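/- Let $N\ge 1$ be an integer and let $L^2_{\rm per,zero}$ be the space of square-integrable, zero-mean, $2\pi N$-periodic functions. Let $P_0$ be the orthogonal projection onto it and $\partial_z^{-2}$ the zero-mean second anti-derivative, i.e. $\partial_z^{-2}e^{inz/N}=-(N/n)^2e^{inz/N}$ for $n\ne0$. For an even $2\pi$-periodic function $U$ put $a=\frac1\pi\int_{-\pi}^{\pi}U(z)\cos z\,dz$. (i) There are $\delta,\varepsilon>0$ and $C$, depending only on $N$, such that for every $\gamma\in(1,1+\delta)$ the equation $$\big((\gamma-U)U'\big)'+U=0$$ has a nonzero smooth even $2\pi$-periodic solution, and for every such solution $U$ the bounded self-adjoint operator $$L_\gamma=P_0\,(-\partial_z^{-2}-\gamma+U):L^2_{\rm per,zero}\to L^2_{\rm per,zero}$$ has the following properties. 1. The spectrum of $L_\gamma$ is real and is the union of the set of its eigenvalues and of the range of the function $-\gamma+U$, which is strictly negative. There are exactly $2N-1$ positive eigenvalues counted with multiplicity; zero is a simple eigenvalue, with eigenfunction $U'$; and there are infinitely many negative eigenvalues. 2. $a^2\le C(\gamma-1)$ and $|U(z)-a\cos z|\le C a^2$ for all $z$.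 The part of the spectrum of $L_\gamma$ in the disc of radius $\varepsilon$ about $0$ is $\{0,\lambda\}$, where $\lambda>0$ is a simple eigenvalue (the one that bifurcates from the double zero eigenvalue at $\gamma=1$, $U=0$), and $\big|\lambda-\tfrac13a^2\big|\le C|a|^3$. (ii) The same holds, with constants $\delta,\varepsilon,C$ of its own, for the modified equation $$\big((\gamma-\tfrac12U^2)U'\big)'+U=0,\qquad L_\gamma=P_0\,(-\partial_z^{-2}-\gamma+\tfrac12U^2),$$ with the range of $-\gamma+\tfrac12U^2$ in property 1, and with $|U(z)-a\cos z|\le C|a|^3$ and $\big|\lambda-\tfrac14a^2\big|\le Ca^4$ in property 2. -/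

import Mathlib

noncomputable section

namespace ReducedOstrovsky

open MeasureTheory AddCircle Set
open scoped ContDiff ENNReal

instance periodPos (N : ℕ) [NeZero N] : Fact (0 < 2 * Real.pi * (N : ℝ)) :=
  ⟨mul_pos Real.two_pi_pos (Nat.cast_pos.mpr (Nat.pos_of_ne_zero (NeZero.ne N)))⟩

/-- Complex square-integrable functions of period `2πN`. The measure is the Haar measure of total
mass one; this only rescales the inner product. -/
abbrev L2per (N : ℕ) [NeZero N] : Type :=
  Lp ℂ 2 (haarAddCircle : Measure (AddCircle (2 * Real.pi * (N : ℝ))))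

/-- Zero-mean functions: the orthogonal complement of the constants. -/
abbrev zeroMean (N : ℕ) [NeZero N] : Submodule ℂ (L2per N) :=
  (Submodule.span ℂ {(fourierLp 2 0 : L2per N)})ᗮ

theorem mem_zeroMean_iff (N : ℕ) [NeZero N] (f : L2per N) :
    f ∈ zeroMean N ↔ ∫ x, f x ∂haarAddCircle = 0 := by
  rw [Submodule.mem_orthogonal_singleton_iff_inner_right, ← coe_fourierBasis,
    ← HilbertBasis.repr_apply_apply, fourierBasis_repr]
  simp [fourierCoeff]

/-- Multiplication of sequences by a bounded sequence `m`, as an operator on `ℓ²(ℤ)`. -/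
def diagOp (m : ℤ → ℂ) (C : ℝ) (hm : ∀ n, ‖m n‖ ≤ C) :
    lp (fun _ : ℤ => ℂ) 2 →L[ℂ] lp (fun _ : ℤ => ℂ) 2 :=
  have hC : 0 ≤ C := (norm_nonneg _).trans (hm 0)
  have key : ∀ (a : lp (fun _ : ℤ => ℂ) 2) (n : ℤ), ‖m n * a n‖ ≤ ‖((C : ℂ) • a) n‖ := by
    intro a n
    rw [lp.coeFn_smul, Pi.smul_apply, norm_smul, norm_mul, Complex.norm_real,
      Real.norm_of_nonneg hC]
    exact mul_le_mul_of_nonneg_right (hm n) (norm_nonneg _)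
  LinearMap.mkContinuous
    { toFun := fun a => ⟨fun n => m n * a n, (lp.memℓp ((C : ℂ) • a)).mono' (key a)⟩
      map_add' := fun a b => by ext n; exact mul_add (m n) (a n) (b n)
      map_smul' := fun c a => by ext n; simp [mul_left_comm] }
    C (fun a => by
      have h : ‖(C : ℂ) • a‖ = C * ‖a‖ := by
        rw [norm_smul, Complex.norm_real, Real.norm_of_nonneg hC]
      rw [← h]
      exact lp.norm_mono (by norm_num) (key a))

/-- The symbol of `-∂_z⁻²` at `e^{inz/N}`: `(N/n)²` for `n ≠ 0`, and `0` for `n = 0`. -/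
def invSymbol (N : ℕ) (n : ℤ) : ℂ :=
  if n = 0 then 0 else ((N : ℂ) / (n : ℂ)) ^ 2

theorem norm_invSymbol_le (N : ℕ) (n : ℤ) : ‖invSymbol N n‖ ≤ (N : ℝ) ^ 2 := by
  unfold invSymbol
  split_ifs with h
  · simp
  · rw [norm_pow, norm_div, Complex.norm_natCast, Complex.norm_intCast]
    have h1 : (1 : ℝ) ≤ |(n : ℝ)| := by exact_mod_cast Int.one_le_abs h
    exact pow_le_pow_left₀ (by positivity) (div_le_self (by positivity) h1) 2

/-- `-∂_z⁻²`, where `∂_z⁻²` is the zero-mean second anti-derivative: the Fourier multiplier with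
symbol `invSymbol N`. -/
def negInvSecondDeriv (N : ℕ) [NeZero N] : L2per N →L[ℂ] L2per N :=
  (fourierBasis.repr.symm.toContinuousLinearEquiv.toContinuousLinearMap).comp
    ((diagOp (invSymbol N) ((N : ℝ) ^ 2) (norm_invSymbol_le N)).comp
      fourierBasis.repr.toContinuousLinearEquiv.toContinuousLinearMap)

theorem fourierCoeff_negInvSecondDeriv (N : ℕ) [NeZero N] (f : L2per N) (n : ℤ) :
    fourierCoeff (negInvSecondDeriv N f) n = invSymbol N n * fourierCoeff f n := by
  rw [← fourierBasis_repr, ← fourierBasis_repr]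
  simp [negInvSecondDeriv, diagOp]

/-- A continuous `2π`-periodic real function, as a function of period `2πN`. -/
def onCircle (N : ℕ) (q : ℝ → ℝ) (hq : Continuous q) (hp : Function.Periodic q (2 * Real.pi)) :
    C(AddCircle (2 * Real.pi * (N : ℝ)), ℂ) where
  toFun x := ((Function.Periodic.lift
    (show Function.Periodic q (2 * Real.pi * (N : ℝ)) by
      simpa [mul_comm] using hp.nat_mul N) x : ℝ) : ℂ)
  continuous_toFun := Complex.continuous_ofReal.comp (hq.quotient_lift _)

theorem onCircle_coe (N : ℕ) (q : ℝ → ℝ) (hq : Continuous q)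
    (hp : Function.Periodic q (2 * Real.pi)) (z : ℝ) :
    onCircle N q hq hp (z : AddCircle (2 * Real.pi * (N : ℝ))) = (q z : ℂ) := rfl

/-- Multiplication by a continuous function of period `2πN` on `L²`. -/
def mulOp (N : ℕ) [NeZero N] (q : C(AddCircle (2 * Real.pi * (N : ℝ)), ℂ)) :
    L2per N →L[ℂ] L2per N :=
  (ContinuousLinearMap.mul ℂ ℂ).holderL haarAddCircle ∞ 2 2
    (ContinuousMap.toLp ∞ haarAddCircle ℂ q)

theorem mulOp_apply (N : ℕ) [NeZero N] (q : C(AddCircle (2 * Real.pi * (N : ℝ)), ℂ))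
    (f : L2per N) : mulOp N q f =ᵐ[haarAddCircle] fun x => q x * f x := by
  have h1 := (ContinuousLinearMap.mul ℂ ℂ).coeFn_holder (r := 2)
    (ContinuousMap.toLp ∞ haarAddCircle ℂ q) f
  have h2 := ContinuousMap.coeFn_toLp (p := ∞) (𝕜 := ℂ)
    (haarAddCircle : Measure (AddCircle (2 * Real.pi * (N : ℝ)))) q
  filter_upwards [h1, h2] with x hx hx2
  rw [← hx2]
  exact hx

/-- The operator `-∂_z⁻² + q` on zero-mean functions of period `2πN`, followed by the orthogonal
projection onto zero-mean functions. -/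
def hessian (N : ℕ) [NeZero N] (q : ℝ → ℝ) (hq : Continuous q)
    (hp : Function.Periodic q (2 * Real.pi)) : zeroMean N →L[ℂ] zeroMean N :=
  (zeroMean N).orthogonalProjectionOnto.comp
    ((negInvSecondDeriv N + mulOp N (onCircle N q hq hp)).comp (zeroMean N).subtypeL)

/-- The eigenspace of `L` for the real number `μ`. -/
abbrev eigenspaceAt {N : ℕ} [NeZero N] (L : zeroMean N →L[ℂ] zeroMean N) (μ : ℝ) :
    Submodule ℂ (zeroMean N) :=
  Module.End.eigenspace (L : zeroMean N →ₗ[ℂ] zeroMean N) (μ : ℂ)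

/-- The set of real eigenvalues of `L`. -/
def realEigenvalues {N : ℕ} [NeZero N] (L : zeroMean N →L[ℂ] zeroMean N) : Set ℝ :=
  {μ | Module.End.HasEigenvalue (L : zeroMean N →ₗ[ℂ] zeroMean N) (μ : ℂ)}

/-- Nonzero smooth even `2π`-periodic solutions `U` of `(c(U) U')' + U = 0`. -/
structure IsWave (c : ℝ → ℝ) (U : ℝ → ℝ) : Prop where
  smooth : ContDiff ℝ ∞ U
  periodic : Function.Periodic U (2 * Real.pi)
  even : ∀ z, U (-z) = U z
  ne_zero : ∃ z, U z ≠ 0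
  ode : ∀ z, deriv (fun x => c (U x) * deriv U x) z + U z = 0

/-- Wave profiles of the reduced Ostrovsky equation: `((γ - U) U')' + U = 0`. -/
abbrev IsOstrovskyWave (γ : ℝ) (U : ℝ → ℝ) : Prop := IsWave (fun u => γ - u) U

/-- Wave profiles of the modified reduced Ostrovsky equation: `((γ - U²/2) U')' + U = 0`. -/
abbrev IsModifiedWave (γ : ℝ) (U : ℝ → ℝ) : Prop := IsWave (fun u => γ - u ^ 2 / 2) U

theorem IsWave.continuous {c U : ℝ → ℝ} (h : IsWave c U) : Continuous U := h.smooth.continuous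

theorem IsWave.continuous_deriv {c U : ℝ → ℝ} (h : IsWave c U) : Continuous (deriv U) :=
  h.smooth.continuous_deriv (by simp)

theorem IsWave.periodic_deriv {c U : ℝ → ℝ} (h : IsWave c U) :
    Function.Periodic (deriv U) (2 * Real.pi) := by
  intro z
  rw [← deriv_comp_add_const]
  congr 1
  funext x
  exact h.periodic x

/-- `L_γ = -∂_z⁻² - γ + U`. -/
def ostrovskyHessian (N : ℕ) [NeZero N] {γ : ℝ} {U : ℝ → ℝ} (h : IsOstrovskyWave γ U) :
    zeroMean N →L[ℂ] zeroMean N :=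
  hessian N (fun z => -γ + U z) (continuous_const.add h.continuous)
    (fun z => by simp only [h.periodic z])

/-- `L_γ = -∂_z⁻² - γ + U²/2`. -/
def modifiedHessian (N : ℕ) [NeZero N] {γ : ℝ} {U : ℝ → ℝ} (h : IsModifiedWave γ U) :
    zeroMean N →L[ℂ] zeroMean N :=
  hessian N (fun z => -γ + U z ^ 2 / 2) (continuous_const.add ((h.continuous.pow 2).div_const 2))
    (fun z => by simp only [h.periodic z])

/-- `v` is the derivative `U'` of the wave profile. -/
def IsDerivOfWave {N : ℕ} [NeZero N] {c U : ℝ → ℝ} (h : IsWave c U) (v : zeroMean N) : Prop :=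
  (v : L2per N) = ContinuousMap.toLp 2 haarAddCircle ℂ
    (onCircle N (deriv U) h.continuous_deriv h.periodic_deriv)

/-- The spectrum of an operator `L = -∂_z⁻² + q` for which `U'` is a zero mode. -/
structure HasStatedSpectrum {N : ℕ} [NeZero N] {c U : ℝ → ℝ} (h : IsWave c U)
    (L : zeroMean N →L[ℂ] zeroMean N) (q : ℝ → ℝ) : Prop where
  /-- The spectrum is real and consists of eigenvalues and of the range of `q`, which is strictly
  negative. -/
  spectrum_eq : spectrum ℂ L = Complex.ofReal '' (realEigenvalues L ∪ range q)
  range_neg : ∀ z, q z < 0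
  /-- There are `2N - 1` positive eigenvalues, counted with multiplicity. -/
  positive : ∃ s : Finset ℝ, (s : Set ℝ) = realEigenvalues L ∩ Ioi 0 ∧
    (∀ μ ∈ s, FiniteDimensional ℂ (eigenspaceAt L μ)) ∧
    ∑ μ ∈ s, Module.finrank ℂ (eigenspaceAt L μ) = 2 * N - 1
  /-- Zero is a simple eigenvalue, with eigenfunction `U'`. -/
  zero_simple : Module.finrank ℂ (eigenspaceAt L 0) = 1
  zero_mode : ∃ v : zeroMean N, IsDerivOfWave h v ∧ eigenspaceAt L 0 = Submodule.span ℂ {v}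
  /-- There are infinitely many negative eigenvalues. -/
  negative : (realEigenvalues L ∩ Iio 0).Infinite

/-- The amplitude of an even profile: its coefficient at `cos z`. -/
def amplitude (U : ℝ → ℝ) : ℝ :=
  Real.pi⁻¹ * ∫ z in (-Real.pi)..Real.pi, U z * Real.cos z

/-- Inside the `ε`-neighbourhood of zero the spectrum of `L` consists of `0` and of one further
point `μ`, which is a positive simple eigenvalue. -/
structure IsBifurcatingEigenvalue {N : ℕ} [NeZero N] (L : zeroMean N →L[ℂ] zeroMean N)
    (ε μ : ℝ) : Prop where
  pos : 0 < μ
  simple : Module.finrank ℂ (eigenspaceAt L μ) = 1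
  spectrum_near_zero : spectrum ℂ L ∩ Metric.ball 0 ε = {0, (μ : ℂ)}

end ReducedOstrovsky

end

/-! At `γ = 1`, `U = 0` the operator is diagonal in the Fourier basis, with eigenvalues `(N/n)² -
1`: there are `2N - 2` positive ones (`0 < |n| < N`), a double zero (`n = ±N`), and negative ones
accumulating at `-1`. For a small wave the multiplication part `q` stays close to `-1`, and the
eigenvalues are counted by min-max with an explicit gap `ε`. Off the modes `|n| ≤ N` the form of `L`
is below `-ε`, so at most `2N` eigenvalues are `≥ -ε`. On the span of the modes `|n| < N` it is
above `ε`, so at least `2N - 2` eigenvalues exceed `ε`. Two places remain.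

One is filled by `U'`: the wave equation says `(q U')' = U`, so `q U'` is a second antiderivative of
`U'` and the two terms of `L U'` cancel. The other is found with an approximate eigenfunction `cos z
+ A cos 2z + B cos 3z`, whose residual at `ρ = a²/3` (or `a²/4`) is `O(|a|³)` (or `O(a⁴)`). By
self-adjointness there is a point of the spectrum that close to `ρ`, hence positive and different
from `0`. The count is now exhausted: both eigenvalues are simple and nothing else lies in `[-ε,
ε]`. This is `exists_bifurcating_eigenvalue`.

Above `max q` the spectrum consists of eigenvalues of finite multiplicity, since for such `μ` the
operator `μ - L` is coercive up to a compact operator (`EssBoundedAbove`). Below `min q` there is no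
spectrum, because the multiplier is non-negative, and each value of `q` lies in the spectrum by
testing with second derivatives of concentrated bumps (`mem_spectrum_hessian`). The same bumps,
placed at a maximum of `q` at dyadic scales, make the form exceed `max q` on infinitely many
mutually orthogonal vectors (`lt_form_bumpVec`); this gives infinitely many eigenvalues, all but
finitely many of them negative.

The waves are controlled through the energy integral. In the variable `y` whose square is the
potential energy, every wave is a uniform rotation up to a change of time (`Profile.exists_angle`),
and the profile `w(y)` is explicit through triple- or double-angle formulas. Existence follows from
the intermediate value theorem for the period, and expansions of profile and period show that every
wave is small and has the asymptotics needed for the approximate eigenfunction. -/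

noncomputable section

namespace ReducedOstrovsky

open MeasureTheory AddCircle Set
open scoped ContDiff ENNReal

/-! ### Spectral consequences of bounds on the quadratic form. -/

section Abstract

variable {H : Type*} [NormedAddCommGroup H] [InnerProductSpace ℂ H]

/-- The quadratic form of `L`. -/
def form (L : H →L[ℂ] H) (v : H) : ℝ := (inner ℂ (L v) v).re

theorem form_sub (L M : H →L[ℂ] H) (v : H) : form (L - M) v = form L v - form M v := by
  simp [form]

theorem form_smul_one (c : ℝ) (v : H) : form ((c : ℂ) • (1 : H →L[ℂ] H)) v = c * ‖v‖ ^ 2 := by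
  have h : (inner ℂ v v).re = ‖v‖ ^ 2 := inner_self_eq_norm_sq (𝕜 := ℂ) v
  rw [← h]
  simp [form]

theorem form_real_smul (c : ℝ) (L : H →L[ℂ] H) (v : H) :
    form ((c : ℂ) • L) v = c * form L v := by
  simp [form]

/-- The essential spectrum of `L` lies below `m`: up to a compact operator, the form of `L` is
bounded by every number above `m`. -/
def EssBoundedAbove (L : H →L[ℂ] H) (m : ℝ) : Prop :=
  ∀ μ > m, ∃ R : H →L[ℂ] H, IsCompactOperator R ∧ ∃ c > 0, ∀ v, form (L - R) v ≤ (μ - c) * ‖v‖ ^ 2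

/-- The eigenspace of `L` for a real number. -/
abbrev realEigenspace (L : H →L[ℂ] H) (μ : ℝ) : Submodule ℂ H :=
  Module.End.eigenspace (L : H →ₗ[ℂ] H) (μ : ℂ)

theorem mem_realEigenspace {L : H →L[ℂ] H} {μ : ℝ} {v : H} :
    v ∈ realEigenspace L μ ↔ L v = (μ : ℂ) • v := by
  simp [realEigenspace]

theorem hasEigenvalue_of_apply_eq {L : H →L[ℂ] H} {μ : ℝ} {v : H} (hv : v ≠ 0)
    (h : L v = (μ : ℂ) • v) : Module.End.HasEigenvalue (L : H →ₗ[ℂ] H) (μ : ℂ) :=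
  Module.End.hasEigenvalue_of_hasEigenvector ⟨mem_realEigenspace.2 h, hv⟩

theorem mem_spectrum_iff_not_isUnit {L : H →L[ℂ] H} {z : ℂ} :
    z ∈ spectrum ℂ L ↔ ¬ IsUnit (z • (1 : H →L[ℂ] H) - L) := by
  rw [spectrum.mem_iff, Algebra.algebraMap_eq_smul_one]

variable [CompleteSpace H]

/-- The form of `μ - S` is at least `c‖v‖²`, and coercive bounded operators are invertible
(Lax–Milgram). -/
theorem isUnit_of_form_le {S : H →L[ℂ] H} {μ c : ℝ} (hc : 0 < c)
    (h : ∀ v, form S v ≤ (μ - c) * ‖v‖ ^ 2) : IsUnit ((μ : ℂ) • (1 : H →L[ℂ] H) - S) := by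
  refine ContinuousLinearMap.isUnit_of_forall_le_norm_inner_map _ (c := ⟨c, hc.le⟩) hc fun v => ?_
  have h1 : form ((μ : ℂ) • (1 : H →L[ℂ] H) - S) v = μ * ‖v‖ ^ 2 - form S v := by
    rw [form_sub, form_smul_one]
  have h2 : form ((μ : ℂ) • (1 : H →L[ℂ] H) - S) v ≤
    ‖inner ℂ (((μ : ℂ) • (1 : H →L[ℂ] H) - S) v) v‖ := Complex.re_le_norm _
  have h3 := h v
  change ‖v‖ ^ 2 * c ≤ _
  nlinarith

theorem not_mem_spectrum_of_form_le {S : H →L[ℂ] H} {μ c : ℝ} (hc : 0 < c)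
    (h : ∀ v, form S v ≤ (μ - c) * ‖v‖ ^ 2) : (μ : ℂ) ∉ spectrum ℂ S := by
  rw [spectrum.notMem_iff, Algebra.algebraMap_eq_smul_one]
  exact isUnit_of_form_le hc h

theorem not_mem_spectrum_of_le_form {S : H →L[ℂ] H} {μ c : ℝ} (hc : 0 < c)
    (h : ∀ v, (μ + c) * ‖v‖ ^ 2 ≤ form S v) : (μ : ℂ) ∉ spectrum ℂ S := by
  have h1 := not_mem_spectrum_of_form_le (S := -S) (μ := -μ) hc (fun v => by
    have := h v
    have h2 : form (-S) v = - form S v := by simp [form]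
    rw [h2]; nlinarith)
  rw [mem_spectrum_iff_not_isUnit, not_not] at h1 ⊢
  rw [← IsUnit.neg_iff]
  convert h1 using 1
  rw [Complex.ofReal_neg]
  module

/-- With `A = μ - (L - R)`, invertible by coercivity, `μ - L = A - R = A (1 - A⁻¹R)`. This reduces
questions about `L` at `μ` to the compact operator `T = A⁻¹R` at `1`. -/
theorem EssBoundedAbove.exists_compact {L : H →L[ℂ] H} {m μ : ℝ} (hL : EssBoundedAbove L m)
    (hμ : m < μ) : ∃ T : H →L[ℂ] H, IsCompactOperator T ∧
      (∃ A : H →L[ℂ] H, IsUnit A ∧ (μ : ℂ) • (1 : H →L[ℂ] H) - L = A * (1 - T)) := by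
  obtain ⟨R, hR, c, hc, h⟩ := hL μ hμ
  obtain ⟨A, hA⟩ := isUnit_of_form_le hc h
  refine ⟨(↑A⁻¹ : H →L[ℂ] H) * R, hR.clm_comp (↑A⁻¹ : H →L[ℂ] H), A, A.isUnit, ?_⟩
  rw [mul_sub, ← mul_assoc, Units.mul_inv, hA, one_mul, mul_one]
  abel

/-- Fredholm alternative: if `1` were not an eigenvalue of `T`, then `1 - T`, hence `μ - L`, would
be invertible; and a fixed vector of `T` is killed by `μ - L`. -/
theorem EssBoundedAbove.hasEigenvalue {L : H →L[ℂ] H} {m μ : ℝ} (hL : EssBoundedAbove L m)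
    (hμ : m < μ) (h : (μ : ℂ) ∈ spectrum ℂ L) :
    Module.End.HasEigenvalue (L : H →ₗ[ℂ] H) (μ : ℂ) := by
  obtain ⟨T, hT, A, hA, hE⟩ := hL.exists_compact hμ
  have h1 : Module.End.HasEigenvalue (T : H →ₗ[ℂ] H) (1 : ℂ) := by
    rw [hT.hasEigenvalue_iff_mem_spectrum one_ne_zero]
    intro h2
    apply h
    rw [spectrum.mem_resolventSet_iff, Algebra.algebraMap_eq_smul_one] at h2 ⊢
    rw [hE]
    rw [one_smul] at h2
    exact hA.mul h2
  obtain ⟨v, hv, hv0⟩ := h1.exists_hasEigenvector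
  refine hasEigenvalue_of_apply_eq hv0 ?_
  have h3 : T v = v := by simpa [Module.End.mem_eigenspace_iff] using hv
  have h4 := congrArg (fun B : H →L[ℂ] H => B v) hE
  simp [h3, sub_eq_zero] at h4
  exact h4.symm

theorem EssBoundedAbove.finiteDimensional {L : H →L[ℂ] H} {m μ : ℝ} (hL : EssBoundedAbove L m)
    (hμ : m < μ) : FiniteDimensional ℂ (realEigenspace L μ) := by
  obtain ⟨T, hT, A, hA, hE⟩ := hL.exists_compact hμ
  have h1 : realEigenspace L μ ≤ Module.End.eigenspace (T : H →ₗ[ℂ] H) 1 := by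
    intro v hv
    rw [mem_realEigenspace] at hv
    have h4 := congrArg (fun B : H →L[ℂ] H => B v) hE
    have h6 : A (v - T v) = 0 := by simpa [hv, sub_eq_zero, eq_comm] using h4
    have h5 := (ContinuousLinearMap.isUnit_iff_bijective.1 hA).1 (h6.trans (map_zero A).symm)
    rw [Module.End.mem_eigenspace_iff]
    simpa using (sub_eq_zero.1 h5).symm
  have := ContinuousLinearMap.finite_dimensional_eigenspace hT (1 : ℂ) one_ne_zero
  exact Submodule.finiteDimensional_of_le h1

/-- `c - L` is self-adjoint with non-negative spectrum, hence a positive operator. This turns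
spectral information back into a bound on the form. -/
theorem form_le_of_spectrum {L : H →L[ℂ] H} (hs : IsSelfAdjoint L) {c : ℝ}
    (h : ∀ μ : ℝ, (μ : ℂ) ∈ spectrum ℂ L → μ ≤ c) (v : H) : form L v ≤ c * ‖v‖ ^ 2 := by
  have hsa : IsSelfAdjoint ((c : ℂ) • (1 : H →L[ℂ] H) - L) := by
    refine IsSelfAdjoint.sub ?_ hs
    rw [IsSelfAdjoint, star_smul, star_one]; simp
  have h0 : 0 ≤ (c : ℂ) • (1 : H →L[ℂ] H) - L := by
    rw [StarOrderedRing.nonneg_iff_spectrum_nonneg (R := ℝ) _ hsa]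
    intro x hx
    rw [← spectrum.algebraMap_mem_iff ℂ] at hx
    have : ((c - x : ℝ) : ℂ) ∈ spectrum ℂ L := by
      rw [mem_spectrum_iff_not_isUnit] at hx ⊢
      intro hu
      apply hx
      have := hu.neg
      convert this using 1
      rw [Complex.ofReal_sub, Complex.coe_algebraMap]
      module
    linarith [h _ this]
  have h1 := (ContinuousLinearMap.nonneg_iff_isPositive _).1 h0
  have h2 := h1.re_inner_nonneg_left v
  change 0 ≤ form ((c : ℂ) • (1 : H →L[ℂ] H) - L) v at h2
  rw [form_sub, form_smul_one] at h2
  linarith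

theorem re_mem_spectrum_of_isSelfAdjoint {L : H →L[ℂ] H} (hs : IsSelfAdjoint L) {z : ℂ}
    (hz : z ∈ spectrum ℂ L) : z = (z.re : ℂ) := hs.mem_spectrum_eq_re hz

/-- An approximate eigenvector detects a point of the spectrum. -/
theorem exists_mem_spectrum_of_approx {L : H →L[ℂ] H} (hs : IsSelfAdjoint L) {ρ η : ℝ}
    (V : H) (h : ‖L V - (ρ : ℂ) • V‖ < η * ‖V‖) :
    ∃ μ : ℝ, (μ : ℂ) ∈ spectrum ℂ L ∧ |μ - ρ| < η := by
  by_contra hcon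
  push Not at hcon
  have hη : 0 < η := by
    by_contra hη
    have := norm_nonneg (L V - (ρ : ℂ) • V)
    have := norm_nonneg V
    nlinarith
  have hρ : IsSelfAdjoint (L - (ρ : ℂ) • (1 : H →L[ℂ] H)) := by
    refine IsSelfAdjoint.sub hs ?_
    rw [IsSelfAdjoint, star_smul, star_one]; simp
  -- If the spectrum of `L` misses `(ρ - η, ρ + η)`, that of `-B²` lies below `-η²`, so `‖B V‖² ≥
  -- η²‖V‖²`, contrary to the hypothesis on `V`.
  set B := L - (ρ : ℂ) • (1 : H →L[ℂ] H) with hB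
  have hB2 : IsSelfAdjoint (-(B ^ 2)) := (hρ.pow 2).neg
  have h1 := form_le_of_spectrum hB2 (c := -η ^ 2) (fun μ hμ => by
    rw [← spectrum.neg_eq, Set.mem_neg, spectrum.map_pow_of_pos _ two_pos] at hμ
    obtain ⟨x, hx, hx2⟩ := hμ
    have hxr := hρ.mem_spectrum_eq_re hx
    have h3 : ((x.re + ρ : ℝ) : ℂ) ∈ spectrum ℂ L := by
      rw [mem_spectrum_iff_not_isUnit] at hx ⊢
      intro hu
      apply hx
      convert hu using 1
      rw [hB, Complex.ofReal_add, ← hxr]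
      module
    have h4 := hcon _ h3
    rw [add_sub_cancel_right] at h4
    have h5 : x.re ^ 2 = -μ := by
      have : ((x.re ^ 2 : ℝ) : ℂ) = ((-μ : ℝ) : ℂ) := by
        push_cast
        rw [← hx2, ← hxr]
      exact_mod_cast this
    have h6 : η ^ 2 ≤ x.re ^ 2 := by
      rw [← sq_abs x.re]
      exact pow_le_pow_left₀ hη.le h4 2
    linarith) V
  have h2 : form (-(B ^ 2)) V = -‖B V‖ ^ 2 := by
    have : form (-(B ^ 2)) V = -(inner ℂ (B (B V)) V).re := by
      simp [form, pow_two]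
    have h7 : inner ℂ (B (B V)) V = inner ℂ (B V) (B V) := hρ.isSymmetric (B V) V
    rw [this, h7]
    congr 1
    exact inner_self_eq_norm_sq (𝕜 := ℂ) (B V)
  have h3 : B V = L V - (ρ : ℂ) • V := by simp [hB]
  rw [h2, h3] at h1
  have h4 := pow_lt_pow_left₀ h (norm_nonneg _) two_ne_zero
  nlinarith

end Abstract

/-! ### Counting eigenvalues by min-max. -/

section Counting

variable {H : Type*} [NormedAddCommGroup H] [InnerProductSpace ℂ H] {L : H →L[ℂ] H}

theorem orthogonalFamily_realEigenspace (hs : (L : H →ₗ[ℂ] H).IsSymmetric) (s : Finset ℝ) :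
    OrthogonalFamily ℂ (fun μ : s => realEigenspace L μ)
      fun μ => (realEigenspace L μ).subtypeₗᵢ :=
  hs.orthogonalFamily_eigenspaces.comp
    (f := fun μ : s => ((μ : ℝ) : ℂ)) (fun _ _ h => Subtype.ext (Complex.ofReal_injective h))

/-- The sum map from a product of eigenspaces. -/
def eigenSum (L : H →L[ℂ] H) (s : Finset ℝ) : (∀ μ : s, realEigenspace L μ) →ₗ[ℂ] H :=
  ∑ μ : s, (realEigenspace L μ).subtype ∘ₗ LinearMap.proj μ

theorem eigenSum_apply (s : Finset ℝ) (v : ∀ μ : s, realEigenspace L μ) :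
    eigenSum L s v = ∑ μ : s, (v μ : H) := by
  simp [eigenSum]

theorem norm_eigenSum_sq (hs : (L : H →ₗ[ℂ] H).IsSymmetric) (s : Finset ℝ)
    (v : ∀ μ : s, realEigenspace L μ) : ‖eigenSum L s v‖ ^ 2 = ∑ μ : s, ‖v μ‖ ^ 2 := by
  rw [eigenSum_apply]
  exact (orthogonalFamily_realEigenspace hs s).norm_sum v Finset.univ

theorem form_eigenSum (hs : (L : H →ₗ[ℂ] H).IsSymmetric) (s : Finset ℝ)
    (v : ∀ μ : s, realEigenspace L μ) :
    form L (eigenSum L s v) = ∑ μ : s, (μ : ℝ) * ‖v μ‖ ^ 2 := by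
  have h1 : L (eigenSum L s v) = ∑ μ : s, ((((μ : ℝ) : ℂ) • v μ : realEigenspace L μ) : H) := by
    rw [eigenSum_apply, map_sum]
    exact Finset.sum_congr rfl fun μ _ => mem_realEigenspace.1 (v μ).2
  have h2 := (orthogonalFamily_realEigenspace hs s).inner_sum
    (fun μ => (((μ : ℝ) : ℂ) • v μ : realEigenspace L μ)) v Finset.univ
  rw [form, h1, eigenSum_apply]
  refine (congrArg Complex.re h2).trans ?_
  rw [Complex.re_sum]
  refine Finset.sum_congr rfl fun μ _ => ?_
  rw [inner_smul_left, Complex.conj_ofReal, Complex.re_ofReal_mul]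
  congr 1
  exact inner_self_eq_norm_sq (𝕜 := ℂ) (v μ)

theorem le_form_eigenSum (hs : (L : H →ₗ[ℂ] H).IsSymmetric) {s : Finset ℝ} {c : ℝ}
    (hc : ∀ μ ∈ s, c ≤ μ) (v : ∀ μ : s, realEigenspace L μ) :
    c * ‖eigenSum L s v‖ ^ 2 ≤ form L (eigenSum L s v) := by
  rw [form_eigenSum hs, norm_eigenSum_sq hs, Finset.mul_sum]
  exact Finset.sum_le_sum fun μ _ => mul_le_mul_of_nonneg_right (hc μ μ.2) (sq_nonneg _)

theorem eigenSum_injective (hs : (L : H →ₗ[ℂ] H).IsSymmetric) (s : Finset ℝ) :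
    Function.Injective (eigenSum L s) := by
  rw [← LinearMap.ker_eq_bot, LinearMap.ker_eq_bot']
  intro v hv
  have h := norm_eigenSum_sq hs s v
  rw [hv, norm_zero, zero_pow two_ne_zero, eq_comm,
    Finset.sum_eq_zero_iff_of_nonneg fun _ _ => sq_nonneg _] at h
  funext μ
  simpa using h μ (Finset.mem_univ _)

/-- If the form of `L` is smaller than `c` on the kernel of `Φ`, then the number of eigenvalues
not smaller than `c` is bounded by the dimension of the target of `Φ`. -/
theorem eigen_injective {W : Type*} [AddCommGroup W] [Module ℂ W]
    (hs : (L : H →ₗ[ℂ] H).IsSymmetric) {c : ℝ} (Φ : H →ₗ[ℂ] W)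
    (h : ∀ v, Φ v = 0 → v ≠ 0 → form L v < c * ‖v‖ ^ 2) {s : Finset ℝ} (hc : ∀ μ ∈ s, c ≤ μ) :
    Function.Injective (Φ ∘ₗ eigenSum L s) := by
  rw [← LinearMap.ker_eq_bot, LinearMap.ker_eq_bot']
  intro v hv
  by_contra hv0
  have h1 : eigenSum L s v ≠ 0 := fun h0 =>
    hv0 (eigenSum_injective hs s (h0.trans (map_zero _).symm))
  exact absurd (h _ hv h1) (not_lt.2 (le_form_eigenSum hs hc v))

theorem finiteDimensional_realEigenspace {W : Type*} [AddCommGroup W] [Module ℂ W]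
    [FiniteDimensional ℂ W] {c : ℝ} (Φ : H →ₗ[ℂ] W)
    (h : ∀ v, Φ v = 0 → v ≠ 0 → form L v < c * ‖v‖ ^ 2) {μ : ℝ} (hμ : c ≤ μ) :
    FiniteDimensional ℂ (realEigenspace L μ) := by
  refine FiniteDimensional.of_injective (Φ ∘ₗ (realEigenspace L μ).subtype) ?_
  rw [← LinearMap.ker_eq_bot, LinearMap.ker_eq_bot']
  intro v hv
  by_contra hv0
  have h1 := h v hv (fun h0 => hv0 (Subtype.ext h0))
  have h2 : form L v = μ * ‖(v : H)‖ ^ 2 := by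
    rw [form, mem_realEigenspace.1 v.2, inner_smul_left, Complex.conj_ofReal,
      Complex.re_ofReal_mul]
    congr 1
    exact inner_self_eq_norm_sq (𝕜 := ℂ) (v : H)
  rw [h2] at h1
  have := mul_le_mul_of_nonneg_right hμ (sq_nonneg ‖(v : H)‖)
  linarith

/-- Upper half of min-max: the sum of the eigenspaces at or above `c` meets `ker Φ` trivially, so it
embeds in `W`. -/
theorem sum_finrank_le {W : Type*} [AddCommGroup W] [Module ℂ W]
    [FiniteDimensional ℂ W] (hs : (L : H →ₗ[ℂ] H).IsSymmetric) {c : ℝ} (Φ : H →ₗ[ℂ] W)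
    (h : ∀ v, Φ v = 0 → v ≠ 0 → form L v < c * ‖v‖ ^ 2) {s : Finset ℝ} (hc : ∀ μ ∈ s, c ≤ μ) :
    ∑ μ ∈ s, Module.finrank ℂ (realEigenspace L μ) ≤ Module.finrank ℂ W := by
  have h1 (μ : s) : FiniteDimensional ℂ (realEigenspace L μ) :=
    finiteDimensional_realEigenspace Φ h (hc μ μ.2)
  have h2 := LinearMap.finrank_le_finrank_of_injective (eigen_injective hs Φ h hc)
  rwa [Module.finrank_pi_fintype, Finset.sum_coe_sort s
    (fun μ => Module.finrank ℂ (realEigenspace L μ))] at h2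

theorem finrank_realEigenspace_pos {μ : ℝ} (hd : FiniteDimensional ℂ (realEigenspace L μ))
    (h : Module.End.HasEigenvalue (L : H →ₗ[ℂ] H) (μ : ℂ)) :
    0 < Module.finrank ℂ (realEigenspace L μ) := by
  rw [Module.finrank_pos_iff]
  exact Submodule.nontrivial_iff_ne_bot.2 h

theorem finite_eigenvalues {W : Type*} [AddCommGroup W] [Module ℂ W]
    [FiniteDimensional ℂ W] (hs : (L : H →ₗ[ℂ] H).IsSymmetric) {c : ℝ} (Φ : H →ₗ[ℂ] W)
    (h : ∀ v, Φ v = 0 → v ≠ 0 → form L v < c * ‖v‖ ^ 2) :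
    {μ : ℝ | c ≤ μ ∧ Module.End.HasEigenvalue (L : H →ₗ[ℂ] H) (μ : ℂ)}.Finite := by
  by_contra hinf
  obtain ⟨t, ht, hcard⟩ := Set.Infinite.exists_subset_card_eq hinf (Module.finrank ℂ W + 1)
  have h1 := sum_finrank_le hs Φ h (s := t) (fun μ hμ => (ht hμ).1)
  have h2 : t.card ≤ ∑ μ ∈ t, Module.finrank ℂ (realEigenspace L μ) := by
    rw [Finset.card_eq_sum_ones]
    exact Finset.sum_le_sum fun μ hμ => finrank_realEigenspace_pos
      (finiteDimensional_realEigenspace Φ h (ht hμ).1) (ht hμ).2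
  omega

/-- The orthogonal projection onto a finite-dimensional subspace is compact. -/
theorem isCompactOperator_starProjection (K : Submodule ℂ H) [FiniteDimensional ℂ K] :
    IsCompactOperator K.starProjection := by
  have : ProperSpace K := FiniteDimensional.proper ℂ K
  exact (isCompactOperator_id (E := K)).comp_clm (K.orthogonalProjectionOnto) |>.clm_comp K.subtypeL

variable [CompleteSpace H]

/-- On the orthogonal complement of the eigenspaces above `c` the form of `L` is bounded
by `c`. -/
theorem form_le_of_orthogonal (hs : IsSelfAdjoint L) {m c : ℝ} (hL : EssBoundedAbove L m)
    (hmc : m ≤ c) {s : Finset ℝ}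
    (hsm : ∀ μ, μ ∈ s ↔ c < μ ∧ Module.End.HasEigenvalue (L : H →ₗ[ℂ] H) (μ : ℂ)) {v : H}
    (hv : ∀ μ ∈ s, ∀ w ∈ realEigenspace L μ, inner ℂ w v = 0) : form L v ≤ c * ‖v‖ ^ 2 := by
  have hfd (μ : s) : FiniteDimensional ℂ (realEigenspace L μ) :=
    hL.finiteDimensional (hmc.trans_lt ((hsm μ).1 μ.2).1)
  obtain ⟨b, hb0, hb⟩ : ∃ b : ℝ, 0 ≤ b ∧ ∀ μ ∈ s, μ - b ≤ c := by
    refine ⟨∑ μ ∈ s, |μ - c|, Finset.sum_nonneg fun _ _ => abs_nonneg _, fun μ hμ => ?_⟩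
    have := Finset.single_le_sum (f := fun μ => |μ - c|) (fun _ _ => abs_nonneg _) hμ
    have := le_abs_self (μ - c)
    linarith
  -- The eigenspaces above `c` are pushed down: `b` is so large that `L - bP` has no eigenvalue
  -- above `c`. An eigenvector of it above `c` is orthogonal to all eigenspaces in `s`, so it is an
  -- eigenvector of `L` above `c` and lies in one of them, a contradiction. As `P` is compact, the
  -- essential bound persists, and `L` and `L - bP` have the same form at `v`.
  set P : H →L[ℂ] H := ∑ μ : s, (realEigenspace L μ).starProjection with hP
  have hPsa : IsSelfAdjoint P := by
    rw [hP, IsSelfAdjoint, star_sum]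
    exact Finset.sum_congr rfl fun μ _ => isSelfAdjoint_starProjection _
  have hPc : IsCompactOperator P := by
    rw [hP]
    refine Finset.sum_induction _ (fun T : H →L[ℂ] H => IsCompactOperator T)
      (fun a b ha hb => ha.add hb) isCompactOperator_zero
      (fun μ _ => isCompactOperator_starProjection _)
  have hPe (μ : s) (w : H) (hw : w ∈ realEigenspace L μ) : P w = w := by
    rw [hP, sum_apply, Finset.sum_eq_single μ]
    · exact Submodule.starProjection_eq_self_iff.2 hw
    · intro ν _ hν
      rw [Submodule.starProjection_apply_eq_zero_iff, Submodule.mem_orthogonal]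
      intro u hu
      exact (orthogonalFamily_realEigenspace hs.isSymmetric s) hν ⟨u, hu⟩ ⟨w, hw⟩
    · simp
  have hPv : P v = 0 := by
    rw [hP, sum_apply]
    refine Finset.sum_eq_zero fun μ _ => ?_
    rw [Submodule.starProjection_apply_eq_zero_iff, Submodule.mem_orthogonal]
    exact hv μ μ.2
  set M : H →L[ℂ] H := L - (b : ℂ) • P with hM
  have hMsa : IsSelfAdjoint M := by
    refine hs.sub ?_
    rw [IsSelfAdjoint, star_smul, hPsa.star_eq]
    simp
  have hMe : EssBoundedAbove M m := by
    intro μ hμ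
    obtain ⟨R, hR, d, hd, h⟩ := hL μ hμ
    refine ⟨R - (b : ℂ) • P, hR.sub (hPc.smul (b : ℂ)), d, hd, fun v => ?_⟩
    have : M - (R - (b : ℂ) • P) = L - R := by rw [hM]; abel
    rw [this]
    exact h v
  have h1 := form_le_of_spectrum hMsa (c := c) (fun μ hμ => by
    by_contra hcμ
    push Not at hcμ
    obtain ⟨w, hw, hw0⟩ := (hMe.hasEigenvalue (hmc.trans_lt hcμ) hμ).exists_hasEigenvector
    replace hw : M w = (μ : ℂ) • w := mem_realEigenspace.1 hw
    have h2 (ν : s) (e : H) (he : e ∈ realEigenspace L ν) : inner ℂ e w = 0 := by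
      have h3 : inner ℂ (M e) w = inner ℂ e (M w) := hMsa.isSymmetric e w
      have h4 : M e = (((ν : ℝ) - b : ℝ) : ℂ) • e := by
        simp only [hM, sub_apply, smul_apply, hPe ν e he,
          mem_realEigenspace.1 he]
        push_cast
        module
      rw [h4, hw, inner_smul_left, inner_smul_right, Complex.conj_ofReal, ← sub_eq_zero,
        ← sub_mul] at h3
      refine (mul_eq_zero.1 h3).resolve_left ?_
      rw [← Complex.ofReal_sub]
      have := hb ν ν.2
      exact Complex.ofReal_ne_zero.2 (by linarith)
    have h3 : P w = 0 := by
      rw [hP, sum_apply]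
      refine Finset.sum_eq_zero fun ν _ => ?_
      rw [Submodule.starProjection_apply_eq_zero_iff, Submodule.mem_orthogonal]
      exact h2 ν
    have h4 : L w = (μ : ℂ) • w := by
      rw [← hw, hM]
      simp [h3]
    have h5 : μ ∈ s := (hsm μ).2 ⟨hcμ, hasEigenvalue_of_apply_eq hw0 h4⟩
    have h6 := h2 ⟨μ, h5⟩ w (mem_realEigenspace.2 h4)
    exact hw0 (inner_self_eq_zero.1 h6)) v
  rw [hM, form_sub, form_real_smul] at h1
  have h2 : form P v = 0 := by rw [form, hPv]; simp
  rw [h2] at h1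
  linarith

/-- If the form of `L` is larger than `c` on the range of the injective map `Ψ`, then there are at
least as many eigenvalues above `c` as the dimension of the source. -/
theorem le_sum_finrank (hs : IsSelfAdjoint L) {m c : ℝ} (hL : EssBoundedAbove L m)
    (hmc : m ≤ c) {s : Finset ℝ}
    (hsm : ∀ μ, μ ∈ s ↔ c < μ ∧ Module.End.HasEigenvalue (L : H →ₗ[ℂ] H) (μ : ℂ))
    {W : Type*} [AddCommGroup W] [Module ℂ W] (Ψ : W →ₗ[ℂ] H)
    (h : ∀ w, w ≠ 0 → c * ‖Ψ w‖ ^ 2 < form L (Ψ w)) :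
    Module.finrank ℂ W ≤ ∑ μ ∈ s, Module.finrank ℂ (realEigenspace L μ) := by
  have hfd (μ : s) : FiniteDimensional ℂ (realEigenspace L μ) :=
    hL.finiteDimensional (hmc.trans_lt ((hsm μ).1 μ.2).1)
  -- For `w` in the kernel, `Ψ w` is orthogonal to all eigenspaces above `c`, where the form is at
  -- most `c`.
  have h1 : Function.Injective (LinearMap.pi fun μ : s =>
      ((realEigenspace L μ).orthogonalProjectionOnto : H →ₗ[ℂ] realEigenspace L μ) ∘ₗ Ψ) := by
    rw [← LinearMap.ker_eq_bot, LinearMap.ker_eq_bot']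
    intro w hw
    by_contra hw0
    refine absurd (h w hw0) (not_lt.2 (form_le_of_orthogonal hs hL hmc hsm fun μ hμ => ?_))
    have h2 := congrFun hw ⟨μ, hμ⟩
    rw [← Submodule.mem_orthogonal, ← Submodule.orthogonalProjectionOnto_eq_zero_iff]
    exact h2
  have h2 := LinearMap.finrank_le_finrank_of_injective h1
  rwa [Module.finrank_pi_fintype, Finset.sum_coe_sort s
    (fun μ => Module.finrank ℂ (realEigenspace L μ))] at h2

/-- The vectors are orthogonal for the inner product and for the form of `L`, so the form exceeds
`m` on the span of any finite number of them. If the total multiplicity `n` above `m` were finite,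
`n + 1` of them would contradict `le_sum_finrank`. -/
theorem infinite_eigenvalues (hs : IsSelfAdjoint L) {m : ℝ} (hL : EssBoundedAbove L m)
    (u : ℕ → H) (hu : ∀ i, m * ‖u i‖ ^ 2 < form L (u i))
    (huo : ∀ i j, i ≠ j → inner ℂ (u i) (u j) = 0 ∧ inner ℂ (L (u i)) (u j) = 0) :
    {μ : ℝ | m < μ ∧ Module.End.HasEigenvalue (L : H →ₗ[ℂ] H) (μ : ℂ)}.Infinite := by
  intro hfin
  have hsm (μ : ℝ) : μ ∈ hfin.toFinset ↔
      m < μ ∧ Module.End.HasEigenvalue (L : H →ₗ[ℂ] H) (μ : ℂ) := by simp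
  set n := ∑ μ ∈ hfin.toFinset, Module.finrank ℂ (realEigenspace L μ) with hn
  let Ψ : (Fin (n + 1) → ℂ) →ₗ[ℂ] H := Fintype.linearCombination ℂ (fun i : Fin (n + 1) => u i)
  have hΨ (w : Fin (n + 1) → ℂ) : Ψ w = ∑ i, w i • u i := Fintype.linearCombination_apply _ _ _
  have key (B : H →L[ℂ] H) (hB : ∀ i j, i ≠ j → inner ℂ (B (u i)) (u j) = 0)
      (w : Fin (n + 1) → ℂ) : form B (Ψ w) = ∑ i, ‖w i‖ ^ 2 * form B (u i) := by
    rw [form, hΨ, map_sum, sum_inner, Complex.re_sum]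
    refine Finset.sum_congr rfl fun i _ => ?_
    rw [inner_sum, Finset.sum_eq_single i]
    · rw [map_smul, inner_smul_left, inner_smul_right, ← mul_assoc, RCLike.conj_mul]
      rw [form]
      norm_cast
      exact Complex.re_ofReal_mul _ _
    · intro j _ hj
      rw [map_smul, inner_smul_left, inner_smul_right, hB i j (fun h => hj (Fin.ext h.symm))]
      simp
    · simp
  have h1 := le_sum_finrank hs hL le_rfl hsm Ψ (fun w hw => by
    have e1 := key L (fun i j hij => (huo i j hij).2) w
    have e2 := key ((m : ℂ) • 1) (fun i j hij => by
      simp [(huo i j hij).1]) w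
    rw [form_smul_one] at e2
    rw [e1, e2]
    obtain ⟨i, hi⟩ := Function.ne_iff.1 hw
    refine Finset.sum_lt_sum (fun j _ => ?_) ⟨i, Finset.mem_univ _, ?_⟩
    · rw [form_smul_one]
      exact mul_le_mul_of_nonneg_left (hu j).le (sq_nonneg _)
    · rw [form_smul_one]
      exact mul_lt_mul_of_pos_left (hu i) (by have := norm_pos_iff.2 hi; positivity))
  rw [Module.finrank_fintype_fun_eq_card, Fintype.card_fin] at h1
  omega

/-- The counting of eigenvalues of a perturbation of an operator with a double zero eigenvalue, one
zero eigenvalue being preserved and the other one being located by an approximate eigenvector. -/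
theorem exists_bifurcating_eigenvalue (hs : IsSelfAdjoint L) {N : ℕ} (hN : 1 ≤ N) {m ρ η ε : ℝ}
    (hL : EssBoundedAbove L m) (hm : m < -ε) {W₁ W₂ : Type*} [AddCommGroup W₁] [Module ℂ W₁]
    [FiniteDimensional ℂ W₁] [AddCommGroup W₂] [Module ℂ W₂] (Φ : H →ₗ[ℂ] W₁)
    (hW₁ : Module.finrank ℂ W₁ = 2 * N)
    (hΦ : ∀ v, Φ v = 0 → v ≠ 0 → form L v < -ε * ‖v‖ ^ 2) (Ψ : W₂ →ₗ[ℂ] H)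
    (hW₂ : Module.finrank ℂ W₂ = 2 * N - 2)
    (hΨ : ∀ w, w ≠ 0 → ε * ‖Ψ w‖ ^ 2 < form L (Ψ w))
    {v₀ : H} (hv₀ : v₀ ≠ 0) (hLv₀ : L v₀ = 0) (V : H) (hV : ‖L V - (ρ : ℂ) • V‖ < η * ‖V‖)
    (hρ : 0 < ρ - η) (hρε : ρ + η < ε) (u : ℕ → H) (hu : ∀ i, m * ‖u i‖ ^ 2 < form L (u i))
    (huo : ∀ i j, i ≠ j → inner ℂ (u i) (u j) = 0 ∧ inner ℂ (L (u i)) (u j) = 0) :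
    ∃ l : ℝ, 0 < l ∧ |l - ρ| < η ∧ Module.finrank ℂ (realEigenspace L l) = 1 ∧
      Module.finrank ℂ (realEigenspace L 0) = 1 ∧
      (∃ s : Finset ℝ,
        (s : Set ℝ) = {μ : ℝ | Module.End.HasEigenvalue (L : H →ₗ[ℂ] H) (μ : ℂ)} ∩ Ioi 0 ∧
        (∀ μ ∈ s, FiniteDimensional ℂ (realEigenspace L μ)) ∧
        ∑ μ ∈ s, Module.finrank ℂ (realEigenspace L μ) = 2 * N - 1) ∧
      ({μ : ℝ | Module.End.HasEigenvalue (L : H →ₗ[ℂ] H) (μ : ℂ)} ∩ Iio 0).Infinite ∧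
      spectrum ℂ L ∩ Metric.ball 0 ε = {0, (l : ℂ)} := by
  obtain ⟨l, hl, hlη⟩ := exists_mem_spectrum_of_approx hs V hV
  have hl2 := abs_lt.1 hlη
  have hl0 : 0 < l := by linarith
  have hlε : l < ε := by linarith
  have hε : 0 < ε := hl0.trans hlε
  have hle := hL.hasEigenvalue (show m < l by linarith) hl
  have h0e : Module.End.HasEigenvalue (L : H →ₗ[ℂ] H) ((0 : ℝ) : ℂ) :=
    hasEigenvalue_of_apply_eq hv₀ (by simpa using hLv₀)
  have hfin := finite_eigenvalues hs.isSymmetric Φ hΦ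
  set A := hfin.toFinset with hA
  have memA (μ : ℝ) : μ ∈ A ↔ -ε ≤ μ ∧ Module.End.HasEigenvalue (L : H →ₗ[ℂ] H) (μ : ℂ) := by
    simp [hA]
  set B := A.filter (ε < ·) with hB
  have memB (μ : ℝ) : μ ∈ B ↔ ε < μ ∧ Module.End.HasEigenvalue (L : H →ₗ[ℂ] H) (μ : ℂ) := by
    rw [hB, Finset.mem_filter, memA]
    constructor
    · exact fun h => ⟨h.2, h.1.2⟩
    · exact fun h => ⟨⟨by linarith [h.1], h.2⟩, h.1⟩
  have hfd (μ : ℝ) (hμ : μ ∈ A) : FiniteDimensional ℂ (realEigenspace L μ) :=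
    finiteDimensional_realEigenspace Φ hΦ ((memA μ).1 hμ).1
  have hpos (μ : ℝ) (hμ : μ ∈ A) : 0 < Module.finrank ℂ (realEigenspace L μ) :=
    finrank_realEigenspace_pos (hfd μ hμ) ((memA μ).1 hμ).2
  have hAle := sum_finrank_le hs.isSymmetric Φ hΦ (s := A) (fun μ hμ => ((memA μ).1 hμ).1)
  rw [hW₁] at hAle
  have hBge := le_sum_finrank hs hL (by linarith) memB Ψ hΨ
  rw [hW₂] at hBge
  have hlA : l ∈ A := (memA l).2 ⟨by linarith, hle⟩
  have h0A : (0 : ℝ) ∈ A := (memA 0).2 ⟨by linarith, h0e⟩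
  have hlB : l ∉ B := fun h => by linarith [((memB l).1 h).1]
  have h0B : (0 : ℝ) ∉ insert l B := by
    rw [Finset.mem_insert]
    rintro (h | h)
    · exact hl0.ne h
    · linarith [((memB 0).1 h).1]
  have hsub : insert 0 (insert l B) ⊆ A := by
    intro μ hμ
    simp only [Finset.mem_insert] at hμ
    rcases hμ with rfl | rfl | hμ
    · exact h0A
    · exact hlA
    · exact Finset.filter_subset _ _ hμ
  have hsplit := Finset.sum_sdiff (f := fun μ => Module.finrank ℂ (realEigenspace L μ)) hsub
  rw [Finset.sum_insert h0B, Finset.sum_insert hlB] at hsplit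
  have hp0 := hpos 0 h0A
  have hpl := hpos l hlA
  -- `B` contributes at least `2N - 2`, and `0` and `l` at least one each, while the total over `A`
  -- is at most `2N`. So `A` has no further element, and all these bounds are equalities.
  have hAeq : A = insert 0 (insert l B) := by
    refine Finset.Subset.antisymm (fun μ hμ => ?_) hsub
    by_contra hμ2
    have h1 := Finset.single_le_sum (f := fun μ => Module.finrank ℂ (realEigenspace L μ))
      (fun _ _ => Nat.zero_le _) (Finset.mem_sdiff.2 ⟨hμ, hμ2⟩)
    have h2 := hpos μ hμ
    omega
  refine ⟨l, hl0, hlη, by omega, by omega, ⟨insert l B, ?_, ?_, ?_⟩, ?_, ?_⟩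
  · ext μ
    simp only [Finset.coe_insert, mem_insert_iff, Finset.mem_coe, mem_inter_iff, mem_ofPred_eq,
      mem_Ioi]
    constructor
    · rintro (rfl | h)
      · exact ⟨hle, hl0⟩
      · exact ⟨((memB μ).1 h).2, by linarith [((memB μ).1 h).1]⟩
    · rintro ⟨h1, h2⟩
      have h3 : μ ∈ A := (memA μ).2 ⟨by linarith, h1⟩
      rw [hAeq, Finset.mem_insert] at h3
      exact Finset.mem_insert.1 (h3.resolve_left h2.ne')
  · exact fun μ hμ => hfd μ (hsub (Finset.mem_insert_of_mem hμ))
  · rw [Finset.sum_insert hlB]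
    omega
  -- Infinitely many eigenvalues exceed `m`, but only finitely many are at least `-ε`.
  · refine ((infinite_eigenvalues hs hL u hu huo).sdiff hfin).mono ?_
    rintro μ ⟨⟨h1, h2⟩, h3⟩
    refine ⟨h2, ?_⟩
    simp only [mem_ofPred_eq, not_and] at h3
    by_contra h4
    exact h3 (by have := not_lt.1 (show ¬ μ < 0 from h4); linarith) h2
  · ext z
    simp only [mem_inter_iff, mem_ball_zero_iff, mem_insert_iff, mem_singleton_iff]
    constructor
    · rintro ⟨h1, h2⟩
      have hz := re_mem_spectrum_of_isSelfAdjoint hs h1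
      rw [hz] at h1 h2 ⊢
      rw [Complex.norm_real, Real.norm_eq_abs, abs_lt] at h2
      have h3 : z.re ∈ A := (memA _).2 ⟨h2.1.le, hL.hasEigenvalue (by linarith) h1⟩
      rw [hAeq, Finset.mem_insert, Finset.mem_insert] at h3
      rcases h3 with h3 | h3 | h3
      · left; rw [h3]; simp
      · right; rw [h3]
      · linarith [((memB _).1 h3).1]
    · rintro (rfl | rfl)
      · refine ⟨?_, by simpa using hε⟩
        rw [ContinuousLinearMap.spectrum_eq]
        simpa using h0e.mem_spectrum
      · refine ⟨hl, ?_⟩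
        rw [Complex.norm_real, Real.norm_eq_abs, abs_of_pos hl0]
        exact hlε

end Counting

/-! ### The multiplier and the multiplication operator as quadratic forms. -/

section Concrete

/-- The modes with `|n| ≤ M`, `n ≠ 0`. -/
def lowModes (M : ℕ) : Finset ℤ := (Finset.Icc (-M : ℤ) M).erase 0

theorem mem_lowModes {M : ℕ} {n : ℤ} : n ∈ lowModes M ↔ n ≠ 0 ∧ |n| ≤ M := by
  rw [lowModes, Finset.mem_erase, Finset.mem_Icc, abs_le]

theorem card_lowModes (M : ℕ) : (lowModes M).card = 2 * M := by
  rw [lowModes, Finset.card_erase_of_mem (by simp), Int.card_Icc]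
  omega

theorem sq_div_le_of_not_mem_lowModes {N M : ℕ} {n : ℤ} (hn : n ≠ 0) (h : n ∉ lowModes M) :
    ((N : ℝ) / n) ^ 2 ≤ ((N : ℝ) / (M + 1)) ^ 2 := by
  have h1 : (M : ℤ) + 1 ≤ |n| := by
    by_contra h2
    exact h (mem_lowModes.2 ⟨hn, by omega⟩)
  have h2 : (M : ℝ) + 1 ≤ |(n : ℝ)| := by exact_mod_cast h1
  rw [← sq_abs ((N : ℝ) / n), abs_div, Nat.abs_cast]
  gcongr

variable {N : ℕ} [NeZero N]

theorem invSymbol_eq_ofReal (N : ℕ) (n : ℤ) :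
    invSymbol N n = ((if n = 0 then 0 else ((N : ℝ) / n) ^ 2 : ℝ) : ℂ) := by
  unfold invSymbol
  split_ifs <;> simp

theorem inner_ofReal_mul_left (t : ℝ) (z w : ℂ) : inner ℂ ((t : ℂ) * z) w = t * inner ℂ z w := by
  simp only [RCLike.inner_apply, map_mul, Complex.conj_ofReal]
  ring

theorem inner_ofReal_mul_right (t : ℝ) (z w : ℂ) : inner ℂ z ((t : ℂ) * w) = t * inner ℂ z w := by
  simp only [RCLike.inner_apply]
  ring

theorem hasSum_inner_fourierCoeff (f g : L2per N) :
    HasSum (fun n => inner ℂ (fourierCoeff f n) (fourierCoeff g n)) (inner ℂ f g) := by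
  have h := lp.hasSum_inner (𝕜 := ℂ) (fourierBasis.repr f) (fourierBasis.repr g)
  rw [LinearIsometryEquiv.inner_map_map] at h
  simpa only [fourierBasis_repr] using h

theorem inner_negInvSecondDeriv_left (f g : L2per N) :
    inner ℂ (negInvSecondDeriv N f) g = inner ℂ f (negInvSecondDeriv N g) := by
  refine (hasSum_inner_fourierCoeff _ _).unique ?_
  convert hasSum_inner_fourierCoeff f (negInvSecondDeriv N g) using 2 with n
  rw [fourierCoeff_negInvSecondDeriv, fourierCoeff_negInvSecondDeriv, invSymbol_eq_ofReal,
    inner_ofReal_mul_left, inner_ofReal_mul_right]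

theorem hasSum_norm_sq_fourierCoeff (f : L2per N) :
    HasSum (fun n => ‖fourierCoeff f n‖ ^ 2) (‖f‖ ^ 2) := by
  have h := Complex.hasSum_re (hasSum_inner_fourierCoeff f f)
  have e1 (z : ℂ) : (inner ℂ z z).re = ‖z‖ ^ 2 := inner_self_eq_norm_sq (𝕜 := ℂ) z
  have e2 : (inner ℂ f f).re = ‖f‖ ^ 2 := inner_self_eq_norm_sq (𝕜 := ℂ) f
  simpa only [e1, e2] using h

theorem hasSum_re_inner_negInvSecondDeriv (f : L2per N) :
    HasSum (fun n : ℤ => (if n = 0 then 0 else ((N : ℝ) / n) ^ 2) * ‖fourierCoeff f n‖ ^ 2)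
      (inner ℂ (negInvSecondDeriv N f) f).re := by
  have h := Complex.hasSum_re (hasSum_inner_fourierCoeff (negInvSecondDeriv N f) f)
  have e1 (z : ℂ) : (inner ℂ z z).re = ‖z‖ ^ 2 := inner_self_eq_norm_sq (𝕜 := ℂ) z
  convert h using 2 with n
  rw [fourierCoeff_negInvSecondDeriv, invSymbol_eq_ofReal, inner_ofReal_mul_left,
    Complex.re_ofReal_mul, e1]

theorem inner_mulOp_left {q : C(AddCircle (2 * Real.pi * (N : ℝ)), ℂ)}
    (hq : ∀ x, (starRingEnd ℂ) (q x) = q x) (f g : L2per N) :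
    inner ℂ (mulOp N q f) g = inner ℂ f (mulOp N q g) := by
  rw [L2.inner_def, L2.inner_def]
  refine integral_congr_ae ?_
  filter_upwards [mulOp_apply N q f, mulOp_apply N q g] with x h1 h2
  rw [h1, h2]
  simp only [RCLike.inner_apply, map_mul, hq]
  ring

theorem re_inner_mulOp_le {q : C(AddCircle (2 * Real.pi * (N : ℝ)), ℂ)} {r : ℝ → ℝ}
    (hr : ∀ x : ℝ, q x = (r x : ℂ)) {c : ℝ} (hc : ∀ x, r x ≤ c) (f : L2per N) :
    (inner ℂ (mulOp N q f) f).re ≤ c * ‖f‖ ^ 2 := by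
  have e2 : (inner ℂ f f).re = ‖f‖ ^ 2 := inner_self_eq_norm_sq (𝕜 := ℂ) f
  rw [← e2, L2.inner_def, L2.inner_def]
  have i1 := L2.integrable_inner (𝕜 := ℂ) (mulOp N q f) f
  have i2 := L2.integrable_inner (𝕜 := ℂ) f f
  have h1 : ∫ a, (inner ℂ (mulOp N q f a) (f a)).re ∂haarAddCircle = _ := integral_re i1
  have h2 : ∫ a, (inner ℂ (f a) (f a)).re ∂haarAddCircle = _ := integral_re i2
  suffices h : ∫ a, (inner ℂ (mulOp N q f a) (f a)).re ∂haarAddCircle ≤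
      c * ∫ a, (inner ℂ (f a) (f a)).re ∂haarAddCircle by
    rw [h1, h2] at h
    exact h
  rw [← integral_const_mul]
  refine integral_mono_ae i1.re (i2.re.const_mul c) ?_
  filter_upwards [mulOp_apply N q f] with x hx
  rw [hx]
  induction x using QuotientAddGroup.induction_on with
  | H x =>
    have h3 : q (x : AddCircle (2 * Real.pi * (N : ℝ))) = (r x : ℂ) := hr x
    have e3 (z : ℂ) : (inner ℂ z z).re = ‖z‖ ^ 2 := inner_self_eq_norm_sq (𝕜 := ℂ) z
    rw [h3, inner_ofReal_mul_left, Complex.re_ofReal_mul, e3]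
    exact mul_le_mul_of_nonneg_right (hc x) (sq_nonneg _)

theorem fourierCoeff_zero_of_mem (v : zeroMean N) : fourierCoeff (v : L2per N) 0 = 0 := by
  have h := (mem_zeroMean_iff N v).1 v.2
  simpa [fourierCoeff] using h

variable {q : ℝ → ℝ} {hq : Continuous q} {hp : Function.Periodic q (2 * Real.pi)}

theorem inner_hessian_left (v w : zeroMean N) :
    inner ℂ (hessian N q hq hp v) w =
      inner ℂ (negInvSecondDeriv N v) (w : L2per N) +
        inner ℂ (mulOp N (onCircle N q hq hp) v) (w : L2per N) := by
  simp only [hessian, ContinuousLinearMap.comp_apply, Submodule.subtypeL_apply, add_apply]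
  rw [Submodule.inner_orthogonalProjectionOnto_eq_of_mem_right, inner_add_left]

theorem form_hessian (v : zeroMean N) :
    form (hessian N q hq hp) v = (inner ℂ (negInvSecondDeriv N v) (v : L2per N)).re +
      (inner ℂ (mulOp N (onCircle N q hq hp) v) (v : L2per N)).re := by
  rw [form, inner_hessian_left, Complex.add_re]

theorem isSelfAdjoint_hessian : IsSelfAdjoint (hessian N q hq hp) := by
  rw [ContinuousLinearMap.isSelfAdjoint_iff_isSymmetric]
  intro v w
  change inner ℂ (hessian N q hq hp v) w = inner ℂ v (hessian N q hq hp w)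
  rw [← inner_conj_symm v, inner_hessian_left, inner_hessian_left, map_add, inner_conj_symm,
    inner_conj_symm, inner_negInvSecondDeriv_left, inner_mulOp_left]
  intro x
  exact Complex.conj_ofReal _

theorem hasSum_norm_sq_zeroMean (v : zeroMean N) :
    HasSum (fun n => ‖fourierCoeff (v : L2per N) n‖ ^ 2) (‖v‖ ^ 2) :=
  hasSum_norm_sq_fourierCoeff (v : L2per N)

/-- The Fourier coefficient as a linear functional on zero-mean functions. -/
def coeffL (n : ℤ) : zeroMean N →L[ℂ] ℂ :=
  (innerSL ℂ (fourierLp 2 n : L2per N)).comp (zeroMean N).subtypeL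

theorem coeffL_apply (n : ℤ) (v : zeroMean N) : coeffL n v = fourierCoeff (v : L2per N) n := by
  rw [← fourierBasis_repr, HilbertBasis.repr_apply_apply, coe_fourierBasis]
  rfl

/-- The form of the Hessian with finitely many Fourier modes removed. -/
theorem re_inner_negInvSecondDeriv_le (v : zeroMean N) {s : Finset ℤ} {c : ℝ}
    (hc : ∀ n : ℤ, n ≠ 0 → n ∉ s → ((N : ℝ) / n) ^ 2 ≤ c) (hc0 : 0 ≤ c) :
    (inner ℂ (negInvSecondDeriv N v) (v : L2per N)).re ≤
      c * ‖v‖ ^ 2 + (N : ℝ) ^ 2 * ∑ n ∈ s, ‖fourierCoeff (v : L2per N) n‖ ^ 2 := by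
  have h1 := hasSum_re_inner_negInvSecondDeriv (v : L2per N)
  have h2 := (hasSum_norm_sq_zeroMean v).mul_left c
  have h3 : HasSum (fun n => if n ∈ s then (N : ℝ) ^ 2 * ‖fourierCoeff (v : L2per N) n‖ ^ 2 else 0)
      ((N : ℝ) ^ 2 * ∑ n ∈ s, ‖fourierCoeff (v : L2per N) n‖ ^ 2) := by
    have := hasSum_sum_of_ne_finset_zero (L := SummationFilter.unconditional ℤ)
      (f := fun n => if n ∈ s then (N : ℝ) ^ 2 * ‖fourierCoeff (v : L2per N) n‖ ^ 2 else 0)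
      (s := s) (fun b hb => if_neg hb)
    rwa [Finset.sum_ite_mem, Finset.inter_self, ← Finset.mul_sum] at this
  refine hasSum_le (fun n => ?_) h1 (h2.add h3)
  have hsq := sq_nonneg ‖fourierCoeff (v : L2per N) n‖
  split_ifs with h4 h5 h5
  · have : 0 ≤ (N : ℝ) ^ 2 := sq_nonneg _
    nlinarith [mul_nonneg hc0 hsq]
  · nlinarith [mul_nonneg hc0 hsq]
  · have h6 : ((N : ℝ) / n) ^ 2 ≤ (N : ℝ) ^ 2 := by
      have h := norm_invSymbol_le N n
      rw [invSymbol_eq_ofReal, if_neg h4, Complex.norm_real, Real.norm_of_nonneg (sq_nonneg _)] at h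
      exact h
    nlinarith [mul_nonneg hc0 hsq, mul_le_mul_of_nonneg_right h6 hsq]
  · nlinarith [mul_le_mul_of_nonneg_right (hc n h4 h5) hsq]

theorem le_re_inner_negInvSecondDeriv (v : zeroMean N) {s : Finset ℤ} {c : ℝ}
    (hc : ∀ n : ℤ, n ≠ 0 → n ∈ s → c ≤ ((N : ℝ) / n) ^ 2)
    (hv : ∀ n, n ∉ s → fourierCoeff (v : L2per N) n = 0) :
    c * ‖v‖ ^ 2 ≤ (inner ℂ (negInvSecondDeriv N v) (v : L2per N)).re := by
  refine hasSum_le (fun n => ?_) ((hasSum_norm_sq_zeroMean v).mul_left c)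
    (hasSum_re_inner_negInvSecondDeriv (v : L2per N))
  by_cases hn : n = 0
  · subst hn
    simp [fourierCoeff_zero_of_mem]
  · rw [if_neg hn]
    by_cases hs : n ∈ s
    · exact mul_le_mul_of_nonneg_right (hc n hn hs) (sq_nonneg _)
    · simp [hv n hs]

theorem re_inner_negInvSecondDeriv_nonneg (f : L2per N) :
    0 ≤ (inner ℂ (negInvSecondDeriv N f) f).re := by
  refine (hasSum_re_inner_negInvSecondDeriv f).nonneg (fun n => mul_nonneg ?_ (sq_nonneg _))
  split_ifs
  · exact le_rfl
  · exact sq_nonneg _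

theorem le_re_inner_mulOp {q : C(AddCircle (2 * Real.pi * (N : ℝ)), ℂ)} {r : ℝ → ℝ}
    (hr : ∀ x : ℝ, q x = (r x : ℂ)) {c : ℝ} (hc : ∀ x, c ≤ r x) (f : L2per N) :
    c * ‖f‖ ^ 2 ≤ (inner ℂ (mulOp N q f) f).re := by
  have h := re_inner_mulOp_le (q := -q) (r := fun x => - r x) (fun x => by simp [hr])
    (c := -c) (fun x => neg_le_neg (hc x)) f
  have h2 : mulOp N (-q) f = -mulOp N q f := by
    refine Lp.ext ?_
    filter_upwards [mulOp_apply N q f, mulOp_apply N (-q) f, Lp.coeFn_neg (mulOp N q f)]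
      with x h1 h2 h3
    rw [h2, h3, Pi.neg_apply, h1]
    simp
  rw [h2, inner_neg_left, Complex.neg_re] at h
  linarith

/-- On the modes `|n| > M` the symbol is at most `(N/(M+1))²`, as small as desired, and the finitely
many other modes are absorbed in a finite-rank operator. Only `q` is left in the essential bound. -/
theorem essBoundedAbove_hessian {m : ℝ} (hm : ∀ x, q x ≤ m) :
    EssBoundedAbove (hessian N q hq hp) m := by
  intro μ hμ
  obtain ⟨M, hM⟩ : ∃ M : ℕ, ((N : ℝ) / (M + 1)) ^ 2 ≤ (μ - m) / 2 := by
    have : Filter.Tendsto (fun M : ℕ => ((N : ℝ) / (M + 1)) ^ 2) Filter.atTop (nhds (0 ^ 2)) :=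
      ((tendsto_const_div_atTop_nhds_zero_nat (N : ℝ)).comp (Filter.tendsto_add_atTop_nat 1)).pow 2
        |>.congr (fun n => by simp)
    rw [zero_pow two_ne_zero] at this
    exact ((this.eventually (gt_mem_nhds (show (0 : ℝ) < (μ - m) / 2 by linarith))).exists).imp
      fun _ h => h.le
  -- `N²` bounds the symbol on every mode, so subtracting `R` removes at least what the low modes
  -- contribute.
  let R : zeroMean N →L[ℂ] zeroMean N :=
    (((N : ℝ) ^ 2 : ℝ) : ℂ) • ∑ n ∈ lowModes M, (ContinuousLinearMap.adjoint (coeffL n)).comp (coeffL n)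
  have hR : IsCompactOperator R := by
    refine IsCompactOperator.smul
      (f := (∑ n ∈ lowModes M, (ContinuousLinearMap.adjoint (coeffL n)).comp (coeffL n) :
        zeroMean N →L[ℂ] zeroMean N)) ?_ (((N : ℝ) ^ 2 : ℝ) : ℂ)
    refine Finset.sum_induction _ (fun T : zeroMean N →L[ℂ] zeroMean N => IsCompactOperator T)
      (fun a b ha hb => ha.add hb) isCompactOperator_zero (fun n _ => ?_)
    exact ((isCompactOperator_id (E := ℂ)).comp_clm (coeffL (N := N) n)).clm_comp
      (ContinuousLinearMap.adjoint (coeffL (N := N) n))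
  refine ⟨R, hR, (μ - m) / 2, by linarith, fun v => ?_⟩
  have hRf : form R v = (N : ℝ) ^ 2 * ∑ n ∈ lowModes M, ‖fourierCoeff (v : L2per N) n‖ ^ 2 := by
    have e1 (z : ℂ) : (inner ℂ z z).re = ‖z‖ ^ 2 := inner_self_eq_norm_sq (𝕜 := ℂ) z
    rw [form_real_smul, form, sum_apply, sum_inner, Complex.re_sum]
    congr 1
    refine Finset.sum_congr rfl fun n _ => ?_
    rw [ContinuousLinearMap.comp_apply, ContinuousLinearMap.adjoint_inner_left, e1, coeffL_apply]
  rw [form_sub, form_hessian, hRf]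
  have h1 := re_inner_negInvSecondDeriv_le v (s := lowModes M)
    (fun n hn hs => (sq_div_le_of_not_mem_lowModes hn hs).trans hM) (by linarith)
  have h2 := re_inner_mulOp_le (q := onCircle N q hq hp) (r := q) (fun x => rfl) hm (v : L2per N)
  have h3 : ‖(v : L2per N)‖ = ‖v‖ := rfl
  rw [h3] at h2
  nlinarith

end Concrete

/-! ### Continuous functions in `L²`, and the Hessian on second derivatives. -/

section CircleFunctions

variable {N : ℕ} [NeZero N]

/-- The element of `L²` given by a continuous function. -/
abbrev lpOf (f : C(AddCircle (2 * Real.pi * (N : ℝ)), ℂ)) : L2per N :=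
  ContinuousMap.toLp 2 haarAddCircle ℂ f

theorem fourierLp_mem_zeroMean {n : ℤ} (hn : n ≠ 0) : (fourierLp 2 n : L2per N) ∈ zeroMean N := by
  rw [Submodule.mem_orthogonal_singleton_iff_inner_right]
  exact orthonormal_fourier.2 hn.symm

theorem fourierCoeff_orthogonalProjectionOnto (f : L2per N) (n : ℤ) :
    fourierCoeff ((zeroMean N).orthogonalProjectionOnto f : L2per N) n =
      if n = 0 then 0 else fourierCoeff f n := by
  split_ifs with h
  · subst h
    exact fourierCoeff_zero_of_mem _
  · rw [← fourierBasis_repr, ← fourierBasis_repr, HilbertBasis.repr_apply_apply,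
      HilbertBasis.repr_apply_apply, coe_fourierBasis]
    exact Submodule.inner_orthogonalProjectionOnto_eq_of_mem_left
      ⟨_, fourierLp_mem_zeroMean h⟩ f

theorem ext_fourierCoeff {f g : L2per N} (h : ∀ n, fourierCoeff f n = fourierCoeff g n) :
    f = g := by
  apply fourierBasis.repr.injective
  ext n
  rw [fourierBasis_repr, fourierBasis_repr, h]

theorem fourierCoeff_eq_fourierCoeffOn (f : C(AddCircle (2 * Real.pi * (N : ℝ)), ℂ)) (n : ℤ) :
    fourierCoeff f n = fourierCoeffOn (lt_add_of_pos_right (0 : ℝ) (periodPos N).out)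
      (fun x : ℝ => f x) n := by
  rw [fourierCoeffOn_eq_integral, fourierCoeff_eq_intervalIntegral _ _ 0, add_sub_cancel_left]

theorem periodic_coe {N : ℕ} {E : Type*} (f : AddCircle (2 * Real.pi * (N : ℝ)) → E) :
    Function.Periodic (fun x : ℝ => f x) (2 * Real.pi * (N : ℝ)) := by
  intro x
  simp only [AddCircle.coe_add_period]

variable {f g : C(AddCircle (2 * Real.pi * (N : ℝ)), ℂ)} {f₁ : ℝ → ℂ}

theorem periodic_of_hasDerivAt {T : ℝ} {φ φ₁ : ℝ → ℂ} (hT : Function.Periodic φ T)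
    (h : ∀ x, HasDerivAt φ (φ₁ x) x) : Function.Periodic φ₁ T := by
  intro x
  have h1 := (h (x + T)).comp_add_const x T
  have h2 : (fun y => φ (y + T)) = φ := funext hT
  rw [h2] at h1
  exact h1.unique (h x)

theorem fourierCoeff_zero_of_hasDerivAt (hf : ∀ x : ℝ, HasDerivAt (fun y : ℝ => f y) (f₁ x) x)
    (hg : ∀ x : ℝ, HasDerivAt f₁ (g x) x) : fourierCoeff g 0 = 0 := by
  rw [fourierCoeff_eq_intervalIntegral _ _ 0]
  have h1 : ∫ x in (0 : ℝ)..0 + 2 * Real.pi * N, g x = 0 := by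
    rw [intervalIntegral.integral_eq_sub_of_hasDerivAt (fun x _ => hg x)
      ((g.continuous.comp (AddCircle.continuous_mk' _)).intervalIntegrable _ _),
      periodic_of_hasDerivAt (periodic_coe f) hf 0, sub_self]
  simp only [neg_zero, fourier_zero, one_smul]
  rw [h1, smul_zero]

/-- Two integrations by parts. The boundary terms vanish because `f` is periodic, and so is its
derivative `f₁`. -/
theorem fourierCoeff_of_hasDerivAt (hf : ∀ x : ℝ, HasDerivAt (fun y : ℝ => f y) (f₁ x) x)
    (hg : ∀ x : ℝ, HasDerivAt f₁ (g x) x) {n : ℤ} (hn : n ≠ 0) :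
    invSymbol N n * fourierCoeff g n = -fourierCoeff f n := by
  have hp := periodic_of_hasDerivAt (periodic_coe f) hf
  have hcg : Continuous fun x : ℝ => g x := g.continuous.comp (AddCircle.continuous_mk' _)
  have hcf₁ : Continuous f₁ := continuous_iff_continuousAt.2 fun x => (hg x).continuousAt
  rw [fourierCoeff_eq_fourierCoeffOn f, fourierCoeff_eq_fourierCoeffOn g,
    fourierCoeffOn_of_hasDerivAt _ hn (fun x _ => hf x) (hcf₁.intervalIntegrable _ _),
    fourierCoeffOn_of_hasDerivAt _ hn (fun x _ => hg x) (hcg.intervalIntegrable _ _),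
    hp 0, show f ((0 + 2 * Real.pi * (N : ℝ) : ℝ) : AddCircle (2 * Real.pi * (N : ℝ))) =
      f ((0 : ℝ) : AddCircle (2 * Real.pi * (N : ℝ))) from periodic_coe f 0, invSymbol, if_neg hn]
  have hn' : (n : ℂ) ≠ 0 := Int.cast_ne_zero.2 hn
  have hpi : (Real.pi : ℂ) ≠ 0 := Complex.ofReal_ne_zero.2 Real.pi_ne_zero
  push_cast
  simp only [sub_self, mul_zero, zero_sub, zero_add, sub_zero]
  field_simp
  rw [Complex.I_sq]
  ring

/-- The zero-mean element of `L²` given by a continuous function which is a second derivative. -/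
theorem lpOf_mem_zeroMean (hf : ∀ x : ℝ, HasDerivAt (fun y : ℝ => f y) (f₁ x) x)
    (hg : ∀ x : ℝ, HasDerivAt f₁ (g x) x) : lpOf g ∈ zeroMean N := by
  rw [mem_zeroMean_iff]
  have h := fourierCoeff_zero_of_hasDerivAt hf hg
  rw [← fourierCoeff_toLp] at h
  simpa [fourierCoeff] using h

/-- The multiplier is nonlocal, but on `g = f''` it returns `-f` up to the mean of `f`, which the
projection removes. All explicit evaluations of the Hessian rest on this. -/
theorem negInvSecondDeriv_lpOf (hf : ∀ x : ℝ, HasDerivAt (fun y : ℝ => f y) (f₁ x) x)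
    (hg : ∀ x : ℝ, HasDerivAt f₁ (g x) x) :
    negInvSecondDeriv N (lpOf g) = ((zeroMean N).orthogonalProjectionOnto (lpOf (-f)) : L2per N) := by
  refine ext_fourierCoeff fun n => ?_
  rw [fourierCoeff_negInvSecondDeriv, fourierCoeff_orthogonalProjectionOnto, fourierCoeff_toLp,
    fourierCoeff_toLp]
  split_ifs with hn
  · simp [hn, invSymbol]
  · rw [fourierCoeff_of_hasDerivAt hf hg hn]
    have := fourierCoeff.const_mul (f := (f : AddCircle (2 * Real.pi * (N : ℝ)) → ℂ)) (-1) n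
    rw [neg_one_mul] at this
    rw [← this]
    congr 1
    funext x
    simp

theorem mulOp_lpOf (q g : C(AddCircle (2 * Real.pi * (N : ℝ)), ℂ)) :
    mulOp N q (lpOf g) = lpOf (q * g) := by
  refine Lp.ext ?_
  filter_upwards [mulOp_apply N q (lpOf g),
    ContinuousMap.coeFn_toLp (p := 2) (𝕜 := ℂ) haarAddCircle g,
    ContinuousMap.coeFn_toLp (p := 2) (𝕜 := ℂ) haarAddCircle (q * g)] with x h1 h2 h3
  rw [h1, h2, h3, ContinuousMap.mul_apply]

/-- The Hessian on a second derivative. -/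
theorem hessian_lpOf {q : ℝ → ℝ} {hq : Continuous q} {hp : Function.Periodic q (2 * Real.pi)}
    (hf : ∀ x : ℝ, HasDerivAt (fun y : ℝ => f y) (f₁ x) x)
    (hg : ∀ x : ℝ, HasDerivAt f₁ (g x) x) {v : zeroMean N} (hv : (v : L2per N) = lpOf g) :
    hessian N q hq hp v =
      (zeroMean N).orthogonalProjectionOnto (lpOf (onCircle N q hq hp * g - f)) := by
  simp only [hessian, ContinuousLinearMap.comp_apply, Submodule.subtypeL_apply, add_apply, map_add]
  rw [hv, negInvSecondDeriv_lpOf hf hg, mulOp_lpOf, Submodule.orthogonalProjectionOnto_mem_subspace_eq_self,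
    ← map_add, ← map_add]
  congr 2
  ring

theorem inner_lpOf {F G : ℝ → ℝ} (hF : ∀ x : ℝ, f x = (F x : ℂ)) (hG : ∀ x : ℝ, g x = (G x : ℂ))
    (a : ℝ) : inner ℂ (lpOf f) (lpOf g) =
      (((2 * Real.pi * (N : ℝ))⁻¹ * ∫ x in a..a + 2 * Real.pi * (N : ℝ), F x * G x : ℝ) : ℂ) := by
  rw [ContinuousMap.inner_toLp, integral_haarAddCircle,
    ← AddCircle.intervalIntegral_preimage (2 * Real.pi * (N : ℝ)) a]
  simp only [hF, hG, Complex.conj_ofReal]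
  rw [Complex.ofReal_mul, ← intervalIntegral.integral_ofReal, Complex.real_smul]
  congr 1
  refine intervalIntegral.integral_congr fun x _ => ?_
  push_cast
  ring

theorem norm_lpOf_sq {F : ℝ → ℝ} (hF : ∀ x : ℝ, f x = (F x : ℂ)) (a : ℝ) :
    ‖lpOf f‖ ^ 2 = (2 * Real.pi * (N : ℝ))⁻¹ * ∫ x in a..a + 2 * Real.pi * (N : ℝ), F x ^ 2 := by
  have h : (inner ℂ (lpOf f) (lpOf f)).re = ‖lpOf f‖ ^ 2 := inner_self_eq_norm_sq (𝕜 := ℂ) _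
  rw [← h, inner_lpOf hF hF a, Complex.ofReal_re]
  simp only [pow_two]

/-- The measure has total mass one, so the sup norm dominates the `L²` norm. -/
theorem norm_lpOf_le {C : ℝ} (hC : 0 ≤ C) (h : ∀ x : ℝ, ‖f x‖ ≤ C) : ‖lpOf f‖ ≤ C := by
  have h1 : ‖f‖ ≤ C := (ContinuousMap.norm_le _ hC).2 fun x => by
    induction x using QuotientAddGroup.induction_on with
    | H x => exact h x
  refine (ContinuousLinearMap.le_of_opNorm_le _ (c := 1) ?_ f).trans (by simpa using h1)
  refine (ContinuousMap.toLp_norm_le haarAddCircle).trans ?_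
  simp [measureUnivNNReal]

end CircleFunctions

/-! ### Form bounds on high and on low Fourier modes. -/

section ModeCounting

variable {N : ℕ} [NeZero N]

/-- The low Fourier coefficients. -/
def lowCoeffs (N : ℕ) [NeZero N] : zeroMean N →ₗ[ℂ] (lowModes N → ℂ) :=
  LinearMap.pi fun n => (coeffL (N := N) (n : ℤ)).toLinearMap

/-- Trigonometric sums of frequency below `1`. -/
def lowSum (N : ℕ) [NeZero N] : (lowModes (N - 1) → ℂ) →ₗ[ℂ] zeroMean N :=
  Fintype.linearCombination ℂ fun n : lowModes (N - 1) =>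
    (⟨fourierLp 2 (n : ℤ), fourierLp_mem_zeroMean (mem_lowModes.1 n.2).1⟩ : zeroMean N)

theorem finrank_lowModes (M : ℕ) : Module.finrank ℂ (lowModes M → ℂ) = 2 * M := by
  rw [Module.finrank_fintype_fun_eq_card, Fintype.card_coe, card_lowModes]

theorem coeffL_lowSum (w : lowModes (N - 1) → ℂ) (n : ℤ) :
    coeffL n (lowSum N w) = ∑ k : lowModes (N - 1), w k * if n = k then 1 else 0 := by
  rw [lowSum, Fintype.linearCombination_apply, map_sum]
  refine Finset.sum_congr rfl fun k _ => ?_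
  rw [map_smul, smul_eq_mul]
  congr 1
  exact (orthonormal_iff_ite.1 orthonormal_fourier) n k

theorem lowSum_ne_zero {w : lowModes (N - 1) → ℂ} (hw : w ≠ 0) : lowSum N w ≠ 0 := by
  obtain ⟨k, hk⟩ := Function.ne_iff.1 hw
  intro h
  have h1 := coeffL_lowSum w k
  rw [h, map_zero, Finset.sum_eq_single k (fun j _ hj => by
    rw [if_neg (fun h => hj (Subtype.ext h.symm)), mul_zero]) (by simp)] at h1
  simp at h1
  exact hk h1.symm

variable {q : ℝ → ℝ} {hq : Continuous q} {hp : Function.Periodic q (2 * Real.pi)}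

/-- The remaining modes have `|n| ≥ N + 1`, where the symbol is at most `(N/(N+1))² ≤ N/(N+1) = 1 -
1/(N+1)`. -/
theorem form_hessian_of_lowCoeffs {m : ℝ} (hm : ∀ x, q x ≤ m) {v : zeroMean N}
    (hv : lowCoeffs N v = 0) :
    form (hessian N q hq hp) v ≤ (1 - 1 / ((N : ℝ) + 1) + m) * ‖v‖ ^ 2 := by
  have hc : ((N : ℝ) / (N + 1)) ^ 2 ≤ 1 - 1 / ((N : ℝ) + 1) := by
    have : (0 : ℝ) ≤ N := Nat.cast_nonneg N
    have h1 : 1 - 1 / ((N : ℝ) + 1) = N / (N + 1) := by field_simp; ring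
    rw [h1]
    have h2 : (N : ℝ) / (N + 1) ≤ 1 := (div_le_one (by positivity)).2 (by linarith)
    exact pow_le_of_le_one (by positivity) h2 two_ne_zero
  have h1 := re_inner_negInvSecondDeriv_le v (s := lowModes N)
    (fun n hn hs => (sq_div_le_of_not_mem_lowModes hn hs).trans hc) ((sq_nonneg _).trans hc)
  have h2 := re_inner_mulOp_le (q := onCircle N q hq hp) (r := q) (fun x => rfl) hm (v : L2per N)
  have h3 : ‖(v : L2per N)‖ = ‖v‖ := rfl
  have h4 : ∑ n ∈ lowModes N, ‖fourierCoeff (v : L2per N) n‖ ^ 2 = 0 := by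
    refine Finset.sum_eq_zero fun n hn => ?_
    have := congrFun hv ⟨n, hn⟩
    have h5 : coeffL n v = 0 := by simpa [lowCoeffs] using this
    rw [← coeffL_apply, h5]
    simp
  rw [h3] at h2
  rw [h4] at h1
  rw [form_hessian]
  linarith

/-- Here `|n| ≤ N - 1`, so the symbol exceeds `1` by at least `1/(N+1)`, which amounts to
`(N+2)(N-1)² ≤ N²(N+1)`. For `N = 1` there are no such modes. -/
theorem form_hessian_lowSum {m : ℝ} (hm : ∀ x, m ≤ q x) (w : lowModes (N - 1) → ℂ) :
    (1 + 1 / ((N : ℝ) + 1) + m) * ‖lowSum N w‖ ^ 2 ≤ form (hessian N q hq hp) (lowSum N w) := by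
  have h1 := le_re_inner_negInvSecondDeriv (lowSum N w) (s := lowModes (N - 1))
    (c := 1 + 1 / ((N : ℝ) + 1)) (fun n hn hs => by
      have h2 := (mem_lowModes.1 hs).2
      have hN : 1 ≤ N := Nat.pos_of_ne_zero (NeZero.ne N)
      have h3 : |(n : ℝ)| ≤ N - 1 := by
        have : |n| ≤ (N : ℤ) - 1 := by omega
        exact_mod_cast this
      have h4 : 0 < |(n : ℝ)| := abs_pos.2 (Int.cast_ne_zero.2 hn)
      have h5 : (1 : ℝ) ≤ |(n : ℝ)| := by exact_mod_cast Int.one_le_abs hn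
      rw [← sq_abs ((N : ℝ) / n), abs_div, Nat.abs_cast, div_pow, le_div_iff₀ (by positivity)]
      have h6 : |(n : ℝ)| ^ 2 ≤ ((N : ℝ) - 1) ^ 2 := pow_le_pow_left₀ h4.le h3 2
      have h7 : (1 + 1 / ((N : ℝ) + 1)) * ((N : ℝ) - 1) ^ 2 ≤ (N : ℝ) ^ 2 := by
        rw [show 1 + 1 / ((N : ℝ) + 1) = ((N : ℝ) + 2) / (N + 1) by field_simp; ring,
          div_mul_eq_mul_div, div_le_iff₀ (by positivity)]
        nlinarith
      exact (mul_le_mul_of_nonneg_left h6 (by positivity)).trans h7)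
    (fun n hn => by
      rw [← coeffL_apply, coeffL_lowSum]
      refine Finset.sum_eq_zero fun k _ => ?_
      rw [if_neg (fun h : n = k => hn (h ▸ k.2)), mul_zero])
  have h2 := le_re_inner_mulOp (q := onCircle N q hq hp) (r := q) (fun x => rfl) hm
    (lowSum N w : L2per N)
  have h3 : ‖(lowSum N w : L2per N)‖ = ‖lowSum N w‖ := rfl
  rw [h3] at h2
  rw [form_hessian]
  linarith

end ModeCounting

/-! ### Concentrated periodic bumps. -/

section Bumps

/-- A smooth bump supported in `[5/4, 7/4]`. -/
def bump : ContDiffBump (3 / 2 : ℝ) := ⟨1 / 8, 1 / 4, by norm_num, by norm_num⟩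

/-- `ψ` is supported in `[5/4, 7/4]`. -/
def SupportedInBump (ψ : ℝ → ℝ) : Prop := ∀ t, t < 5 / 4 ∨ 7 / 4 < t → ψ t = 0

theorem supportedInBump_bump : SupportedInBump bump := by
  intro t ht
  refine bump.zero_of_le_dist ?_
  change (1 / 4 : ℝ) ≤ _
  rw [Real.dist_eq, le_abs]
  rcases ht with h | h
  · right; linarith
  · left; linarith

theorem SupportedInBump.deriv {ψ : ℝ → ℝ} (h : SupportedInBump ψ) : SupportedInBump (deriv ψ) := by
  intro t ht
  have h1 : ψ =ᶠ[nhds t] fun _ => 0 := by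
    rcases ht with ht | ht
    · filter_upwards [gt_mem_nhds ht] with x hx using h x (Or.inl hx)
    · filter_upwards [lt_mem_nhds ht] with x hx using h x (Or.inr hx)
  rw [h1.deriv_eq]
  simp

/-- The periodic extension of `ψ((x - z₀)/s)` with period `T`. -/
def periodicBump (T z₀ s : ℝ) (ψ : ℝ → ℝ) (x : ℝ) : ℝ := ψ (T * Int.fract ((x - z₀) / T) / s)

theorem periodicBump_periodic {T : ℝ} (hT : 0 < T) (z₀ s : ℝ) (ψ : ℝ → ℝ) :
    Function.Periodic (periodicBump T z₀ s ψ) T := by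
  intro x
  rw [periodicBump, show (x + T - z₀) / T = (x - z₀) / T + 1 by field_simp; ring, Int.fract_add_one]
  rfl

theorem periodicBump_add {T : ℝ} (hT : 0 < T) (z₀ s : ℝ) (ψ : ℝ → ℝ) {y : ℝ} (hy : y ∈ Ico 0 T) :
    periodicBump T z₀ s ψ (y + z₀) = ψ (y / s) := by
  rw [periodicBump, add_sub_cancel_right, Int.fract_eq_self.2
    ⟨div_nonneg hy.1 hT.le, (div_lt_one hT).2 hy.2⟩, mul_div_cancel₀ _ hT.ne']

theorem hasDerivAt_periodicBump {T z₀ s : ℝ} (hs : 0 < s) (hs1 : s ≤ 1) (hT : 2 < T) {ψ ψ₁ : ℝ → ℝ}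
    (h : SupportedInBump ψ) (hψ : ∀ t, HasDerivAt ψ (ψ₁ t) t) (x : ℝ) :
    HasDerivAt (periodicBump T z₀ s ψ) (s⁻¹ * periodicBump T z₀ s ψ₁ x) x := by
  have hT0 : 0 < T := by linarith
  have hc : Continuous fun x : ℝ => (x - z₀) / T := by fun_prop
  set t := (x - z₀) / T with ht
  set k : ℤ := ⌊t⌋ with hk
  have h1 : HasDerivAt (fun y => ψ (T * ((y - z₀) / T - k) / s))
      (ψ₁ (T * Int.fract t / s) * s⁻¹) x := by
    have e : HasDerivAt (fun y => T * ((y - z₀) / T - k) / s) s⁻¹ x := by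
      have := ((((hasDerivAt_id x).sub_const z₀).div_const T).sub_const (k : ℝ)).const_mul T
        |>.div_const s
      rw [show s⁻¹ = T * (1 / T) / s by field_simp]
      exact this
    exact (hψ _).comp x e
  rw [mul_comm] at h1
  refine h1.congr_of_eventuallyEq ?_
  -- `Int.fract` jumps at these points, but the function vanishes on both sides: `ψ(·/s)` is
  -- supported in `[5s/4, 7s/4]`, away from `0` and, as `s ≤ 1` and `2 < T`, from `T`.
  by_cases hf : Int.fract t = 0
  · have htk : t = k := by rw [hk, ← Int.self_sub_fract, hf, sub_zero]
    have hr : 0 < s / T := div_pos hs hT0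
    have hn : ∀ᶠ y in nhds x, (y - z₀) / T ∈ Ioo (t - 1 / 8) (t + s / T) :=
      hc.continuousAt.eventually_mem (Ioo_mem_nhds (by linarith) (by linarith))
    filter_upwards [hn] with y hy
    rw [htk] at hy
    have hz : ψ (T * ((y - z₀) / T - k) / s) = 0 := by
      refine h _ (Or.inl ?_)
      rw [div_lt_iff₀ hs]
      have := mul_lt_mul_of_pos_left (show (y - z₀) / T - k < s / T by linarith [hy.2]) hT0
      rw [mul_div_cancel₀ _ hT0.ne'] at this
      linarith
    rw [hz, periodicBump]
    rcases lt_or_ge ((y - z₀) / T) k with hlt | hge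
    · have hfl : ⌊(y - z₀) / T⌋ = k - 1 := by
        rw [Int.floor_eq_iff]
        push_cast
        constructor <;> linarith [hy.1]
      refine h _ (Or.inr ?_)
      rw [Int.fract, hfl, lt_div_iff₀ hs]
      push_cast
      have : T * (7 / 8) < T * ((y - z₀) / T - (k - 1)) :=
        mul_lt_mul_of_pos_left (by linarith [hy.1]) hT0
      nlinarith
    · have hfl : ⌊(y - z₀) / T⌋ = k := by
        rw [Int.floor_eq_iff]
        have : s / T ≤ 1 := (div_le_one hT0).2 (by linarith)
        constructor
        · exact hge
        · linarith [hy.2]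
      rw [Int.fract, hfl, hz]
  · have h2 : (k : ℝ) < t := by
      rcases (Int.floor_le t).lt_or_eq with h2 | h2
      · exact h2
      · exact absurd (by rw [Int.fract, h2, sub_self]) hf
    have hn : ∀ᶠ y in nhds x, (y - z₀) / T ∈ Ioo (k : ℝ) (k + 1) :=
      hc.continuousAt.eventually_mem (Ioo_mem_nhds h2 (Int.lt_floor_add_one t))
    filter_upwards [hn] with y hy
    rw [periodicBump, Int.fract, Int.floor_eq_iff.2 ⟨hy.1.le, hy.2⟩]

/-- Substitution `x = z₀ + s t`: the period starting at `z₀` contains one copy of the bump, inside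
`(z₀, z₀ + 2s)`. -/
theorem integral_periodicBump {T z₀ s : ℝ} (hs : 0 < s) (hs1 : s ≤ 1) (hT : 2 < T)
    {ψ : ℝ → ℝ} (h : SupportedInBump ψ) (F : ℝ → ℝ) :
    ∫ x in z₀..z₀ + T, F (x - z₀) * periodicBump T z₀ s ψ x =
      s * ∫ t in (0 : ℝ)..2, F (s * t) * ψ t := by
  have hT0 : 0 < T := by linarith
  have h1 : ∫ x in z₀..z₀ + T, F (x - z₀) * periodicBump T z₀ s ψ x =
      ∫ y in (0 : ℝ)..T, F y * ψ (y / s) := by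
    have := intervalIntegral.integral_comp_add_right (a := 0) (b := T)
      (fun x => F (x - z₀) * periodicBump T z₀ s ψ x) z₀
    rw [zero_add, add_comm T] at this
    rw [← this]
    refine intervalIntegral.integral_congr_Ioo_of_le hT0.le fun y hy => ?_
    simp only [add_sub_cancel_right]
    rw [periodicBump_add hT0 _ _ _ (Ioo_subset_Ico_self hy)]
  have h2 : ∫ y in (0 : ℝ)..T, F y * ψ (y / s) = ∫ y in (0 : ℝ)..(2 * s), F y * ψ (y / s) := by
    refine (intervalIntegral.integral_eq_integral_of_support_subset ?_).trans
      (intervalIntegral.integral_eq_integral_of_support_subset ?_).symm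
    all_goals
      intro y hy
      have h3 : ψ (y / s) ≠ 0 := right_ne_zero_of_mul hy
      have h4 : ¬ (y / s < 5 / 4 ∨ 7 / 4 < y / s) := fun h4 => h3 (h _ h4)
      push Not at h4
      rw [le_div_iff₀ hs, div_le_iff₀ hs] at h4
      constructor <;> nlinarith [h4.1, h4.2]
  rw [h1, h2]
  have h3 := intervalIntegral.integral_comp_mul_left (a := 0) (b := 2)
    (fun y => F y * ψ (y / s)) hs.ne'
  rw [mul_zero, mul_comm s 2, smul_eq_mul] at h3
  rw [eq_comm, inv_mul_eq_iff_eq_mul₀ hs.ne'] at h3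
  rw [h3]
  congr 1
  refine intervalIntegral.integral_congr fun t _ => ?_
  simp only [mul_div_cancel_left₀ _ hs.ne']

theorem contDiff_bump : ContDiff ℝ ∞ bump := bump.contDiff

theorem contDiff_deriv_bump : ContDiff ℝ ∞ (deriv bump) :=
  (contDiff_infty_iff_deriv.1 contDiff_bump).2

theorem contDiff_deriv_deriv_bump : ContDiff ℝ ∞ (deriv (deriv bump)) :=
  (contDiff_infty_iff_deriv.1 contDiff_deriv_bump).2

theorem hasDerivAt_of_contDiff {ψ : ℝ → ℝ} (h : ContDiff ℝ ∞ ψ) (t : ℝ) :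
    HasDerivAt ψ (deriv ψ t) t :=
  (h.differentiable (by simp)).differentiableAt.hasDerivAt

/-- `∫ b'²`. -/
def bumpEnergy : ℝ := ∫ t in (0 : ℝ)..2, deriv bump t ^ 2

theorem bumpEnergy_eq : ∫ t in (0 : ℝ)..2, bump t * deriv (deriv bump) t = -bumpEnergy := by
  rw [intervalIntegral.integral_mul_deriv_eq_deriv_mul
    (fun t _ => hasDerivAt_of_contDiff contDiff_bump t)
    (fun t _ => hasDerivAt_of_contDiff contDiff_deriv_bump t)
    (contDiff_deriv_bump.continuous.intervalIntegrable _ _)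
    (contDiff_deriv_deriv_bump.continuous.intervalIntegrable _ _),
    supportedInBump_bump 0 (by norm_num), supportedInBump_bump 2 (by norm_num), bumpEnergy]
  simp only [zero_mul, sub_zero, zero_sub, pow_two]

theorem integral_sq_pos {ψ : ℝ → ℝ} (h : Continuous ψ) (hs : SupportedInBump ψ) {t : ℝ}
    (ht : ψ t ≠ 0) : 0 < ∫ t in (0 : ℝ)..2, ψ t ^ 2 := by
  have h4 : ¬ (t < 5 / 4 ∨ 7 / 4 < t) := fun h4 => ht (hs _ h4)
  push Not at h4
  refine intervalIntegral.integral_pos two_pos (h.pow 2).continuousOn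
    (fun _ _ => sq_nonneg _) ⟨t, ⟨by linarith, by linarith⟩, by positivity⟩

theorem exists_deriv_ne_zero {ψ : ℝ → ℝ} (h : ContDiff ℝ ∞ ψ) (hs : SupportedInBump ψ) {t : ℝ}
    (ht : ψ t ≠ 0) : ∃ u, deriv ψ u ≠ 0 := by
  by_contra hcon
  push Not at hcon
  have := is_const_of_deriv_eq_zero (h.differentiable (by simp)) hcon t 0
  exact ht (this.trans (hs 0 (by norm_num)))

theorem bump_apply_ne_zero : bump (3 / 2) ≠ 0 := by
  rw [bump.one_of_mem_closedBall (Metric.mem_closedBall_self bump.rIn_pos.le)]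
  exact one_ne_zero

theorem bumpEnergy_pos : 0 < bumpEnergy := by
  obtain ⟨u, hu⟩ := exists_deriv_ne_zero contDiff_bump supportedInBump_bump bump_apply_ne_zero
  exact integral_sq_pos contDiff_deriv_bump.continuous supportedInBump_bump.deriv hu

theorem integral_deriv_deriv_bump_sq_pos : 0 < ∫ t in (0 : ℝ)..2, deriv (deriv bump) t ^ 2 := by
  obtain ⟨u, hu⟩ := exists_deriv_ne_zero contDiff_bump supportedInBump_bump bump_apply_ne_zero
  obtain ⟨u, hu⟩ := exists_deriv_ne_zero contDiff_deriv_bump supportedInBump_bump.deriv hu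
  exact integral_sq_pos contDiff_deriv_deriv_bump.continuous supportedInBump_bump.deriv.deriv hu

end Bumps

/-! ### Second derivatives of bumps as zero-mean vectors. -/

section BumpVectors

variable {N : ℕ} [NeZero N]

/-- A continuous real function of period `2πN` as a function on the circle. -/
def circleFun (N : ℕ) (F : ℝ → ℝ) (hF : Continuous F)
    (hp : Function.Periodic F (2 * Real.pi * (N : ℝ))) :
    C(AddCircle (2 * Real.pi * (N : ℝ)), ℂ) where
  toFun x := ((hp.lift x : ℝ) : ℂ)
  continuous_toFun := Complex.continuous_ofReal.comp (hF.quotient_lift _)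

theorem circleFun_coe (N : ℕ) (F : ℝ → ℝ) (hF : Continuous F)
    (hp : Function.Periodic F (2 * Real.pi * (N : ℝ))) (x : ℝ) :
    circleFun N F hF hp (x : AddCircle (2 * Real.pi * (N : ℝ))) = (F x : ℂ) := rfl

theorem two_lt_period (N : ℕ) [NeZero N] : 2 < 2 * Real.pi * (N : ℝ) := by
  have h1 : (1 : ℝ) ≤ N := by exact_mod_cast Nat.pos_of_ne_zero (NeZero.ne N)
  nlinarith [Real.pi_gt_three]

theorem continuous_periodicBump (N : ℕ) [NeZero N] {z₀ s : ℝ} (hs : 0 < s) (hs1 : s ≤ 1) {ψ : ℝ → ℝ}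
    (h : SupportedInBump ψ) (hψ : ContDiff ℝ ∞ ψ) :
    Continuous (periodicBump (2 * Real.pi * (N : ℝ)) z₀ s ψ) :=
  continuous_iff_continuousAt.2 fun x => (hasDerivAt_periodicBump hs hs1 (two_lt_period N) h
    (hasDerivAt_of_contDiff hψ) x).continuousAt

/-- The periodic extension of a bump as a function on the circle. -/
def bumpCircle (N : ℕ) [NeZero N] (z₀ : ℝ) {s : ℝ} (hs : 0 < s) (hs1 : s ≤ 1) (ψ : ℝ → ℝ)
    (h : SupportedInBump ψ) (hψ : ContDiff ℝ ∞ ψ) (c : ℝ) :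
    C(AddCircle (2 * Real.pi * (N : ℝ)), ℂ) :=
  circleFun N (fun x => c * periodicBump (2 * Real.pi * (N : ℝ)) z₀ s ψ x)
    ((continuous_periodicBump N hs hs1 h hψ).const_mul c)
    (fun x => by simp only [periodicBump_periodic (periodPos N).out z₀ s ψ x])

/-- A concentrated bump. -/
abbrev bump₀ (N : ℕ) [NeZero N] (z₀ : ℝ) {s : ℝ} (hs : 0 < s) (hs1 : s ≤ 1) :=
  bumpCircle N z₀ hs hs1 bump supportedInBump_bump contDiff_bump 1

/-- The second derivative of a concentrated bump. -/
abbrev bump₂ (N : ℕ) [NeZero N] (z₀ : ℝ) {s : ℝ} (hs : 0 < s) (hs1 : s ≤ 1) :=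
  bumpCircle N z₀ hs hs1 (deriv (deriv bump)) supportedInBump_bump.deriv.deriv
    contDiff_deriv_deriv_bump (s⁻¹ ^ 2)

variable {z₀ s : ℝ} (hs : 0 < s) (hs1 : s ≤ 1)

theorem hasDerivAt_bump₀ (x : ℝ) : HasDerivAt (fun y : ℝ => bump₀ N z₀ hs hs1 y)
    ((s⁻¹ * periodicBump (2 * Real.pi * (N : ℝ)) z₀ s (deriv bump) x : ℝ) : ℂ) x := by
  have h := (hasDerivAt_periodicBump (z₀ := z₀) hs hs1 (two_lt_period N) supportedInBump_bump
    (hasDerivAt_of_contDiff contDiff_bump) x).ofReal_comp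
  refine h.congr_of_eventuallyEq (Filter.Eventually.of_forall fun y => ?_)
  simp [bump₀, bumpCircle, circleFun_coe]

theorem hasDerivAt_bump₁ (x : ℝ) :
    HasDerivAt (fun y : ℝ =>
      ((s⁻¹ * periodicBump (2 * Real.pi * (N : ℝ)) z₀ s (deriv bump) y : ℝ) : ℂ))
      (bump₂ N z₀ hs hs1 x) x := by
  have h := ((hasDerivAt_periodicBump (z₀ := z₀) hs hs1 (two_lt_period N) supportedInBump_bump.deriv
    (hasDerivAt_of_contDiff contDiff_deriv_bump) x).const_mul s⁻¹).ofReal_comp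
  convert h using 1
  refine congrArg Complex.ofReal ?_
  change s⁻¹ ^ 2 * _ = _
  ring

/-- The second derivative of a concentrated bump as an element of `L²`. -/
def bumpVec (N : ℕ) [NeZero N] (z₀ : ℝ) {s : ℝ} (hs : 0 < s) (hs1 : s ≤ 1) : zeroMean N :=
  ⟨lpOf (bump₂ N z₀ hs hs1), lpOf_mem_zeroMean (hasDerivAt_bump₀ hs hs1) (hasDerivAt_bump₁ hs hs1)⟩

variable {q : ℝ → ℝ} {hq : Continuous q} {hp : Function.Periodic q (2 * Real.pi)}

theorem hessian_bumpVec : hessian N q hq hp (bumpVec N z₀ hs hs1) =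
    (zeroMean N).orthogonalProjectionOnto
      (lpOf (onCircle N q hq hp * bump₂ N z₀ hs hs1 - bump₀ N z₀ hs hs1)) :=
  hessian_lpOf (hasDerivAt_bump₀ hs hs1) (hasDerivAt_bump₁ hs hs1) rfl

end BumpVectors

/-! ### Form and residual of the Hessian on bumps. -/

section BumpEstimates

variable {N : ℕ} [NeZero N] {z₀ s : ℝ} (hs : 0 < s) (hs1 : s ≤ 1)
  {q : ℝ → ℝ} {hq : Continuous q} {hp : Function.Periodic q (2 * Real.pi)}

theorem bump₀_coe (x : ℝ) : bump₀ N z₀ hs hs1 x =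
    (periodicBump (2 * Real.pi * (N : ℝ)) z₀ s bump x : ℂ) := by
  refine congrArg Complex.ofReal ?_
  exact one_mul _

theorem bump₂_coe (x : ℝ) : bump₂ N z₀ hs hs1 x =
    ((s⁻¹ ^ 2 * periodicBump (2 * Real.pi * (N : ℝ)) z₀ s (deriv (deriv bump)) x : ℝ) : ℂ) := rfl

theorem hessian_bump_coe (x : ℝ) :
    (onCircle N q hq hp * bump₂ N z₀ hs hs1 - bump₀ N z₀ hs hs1) x =
    ((q x * (s⁻¹ ^ 2 * periodicBump (2 * Real.pi * (N : ℝ)) z₀ s (deriv (deriv bump)) x) -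
      periodicBump (2 * Real.pi * (N : ℝ)) z₀ s bump x : ℝ) : ℂ) := by
  rw [ContinuousMap.sub_apply, ContinuousMap.mul_apply, bump₀_coe, bump₂_coe, onCircle_coe]
  push_cast
  ring

/-- Measured from `z₀` modulo the period, the supports are `[5s/4, 7s/4]` and `[5t/4, 7t/4]`. A
factor of two between the scales separates them because `7/8 < 5/4`. -/
theorem periodicBump_mul_eq_zero {T s t : ℝ} (hs : 0 < s) (ht : 0 < t)
    (hst : 2 * s ≤ t ∨ 2 * t ≤ s) {ψ χ : ℝ → ℝ}
    (hψ : SupportedInBump ψ) (hχ : SupportedInBump χ) (x : ℝ) :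
    periodicBump T z₀ s ψ x * periodicBump T z₀ t χ x = 0 := by
  by_contra h
  have h1 := left_ne_zero_of_mul h
  have h2 := right_ne_zero_of_mul h
  rw [periodicBump] at h1 h2
  set y := T * Int.fract ((x - z₀) / T)
  have h3 : ¬ (y / s < 5 / 4 ∨ 7 / 4 < y / s) := fun h => h1 (hψ _ h)
  have h4 : ¬ (y / t < 5 / 4 ∨ 7 / 4 < y / t) := fun h => h2 (hχ _ h)
  push Not at h3 h4
  rw [le_div_iff₀ hs, div_le_iff₀ hs] at h3
  rw [le_div_iff₀ ht, div_le_iff₀ ht] at h4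
  rcases hst with h | h <;> linarith [h3.1, h3.2, h4.1, h4.2]

variable {t : ℝ} (ht : 0 < t) (ht1 : t ≤ 1)

theorem inner_bumpVec_eq_zero (hst : 2 * s ≤ t ∨ 2 * t ≤ s) :
    inner ℂ (bumpVec N z₀ hs hs1) (bumpVec N z₀ ht ht1) = 0 := by
  change inner ℂ (lpOf (bump₂ N z₀ hs hs1)) (lpOf (bump₂ N z₀ ht ht1)) = 0
  rw [inner_lpOf (bump₂_coe hs hs1) (bump₂_coe ht ht1) 0, Complex.ofReal_eq_zero]
  refine mul_eq_zero_of_right _ (intervalIntegral.integral_zero_ae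
    (Filter.Eventually.of_forall fun x _ => ?_))
  have h := periodicBump_mul_eq_zero (T := 2 * Real.pi * (N : ℝ)) (z₀ := z₀) hs ht hst
    supportedInBump_bump.deriv.deriv supportedInBump_bump.deriv.deriv x
  linear_combination s⁻¹ ^ 2 * t⁻¹ ^ 2 * h

theorem inner_hessian_bumpVec : inner ℂ (hessian N q hq hp (bumpVec N z₀ hs hs1))
    (bumpVec N z₀ ht ht1) = inner ℂ
      (lpOf (onCircle N q hq hp * bump₂ N z₀ hs hs1 - bump₀ N z₀ hs hs1))
      (lpOf (bump₂ N z₀ ht ht1)) := by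
  rw [hessian_bumpVec, Submodule.inner_orthogonalProjectionOnto_eq_of_mem_right]
  rfl

/-- For a bump `φ` the Hessian maps `φ''` to `q φ'' - φ` up to a constant, so it acts locally and
disjoint supports suffice. -/
theorem inner_hessian_bumpVec_eq_zero (hst : 2 * s ≤ t ∨ 2 * t ≤ s) :
    inner ℂ (hessian N q hq hp (bumpVec N z₀ hs hs1)) (bumpVec N z₀ ht ht1) = 0 := by
  rw [inner_hessian_bumpVec, inner_lpOf (hessian_bump_coe hs hs1) (bump₂_coe ht ht1) 0,
    Complex.ofReal_eq_zero]
  refine mul_eq_zero_of_right _ (intervalIntegral.integral_zero_ae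
    (Filter.Eventually.of_forall fun x _ => ?_))
  have h1 := periodicBump_mul_eq_zero (T := 2 * Real.pi * (N : ℝ)) (z₀ := z₀) hs ht hst
    supportedInBump_bump.deriv.deriv supportedInBump_bump.deriv.deriv x
  have h2 := periodicBump_mul_eq_zero (T := 2 * Real.pi * (N : ℝ)) (z₀ := z₀) hs ht hst
    supportedInBump_bump supportedInBump_bump.deriv.deriv x
  linear_combination q x * s⁻¹ ^ 2 * t⁻¹ ^ 2 * h1 - t⁻¹ ^ 2 * h2

theorem norm_bumpVec_sq : ‖bumpVec N z₀ hs hs1‖ ^ 2 = (2 * Real.pi * (N : ℝ))⁻¹ *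
    ((s⁻¹ ^ 2) ^ 2 * (s * ∫ t in (0 : ℝ)..2, deriv (deriv bump) t ^ 2)) := by
  have h := norm_lpOf_sq (bump₂_coe (N := N) (z₀ := z₀) hs hs1) z₀
  change ‖lpOf (bump₂ N z₀ hs hs1)‖ ^ 2 = _
  rw [h]
  have h1 := integral_periodicBump (z₀ := z₀) (ψ := fun t => deriv (deriv bump) t ^ 2) hs hs1
    (two_lt_period N) (fun t ht => by simp [supportedInBump_bump.deriv.deriv t ht]) (fun _ => 1)
  simp only [one_mul] at h1
  rw [← h1]
  simp only [periodicBump, mul_pow, intervalIntegral.integral_const_mul]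

/-- `∫ t² b''²`. -/
def bumpMoment : ℝ := ∫ t in (0 : ℝ)..2, t ^ 2 * deriv (deriv bump) t ^ 2

/-- For the bump `φ` at scale `s`, and up to the normalisation of the measure, the multiplier
contributes `-∫ φ φ'' = s⁻¹ bumpEnergy`, while the loss from `q < m` is at most `κ ∫ (x - z₀)² φ''²
= s⁻¹ κ bumpMoment`. Both scale alike, so one smallness condition on `κ` serves every scale. -/
theorem lt_form_bumpVec {m κ : ℝ} (hκ : κ * bumpMoment < bumpEnergy)
    (hm : ∀ x, m - q x ≤ κ * (x - z₀) ^ 2) :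
    m * ‖bumpVec N z₀ hs hs1‖ ^ 2 < form (hessian N q hq hp) (bumpVec N z₀ hs hs1) := by
  set T := 2 * Real.pi * (N : ℝ) with hT
  have hT0 : 0 < T := (periodPos N).out
  have hT2 : 2 < T := two_lt_period N
  set B := periodicBump T z₀ s (deriv (deriv bump)) with hB
  set A := periodicBump T z₀ s bump with hA
  have cB : Continuous B := continuous_periodicBump N hs hs1 supportedInBump_bump.deriv.deriv
    contDiff_deriv_deriv_bump
  have cA : Continuous A := continuous_periodicBump N hs hs1 supportedInBump_bump contDiff_bump
  have e1 : ‖bumpVec N z₀ hs hs1‖ ^ 2 = T⁻¹ * ∫ x in z₀..z₀ + T, (s⁻¹ ^ 2 * B x) ^ 2 :=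
    norm_lpOf_sq (bump₂_coe hs hs1) z₀
  have e2 : form (hessian N q hq hp) (bumpVec N z₀ hs hs1) =
      T⁻¹ * ∫ x in z₀..z₀ + T, (q x * (s⁻¹ ^ 2 * B x) - A x) * (s⁻¹ ^ 2 * B x) := by
    rw [form, inner_hessian_bumpVec, inner_lpOf (hessian_bump_coe hs hs1) (bump₂_coe hs hs1) z₀,
      Complex.ofReal_re]
  have h1 : ∫ x in z₀..z₀ + T, (x - z₀) ^ 2 * B x ^ 2 = s * (s ^ 2 * bumpMoment) := by
    have := integral_periodicBump (z₀ := z₀) (ψ := fun t => deriv (deriv bump) t ^ 2) hs hs1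
      hT2 (fun t ht => by simp [supportedInBump_bump.deriv.deriv t ht]) (fun x => x ^ 2)
    rw [bumpMoment, ← intervalIntegral.integral_const_mul]
    refine this.trans ?_
    refine congrArg _ (intervalIntegral.integral_congr fun x _ => ?_)
    ring
  have h2 : ∫ x in z₀..z₀ + T, A x * B x = s * -bumpEnergy := by
    have := integral_periodicBump (z₀ := z₀) (ψ := fun t => bump t * deriv (deriv bump) t) hs hs1
      hT2 (fun t ht => by simp [supportedInBump_bump t ht]) (fun _ => 1)
    simp only [one_mul] at this
    rw [← bumpEnergy_eq]
    exact this
  have h4 : (m * ∫ x in z₀..z₀ + T, (s⁻¹ ^ 2 * B x) ^ 2) - κ * (s⁻¹ ^ 2) ^ 2 *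
      (∫ x in z₀..z₀ + T, (x - z₀) ^ 2 * B x ^ 2) - s⁻¹ ^ 2 * (∫ x in z₀..z₀ + T, A x * B x) ≤
      ∫ x in z₀..z₀ + T, (q x * (s⁻¹ ^ 2 * B x) - A x) * (s⁻¹ ^ 2 * B x) := by
    rw [← intervalIntegral.integral_const_mul, ← intervalIntegral.integral_const_mul,
      ← intervalIntegral.integral_const_mul, ← intervalIntegral.integral_sub,
      ← intervalIntegral.integral_sub]
    · refine intervalIntegral.integral_mono_on (by linarith)
        (Continuous.intervalIntegrable (by fun_prop) _ _)
        (Continuous.intervalIntegrable (by fun_prop) _ _) fun x _ => ?_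
      nlinarith [mul_le_mul_of_nonneg_right (hm x) (sq_nonneg (s⁻¹ ^ 2 * B x))]
    all_goals exact Continuous.intervalIntegrable (by fun_prop) _ _
  rw [e1, e2, mul_left_comm]
  refine mul_lt_mul_of_pos_left ?_ (inv_pos.2 hT0)
  refine lt_of_lt_of_le ?_ h4
  rw [h1, h2]
  have h5 : κ * (s⁻¹ ^ 2) ^ 2 * (s * (s ^ 2 * bumpMoment)) = s⁻¹ * (κ * bumpMoment) := by
    field_simp
  have h6 : s⁻¹ ^ 2 * (s * -bumpEnergy) = -(s⁻¹ * bumpEnergy) := by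
    field_simp
  rw [h5, h6]
  have := mul_lt_mul_of_pos_left hκ (inv_pos.2 hs)
  linarith

/-- Before projection the residual is `(q - q z₀) φ'' - φ`. The oscillation of `q` is at most `w`
where `φ''` lives, and the square of the difference is at most twice the sum of the squares. -/
theorem norm_hessian_sub_bumpVec_sq_le {w : ℝ}
    (hw : ∀ x ∈ Icc z₀ (z₀ + 2 * s), |q x - q z₀| ≤ w) :
    ‖hessian N q hq hp (bumpVec N z₀ hs hs1) - (q z₀ : ℂ) • bumpVec N z₀ hs hs1‖ ^ 2 ≤
      2 * w ^ 2 * ‖bumpVec N z₀ hs hs1‖ ^ 2 +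
        2 * ((2 * Real.pi * (N : ℝ))⁻¹ * (s * ∫ t in (0 : ℝ)..2, bump t ^ 2)) := by
  set T := 2 * Real.pi * (N : ℝ) with hT
  have hT0 : 0 < T := (periodPos N).out
  have hT2 : 2 < T := two_lt_period N
  set B := periodicBump T z₀ s (deriv (deriv bump)) with hB
  set A := periodicBump T z₀ s bump with hA
  have cB : Continuous B := continuous_periodicBump N hs hs1 supportedInBump_bump.deriv.deriv
    contDiff_deriv_deriv_bump
  have cA : Continuous A := continuous_periodicBump N hs hs1 supportedInBump_bump contDiff_bump
  have e1 : ‖bumpVec N z₀ hs hs1‖ ^ 2 = T⁻¹ * ∫ x in z₀..z₀ + T, (s⁻¹ ^ 2 * B x) ^ 2 :=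
    norm_lpOf_sq (bump₂_coe hs hs1) z₀
  have h2 : ∫ x in z₀..z₀ + T, A x ^ 2 = s * ∫ t in (0 : ℝ)..2, bump t ^ 2 := by
    have := integral_periodicBump (z₀ := z₀) (ψ := fun t => bump t ^ 2) hs hs1
      hT2 (fun t ht => by simp [supportedInBump_bump t ht]) (fun _ => 1)
    simp only [one_mul] at this
    exact this
  set f : C(AddCircle T, ℂ) := onCircle N q hq hp * bump₂ N z₀ hs hs1 - bump₀ N z₀ hs hs1 -
    (q z₀ : ℂ) • bump₂ N z₀ hs hs1 with hf
  have hfx (x : ℝ) : f x = ((((q x - q z₀) * (s⁻¹ ^ 2 * B x) - A x : ℝ)) : ℂ) := by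
    rw [hf, ContinuousMap.sub_apply, hessian_bump_coe, ContinuousMap.smul_apply, bump₂_coe]
    push_cast
    simp only [smul_eq_mul]
    ring
  have h3 : hessian N q hq hp (bumpVec N z₀ hs hs1) - (q z₀ : ℂ) • bumpVec N z₀ hs hs1 =
      (zeroMean N).orthogonalProjectionOnto (lpOf f) := by
    have : (zeroMean N).orthogonalProjectionOnto (lpOf (bump₂ N z₀ hs hs1)) =
        bumpVec N z₀ hs hs1 :=
      Submodule.orthogonalProjectionOnto_mem_subspace_eq_self (bumpVec N z₀ hs hs1)
    rw [hessian_bumpVec, ← this, ← map_smul, ← map_sub, hf]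
    simp only [lpOf, map_sub, map_smul]
  have h4 : ‖(zeroMean N).orthogonalProjectionOnto (lpOf f)‖ ≤ ‖lpOf f‖ :=
    Submodule.norm_orthogonalProjectionOnto_apply_le _ _
  rw [h3]
  refine (pow_le_pow_left₀ (norm_nonneg _) h4 2).trans ?_
  rw [norm_lpOf_sq hfx z₀, e1, ← h2]
  have h5 : ∫ x in z₀..z₀ + T, ((q x - q z₀) * (s⁻¹ ^ 2 * B x) - A x) ^ 2 ≤
      2 * w ^ 2 * (∫ x in z₀..z₀ + T, (s⁻¹ ^ 2 * B x) ^ 2) + 2 * ∫ x in z₀..z₀ + T, A x ^ 2 := by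
    rw [← intervalIntegral.integral_const_mul, ← intervalIntegral.integral_const_mul,
      ← intervalIntegral.integral_add]
    · refine intervalIntegral.integral_mono_on_of_le_Ioo (by linarith)
        (Continuous.intervalIntegrable (by fun_prop) _ _)
        (Continuous.intervalIntegrable (by fun_prop) _ _) fun x hx => ?_
      have h6 : ((q x - q z₀) * (s⁻¹ ^ 2 * B x)) ^ 2 ≤ w ^ 2 * (s⁻¹ ^ 2 * B x) ^ 2 := by
        by_cases hx2 : x ≤ z₀ + 2 * s
        · rw [mul_pow]
          refine mul_le_mul_of_nonneg_right ?_ (sq_nonneg _)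
          rw [← sq_abs]
          exact pow_le_pow_left₀ (abs_nonneg _) (hw x ⟨hx.1.le, hx2⟩) 2
        · have h7 : B x = 0 := by
            have h8 := periodicBump_add hT0 z₀ s (deriv (deriv bump)) (y := x - z₀)
              ⟨by linarith [hx.1], by linarith [hx.2]⟩
            rw [sub_add_cancel] at h8
            rw [hB, h8]
            refine supportedInBump_bump.deriv.deriv _ (Or.inr ?_)
            rw [lt_div_iff₀ hs]
            push Not at hx2
            linarith
          simp [h7]
      nlinarith [sq_nonneg ((q x - q z₀) * (s⁻¹ ^ 2 * B x) + A x)]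
    all_goals exact Continuous.intervalIntegrable (by fun_prop) _ _
  have := mul_le_mul_of_nonneg_left h5 (inv_pos.2 hT0).le
  linarith

/-- Weyl's criterion. As `‖φ''‖²` is of order `s⁻³` and `‖φ‖²` of order `s`, concentrating the bump
makes the relative residual arbitrarily small, which contradicts the lower bound `c` supplied by a
bounded inverse. -/
theorem mem_spectrum_hessian (z₀ : ℝ) : (q z₀ : ℂ) ∈ spectrum ℂ (hessian N q hq hp) := by
  rw [mem_spectrum_iff_not_isUnit]
  intro hu
  obtain ⟨A, hA⟩ := hu
  obtain ⟨c, hc, hb⟩ : ∃ c > 0, ∀ v : zeroMean N, c * ‖v‖ ≤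
      ‖hessian N q hq hp v - (q z₀ : ℂ) • v‖ := by
    refine ⟨(‖(↑A⁻¹ : zeroMean N →L[ℂ] zeroMean N)‖ + 1)⁻¹, by positivity, fun v => ?_⟩
    rw [inv_mul_le_iff₀ (by positivity)]
    have h1 : (↑A⁻¹ : zeroMean N →L[ℂ] zeroMean N) ((A : zeroMean N →L[ℂ] zeroMean N) v) = v := by
      rw [← mul_apply_eq_comp, Units.inv_mul]
      rfl
    have h2 : (A : zeroMean N →L[ℂ] zeroMean N) v = -(hessian N q hq hp v - (q z₀ : ℂ) • v) := by
      rw [hA, sub_apply, smul_apply]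
      change (q z₀ : ℂ) • v - _ = _
      abel
    have h3 := (↑A⁻¹ : zeroMean N →L[ℂ] zeroMean N).le_opNorm ((A : zeroMean N →L[ℂ] zeroMean N) v)
    rw [h1, h2, norm_neg] at h3
    refine h3.trans (mul_le_mul_of_nonneg_right (by linarith) (norm_nonneg _))
  set J₀ := ∫ t in (0 : ℝ)..2, bump t ^ 2 with hJ₀
  set J₂ := ∫ t in (0 : ℝ)..2, deriv (deriv bump) t ^ 2 with hJ₂
  have hJ₀p : 0 < J₀ :=
    integral_sq_pos contDiff_bump.continuous supportedInBump_bump bump_apply_ne_zero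
  have hJ₂p : 0 < J₂ := integral_deriv_deriv_bump_sq_pos
  obtain ⟨d, hd, hdq⟩ := Metric.continuous_iff.1 hq z₀ (c / 2) (by positivity)
  -- The bound `d / 3` keeps the bump where `|q - q z₀| < c / 2`; the last entry, with `s⁴ ≤ s`,
  -- makes `4 s⁴ J₀` smaller than `c² J₂`.
  set s := min 1 (min (d / 3) (c ^ 2 * J₂ / (8 * J₀))) with hs_def
  have hs : 0 < s := by positivity
  have hs1 : s ≤ 1 := min_le_left _ _
  have hsd : s ≤ d / 3 := (min_le_right _ _).trans (min_le_left _ _)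
  have hsJ : s ≤ c ^ 2 * J₂ / (8 * J₀) := (min_le_right _ _).trans (min_le_right _ _)
  have h1 := norm_hessian_sub_bumpVec_sq_le (N := N) (hq := hq) (hp := hp) (z₀ := z₀) hs hs1
    (w := c / 2) (fun x hx => by
      refine (hdq x ?_).le
      rw [Real.dist_eq, abs_lt]
      constructor <;> linarith [hx.1, hx.2])
  have h2 := pow_le_pow_left₀ (by positivity) (hb (bumpVec N z₀ hs hs1)) 2
  rw [mul_pow] at h2
  have h3 := h2.trans h1
  rw [norm_bumpVec_sq] at h3
  have hT0 := (periodPos N).out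
  have h4 : c ^ 2 * J₂ ≤ 4 * s ^ 4 * J₀ := by
    have h5 : (s⁻¹ ^ 2) ^ 2 * (s * J₂) = s⁻¹ ^ 3 * J₂ := by field_simp
    rw [h5] at h3
    have h6 : c ^ 2 * (s⁻¹ ^ 3 * J₂) ≤ 2 * (c / 2) ^ 2 * (s⁻¹ ^ 3 * J₂) + 2 * (s * J₀) := by
      have := mul_le_mul_of_nonneg_left h3 hT0.le
      have hT0' := hT0.ne'
      generalize 2 * Real.pi * (N : ℝ) = T at this hT0'
      have e1 : T * (c ^ 2 * (T⁻¹ * (s⁻¹ ^ 3 * J₂))) = c ^ 2 * (s⁻¹ ^ 3 * J₂) := by field_simp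
      have e2 : T * (2 * (c / 2) ^ 2 * (T⁻¹ * (s⁻¹ ^ 3 * J₂)) + 2 * (T⁻¹ * (s * J₀))) =
        2 * (c / 2) ^ 2 * (s⁻¹ ^ 3 * J₂) + 2 * (s * J₀) := by field_simp
      rwa [e1, e2] at this
    have h7 := mul_le_mul_of_nonneg_left h6 (pow_pos hs 3).le
    have e3 : s ^ 3 * (c ^ 2 * (s⁻¹ ^ 3 * J₂)) = c ^ 2 * J₂ := by field_simp
    have e4 : s ^ 3 * (2 * (c / 2) ^ 2 * (s⁻¹ ^ 3 * J₂) + 2 * (s * J₀)) =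
        c ^ 2 * J₂ / 2 + 2 * s ^ 4 * J₀ := by field_simp
    rw [e3, e4] at h7
    linarith
  have h5 : s ^ 4 ≤ s := by
    have := pow_le_of_le_one hs.le hs1 (show 4 ≠ 0 by norm_num)
    exact this
  rw [le_div_iff₀ (by positivity)] at hsJ
  have h6 : 0 < c ^ 2 * J₂ := by positivity
  nlinarith [mul_le_mul_of_nonneg_right h5 hJ₀p.le]

end BumpEstimates

/-! ### The spectrum of the Hessian for a potential close to `-1`. -/

section HessianSpectrum

variable {N : ℕ} [NeZero N] {q : ℝ → ℝ} {hq : Continuous q}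
  {hp : Function.Periodic q (2 * Real.pi)}

/-- Above `max q` the essential bound leaves only eigenvalues; below `min q` the non-negativity of
the multiplier excludes spectrum; every number in between is a value of `q` by continuity. -/
theorem spectrum_hessian {z₀ z₁ : ℝ} (h₀ : ∀ x, q x ≤ q z₀) (h₁ : ∀ x, q z₁ ≤ q x) :
    spectrum ℂ (hessian N q hq hp) =
      Complex.ofReal '' (realEigenvalues (hessian N q hq hp) ∪ range q) := by
  ext z
  constructor
  · intro hz
    have hzr := re_mem_spectrum_of_isSelfAdjoint isSelfAdjoint_hessian hz
    refine ⟨z.re, ?_, hzr.symm⟩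
    rw [hzr] at hz
    rcases lt_or_ge (q z₀) z.re with h | h
    · exact Or.inl ((essBoundedAbove_hessian h₀).hasEigenvalue h hz)
    · right
      rcases lt_or_ge z.re (q z₁) with h' | h'
      · refine absurd hz (not_mem_spectrum_of_le_form (c := q z₁ - z.re) (by linarith) fun v => ?_)
        have h2 := le_re_inner_mulOp (q := onCircle N q hq hp) (r := q) (fun x => rfl) h₁
          (v : L2per N)
        have h3 := re_inner_negInvSecondDeriv_nonneg (v : L2per N)
        have h4 : ‖(v : L2per N)‖ = ‖v‖ := rfl
        rw [h4] at h2
        rw [form_hessian]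
        linarith
      · exact mem_range_of_exists_le_of_exists_ge hq ⟨z₁, h'⟩ ⟨z₀, h⟩
  · rintro ⟨x, hx | ⟨y, rfl⟩, rfl⟩
    · rw [ContinuousLinearMap.spectrum_eq]
      exact Module.End.HasEigenvalue.mem_spectrum hx
    · exact mem_spectrum_hessian y

/-- With `d = 1/(N+1)`, the symbol off `n = ±N` stays at distance at least `d` from `1`. A
perturbation of size `d/4` leaves `3d/4`, more than `ε = d/2`. The infinite family consists of bumps
at `z₀` at the scales `2⁻ⁱ`. -/
theorem exists_bifurcating_hessian {z₀ κ ρ η : ℝ}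
    (hq1 : ∀ x, |q x + 1| ≤ 1 / (4 * ((N : ℝ) + 1))) (h₀ : ∀ x, q x ≤ q z₀)
    (hκ : κ * bumpMoment < bumpEnergy) (hz₀ : ∀ x, q z₀ - q x ≤ κ * (x - z₀) ^ 2)
    {v₀ : zeroMean N} (hv₀ : v₀ ≠ 0) (hLv₀ : hessian N q hq hp v₀ = 0) (V : zeroMean N)
    (hV : ‖hessian N q hq hp V - (ρ : ℂ) • V‖ < η * ‖V‖)
    (hρ : 0 < ρ - η) (hρε : ρ + η < 1 / (2 * ((N : ℝ) + 1))) :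
    ∃ l : ℝ, 0 < l ∧ |l - ρ| < η ∧ Module.finrank ℂ (eigenspaceAt (hessian N q hq hp) l) = 1 ∧
      Module.finrank ℂ (eigenspaceAt (hessian N q hq hp) 0) = 1 ∧
      (∃ s : Finset ℝ,
        (s : Set ℝ) = realEigenvalues (hessian N q hq hp) ∩ Ioi 0 ∧
        (∀ μ ∈ s, FiniteDimensional ℂ (eigenspaceAt (hessian N q hq hp) μ)) ∧
        ∑ μ ∈ s, Module.finrank ℂ (eigenspaceAt (hessian N q hq hp) μ) = 2 * N - 1) ∧
      (realEigenvalues (hessian N q hq hp) ∩ Iio 0).Infinite ∧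
      spectrum ℂ (hessian N q hq hp) ∩ Metric.ball 0 (1 / (2 * ((N : ℝ) + 1))) = {0, (l : ℂ)} := by
  have hN : 1 ≤ N := Nat.pos_of_ne_zero (NeZero.ne N)
  have hN' : (1 : ℝ) ≤ N := by exact_mod_cast hN
  set d : ℝ := 1 / ((N : ℝ) + 1) with hd
  have hd0 : 0 < d := by positivity
  have hd1 : d ≤ 1 / 2 := by
    rw [hd, div_le_div_iff₀ (by positivity) (by norm_num)]
    linarith
  have e1 : 1 / (4 * ((N : ℝ) + 1)) = d / 4 := by rw [hd]; field_simp
  have e2 : 1 / (2 * ((N : ℝ) + 1)) = d / 2 := by rw [hd]; field_simp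
  rw [e1] at hq1
  rw [e2] at hρε ⊢
  have hup (x : ℝ) : q x ≤ -1 + d / 4 := by linarith [(abs_le.1 (hq1 x)).2]
  have hlo (x : ℝ) : -1 - d / 4 ≤ q x := by linarith [(abs_le.1 (hq1 x)).1]
  have hpow (i : ℕ) : (0 : ℝ) < (1 / 2) ^ i := by positivity
  have hpow1 (i : ℕ) : ((1 : ℝ) / 2) ^ i ≤ 1 := pow_le_one₀ (by norm_num) (by norm_num)
  have hpow2 (i j : ℕ) (hij : i ≠ j) :
      2 * ((1 : ℝ) / 2) ^ i ≤ (1 / 2) ^ j ∨ 2 * ((1 : ℝ) / 2) ^ j ≤ (1 / 2) ^ i := by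
    have key (i j : ℕ) (h : i < j) : 2 * ((1 : ℝ) / 2) ^ j ≤ (1 / 2) ^ i := by
      have := pow_le_pow_of_le_one (show (0 : ℝ) ≤ 1 / 2 by norm_num) (by norm_num)
        (show i + 1 ≤ j from h)
      rw [pow_succ] at this
      linarith
    rcases lt_or_gt_of_ne hij with h | h
    · exact Or.inr (key i j h)
    · exact Or.inl (key j i h)
  exact exists_bifurcating_eigenvalue isSelfAdjoint_hessian hN (essBoundedAbove_hessian h₀)
    (by linarith [hup z₀]) (lowCoeffs N) (finrank_lowModes N)
    (fun v hv hv0 => by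
      refine (form_hessian_of_lowCoeffs hup hv).trans_lt
        (mul_lt_mul_of_pos_right ?_ (by have := norm_pos_iff.2 hv0; positivity))
      linarith)
    (lowSum N) (by rw [finrank_lowModes, Nat.mul_sub])
    (fun w hw => by
      refine lt_of_lt_of_le
        (mul_lt_mul_of_pos_right ?_ (by have := norm_pos_iff.2 (lowSum_ne_zero hw); positivity))
        (form_hessian_lowSum hlo w)
      linarith)
    hv₀ hLv₀ V hV hρ hρε (fun i => bumpVec N z₀ (hpow i) (hpow1 i))
    (fun i => lt_form_bumpVec _ _ hκ hz₀)
    (fun i j hij => ⟨inner_bumpVec_eq_zero _ _ _ _ (hpow2 i j hij),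
      inner_hessian_bumpVec_eq_zero _ _ _ _ (hpow2 i j hij)⟩)

end HessianSpectrum

/-! ### Waves as reparametrised rotations. -/

section Profiles

/-- Data which turn the equation `γ (c₁(W) W')' + W = 0` into a rotation: `W = w(y)`, where `y`
satisfies `√γ g(y) y' = p`, `√γ g(y) p' = -y`. -/
structure Profile (c₁ w g : ℝ → ℝ) (R : ℝ) : Prop where
  pos : 0 < R
  differentiable : Differentiable ℝ c₁
  continuous : Continuous g
  half_le : ∀ y, 1 / 2 ≤ g y
  at_zero : g 0 = 1
  contDiffOn_g : ContDiffOn ℝ ∞ g (Ioo (-R) R)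
  contDiffOn_w : ContDiffOn ℝ ∞ w (Ioo (-R) R)
  mul_eq : ∀ y ∈ Ioo (-R) R, w y * g y = y
  deriv_eq : ∀ y ∈ Ioo (-R) R, c₁ (w y) * deriv w y = g y
  add_le : ∀ y ∈ Ioo (-R) R, g y + g (-y) ≤ 2 - y ^ 2 / 4

/-- Waves in the normalised form `γ (c₁(W) W')' + W = 0`. -/
abbrev IsNormalWave (γ : ℝ) (c₁ W : ℝ → ℝ) : Prop := IsWave (fun w => γ * c₁ w) W

/-- The angle reparametrisation `θ ↦ ∫₀^θ g(r cos t) dt`. -/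
def angleInt (g : ℝ → ℝ) (r θ : ℝ) : ℝ := ∫ t in (0 : ℝ)..θ, g (r * Real.cos t)

variable {c₁ w g : ℝ → ℝ} {R : ℝ}

theorem Profile.continuous_comp_cos (h : Profile c₁ w g R) (r : ℝ) :
    Continuous fun t => g (r * Real.cos t) :=
  h.continuous.comp (continuous_const.mul Real.continuous_cos)

theorem Profile.hasDerivAt_angleInt (h : Profile c₁ w g R) (r θ : ℝ) :
    HasDerivAt (angleInt g r) (g (r * Real.cos θ)) θ :=
  intervalIntegral.integral_hasDerivAt_right
    ((h.continuous_comp_cos r).intervalIntegrable _ _)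
    (h.continuous_comp_cos r).aestronglyMeasurable.stronglyMeasurableAtFilter
    (h.continuous_comp_cos r).continuousAt

theorem Profile.pos_g (h : Profile c₁ w g R) (y : ℝ) : 0 < g y := by
  linarith [h.half_le y]

theorem mul_cos_mem_Ioo {r : ℝ} (hr : r ∈ Ioo (-R) R) (t : ℝ) : r * Real.cos t ∈ Ioo (-R) R := by
  have h1 : |r| < R := abs_lt.2 hr
  refine abs_lt.1 (lt_of_le_of_lt ?_ h1)
  rw [abs_mul]
  exact mul_le_of_le_one_right (abs_nonneg _) (Real.abs_cos_le_one t)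

/-- The shift `t ↦ t + π` replaces `y` by `-y`, so twice the integral is that of `g(y) + g(-y)`. The
odd part of `g` drops out and `add_le` supplies the quadratic deficit. -/
theorem Profile.angleInt_two_pi_le (h : Profile c₁ w g R) {r : ℝ} (hr : r ∈ Ioo (-R) R) :
    angleInt g r (2 * Real.pi) ≤ 2 * Real.pi - Real.pi * r ^ 2 / 8 := by
  have hc := h.continuous_comp_cos r
  have hc' : Continuous fun t => g (-(r * Real.cos t)) :=
    h.continuous.comp (continuous_const.mul Real.continuous_cos).neg
  have h1 : ∫ t in (0 : ℝ)..2 * Real.pi, g (-(r * Real.cos t)) = angleInt g r (2 * Real.pi) := by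
    have h2 : Function.Periodic (fun t => g (r * Real.cos t)) (2 * Real.pi) := fun t => by
      simp only [Real.cos_add_two_pi]
    have h3 := h2.intervalIntegral_add_eq 0 Real.pi
    rw [zero_add] at h3
    rw [angleInt, h3, add_comm Real.pi]
    have h4 := intervalIntegral.integral_comp_add_right (a := 0) (b := 2 * Real.pi)
      (fun t => g (r * Real.cos t)) Real.pi
    rw [zero_add] at h4
    rw [← h4]
    simp only [Real.cos_add_pi, mul_neg]
  have h2 : ∫ t in (0 : ℝ)..2 * Real.pi, (g (r * Real.cos t) + g (-(r * Real.cos t))) ≤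
      ∫ t in (0 : ℝ)..2 * Real.pi, (2 - r ^ 2 / 4 * Real.cos t ^ 2) := by
    refine intervalIntegral.integral_mono_on Real.two_pi_pos.le
      ((hc.add hc').intervalIntegrable _ _) (Continuous.intervalIntegrable (by fun_prop) _ _)
      fun t _ => ?_
    have := h.add_le _ (mul_cos_mem_Ioo hr t)
    rw [mul_pow] at this
    linarith
  rw [intervalIntegral.integral_add (hc.intervalIntegrable _ _) (hc'.intervalIntegrable _ _), h1,
    intervalIntegral.integral_sub (by simp) (Continuous.intervalIntegrable (by fun_prop) _ _),
    intervalIntegral.integral_const, intervalIntegral.integral_const_mul, integral_cos_sq] at h2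
  simp only [Real.sin_two_pi, Real.sin_zero, mul_zero, sub_zero, smul_eq_mul] at h2
  change angleInt g r (2 * Real.pi) + _ ≤ _ at h2
  linarith

theorem Profile.half_mul_le_angleInt (h : Profile c₁ w g R) (r : ℝ) {θ : ℝ} (hθ : 0 ≤ θ) :
    θ / 2 ≤ angleInt g r θ := by
  have : ∫ _ in (0 : ℝ)..θ, (1 / 2 : ℝ) ≤ angleInt g r θ :=
    intervalIntegral.integral_mono_on hθ (by simp)
      ((h.continuous_comp_cos r).intervalIntegrable _ _) fun t _ => h.half_le _
  rw [intervalIntegral.integral_const, smul_eq_mul] at this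
  linarith

/-- Every wave with values in the range of the profile is a reparametrised rotation. -/
theorem Profile.exists_angle (h : Profile c₁ w g R) {β : ℝ} (hβ : 1 < β) {W : ℝ → ℝ}
    (hW : IsNormalWave (β ^ 2) c₁ W) {Y : ℝ → ℝ} (hY : Differentiable ℝ fun z => Y (W z))
    (hYR : ∀ z, Y (W z) ∈ Ioo (-R) R) (hwY : ∀ z, w (Y (W z)) = W z) :
    ∃ r ∈ Ioo (-R) R, r ≠ 0 ∧ β * angleInt g r (2 * Real.pi) = 2 * Real.pi ∧
      ∃ Θ : ℝ → ℝ, (∀ z, β * angleInt g r (Θ z) = z) ∧ (∀ z, W z = w (r * Real.cos (Θ z))) ∧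
        ∀ z, HasDerivAt Θ (β * g (r * Real.cos (Θ z)))⁻¹ z := by
  have hβ0 : 0 < β := by linarith
  set y := fun z => Y (W z) with hy
  set p := fun z => β * (c₁ (W z) * deriv W z) with hp
  have hwd (z : ℝ) : HasDerivAt w (deriv w (y z)) (y z) :=
    (((h.contDiffOn_w _ (hYR z)).contDiffAt (Ioo_mem_nhds (hYR z).1 (hYR z).2)).differentiableAt
      (by simp)).hasDerivAt
  have hy' (z : ℝ) : HasDerivAt y (p z * (β * g (y z))⁻¹) z := by
    have h1 := (hY z).hasDerivAt
    have h2 := (hwd z).comp z h1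
    have h3 : deriv W z = deriv w (y z) * deriv y z := by
      have : (w ∘ fun z => Y (W z)) = W := funext hwY
      rw [this] at h2
      exact h2.deriv
    have h4 : p z = β * g (y z) * deriv y z := by
      rw [hp, ← h.deriv_eq _ (hYR z)]
      change β * (c₁ (W z) * deriv W z) = _
      rw [h3, show w (y z) = W z from hwY z]
      ring
    have h5 : β * g (y z) ≠ 0 := (mul_pos hβ0 (h.pos_g _)).ne'
    rw [h4, mul_comm (β * g (y z)), mul_assoc, mul_inv_cancel₀ h5, mul_one]
    exact h1
  have hp' (z : ℝ) : HasDerivAt p (-(y z) * (β * g (y z))⁻¹) z := by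
    have h1 := hW.ode z
    have h2 : W z = y z * (g (y z))⁻¹ := by
      have h6 := h.mul_eq _ (hYR z)
      rw [hwY z] at h6
      rw [eq_mul_inv_iff_mul_eq₀ (h.pos_g _).ne']
      exact h6
    have h3 : DifferentiableAt ℝ p z := by
      have e1 : Differentiable ℝ W := hW.smooth.differentiable (by simp)
      have e2 : Differentiable ℝ (deriv W) :=
        (contDiff_infty_iff_deriv.1 hW.smooth).2.differentiable (by simp)
      exact (((h.differentiable.comp e1) z).mul (e2 z)).const_mul β
    have h4 : deriv p z = -(y z) * (β * g (y z))⁻¹ := by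
      have h5 : (fun x => β ^ 2 * c₁ (W x) * deriv W x) = fun x => β * p x := by
        funext x
        simp only [hp]
        ring
      rw [h5, deriv_const_mul _ h3, h2] at h1
      have h6 := (h.pos_g (y z)).ne'
      rw [mul_inv]
      field_simp at h1 ⊢
      linarith
    rw [← h4]
    exact h3.hasDerivAt
  have hyc : Continuous y := hY.continuous
  have hκc : Continuous fun z => (β * g (y z))⁻¹ :=
    (continuous_const.mul (h.continuous.comp hyc)).inv₀ fun z => (mul_pos hβ0 (h.pos_g _)).ne'
  set Θ : ℝ → ℝ := fun z => ∫ x in (0 : ℝ)..z, (β * g (y x))⁻¹ with hΘ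
  have hΘ' (z : ℝ) : HasDerivAt Θ (β * g (y z))⁻¹ z :=
    intervalIntegral.integral_hasDerivAt_right (hκc.intervalIntegrable _ _)
      hκc.aestronglyMeasurable.stronglyMeasurableAtFilter hκc.continuousAt
  have hΘ0 : Θ 0 = 0 := by simp [hΘ]
  have hp0 : p 0 = 0 := by
    have h1 : deriv W 0 = 0 := by
      have h2 := deriv_comp_neg W 0
      have h3 : (fun x => W (-x)) = W := funext hW.even
      rw [h3, neg_zero] at h2
      linarith
    simp [hp, h1]
  -- Rotating `(y, p)` back by `Θ` gives a constant vector; it is `(y 0, 0)` because `W` is even and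
  -- so `p` vanishes at `0`.
  have hA (z : ℝ) : y z * Real.cos (Θ z) - p z * Real.sin (Θ z) = y 0 := by
    have h1 := is_const_of_deriv_eq_zero (f := fun z => y z * Real.cos (Θ z) - p z * Real.sin (Θ z))
      (fun z => (((hy' z).mul (hΘ' z).cos).sub ((hp' z).mul (hΘ' z).sin)).differentiableAt)
      (fun z => by
        have e : HasDerivAt (fun z => y z * Real.cos (Θ z) - p z * Real.sin (Θ z)) _ z :=
          ((hy' z).mul (hΘ' z).cos).sub ((hp' z).mul (hΘ' z).sin)
        rw [e.deriv]
        ring) z 0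
    simpa [hΘ0] using h1
  have hB (z : ℝ) : y z * Real.sin (Θ z) + p z * Real.cos (Θ z) = 0 := by
    have h1 := is_const_of_deriv_eq_zero (f := fun z => y z * Real.sin (Θ z) + p z * Real.cos (Θ z))
      (fun z => (((hy' z).mul (hΘ' z).sin).add ((hp' z).mul (hΘ' z).cos)).differentiableAt)
      (fun z => by
        have e : HasDerivAt (fun z => y z * Real.sin (Θ z) + p z * Real.cos (Θ z)) _ z :=
          ((hy' z).mul (hΘ' z).sin).add ((hp' z).mul (hΘ' z).cos)
        rw [e.deriv]
        ring) z 0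
    simpa [hΘ0, hp0] using h1
  have hyr (z : ℝ) : y z = y 0 * Real.cos (Θ z) := by
    linear_combination Real.cos (Θ z) * hA z + Real.sin (Θ z) * hB z -
      y z * Real.sin_sq_add_cos_sq (Θ z)
  have hr0 : y 0 ≠ 0 := by
    intro h0
    obtain ⟨z, hz⟩ := hW.ne_zero
    have h1 := h.mul_eq _ (hYR z)
    rw [hwY z, show Y (W z) = y z from rfl, hyr z, h0, zero_mul] at h1
    exact hz ((mul_eq_zero.1 h1).resolve_right (h.pos_g 0).ne')
  have hΘd (z : ℝ) : HasDerivAt Θ (β * g (y 0 * Real.cos (Θ z)))⁻¹ z := by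
    rw [← hyr z]
    exact hΘ' z
  have hinv (z : ℝ) : β * angleInt g (y 0) (Θ z) = z := by
    have h1 (z : ℝ) : HasDerivAt (fun z => β * angleInt g (y 0) (Θ z) - z) (0 : ℝ) z := by
      have h2 : HasDerivAt (fun z => β * angleInt g (y 0) (Θ z) - z)
          (β * (g (y 0 * Real.cos (Θ z)) * (β * g (y 0 * Real.cos (Θ z)))⁻¹) - 1) z :=
        (((h.hasDerivAt_angleInt (y 0) (Θ z)).comp z (hΘd z)).const_mul β).sub (hasDerivAt_id z)
      have h3 : β * g (y 0 * Real.cos (Θ z)) ≠ 0 := (mul_pos hβ0 (h.pos_g _)).ne'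
      rwa [← mul_assoc, mul_inv_cancel₀ h3, sub_self] at h2
    have h2 := is_const_of_deriv_eq_zero (fun z => (h1 z).differentiableAt)
      (fun z => (h1 z).deriv) z 0
    simp only [hΘ0, angleInt, intervalIntegral.integral_same, mul_zero, sub_zero] at h2
    exact sub_eq_zero.1 h2
  -- Over `2π` the vector makes a whole number `k` of turns. As `g ≥ 1/2` and `β > 1`, these take a
  -- time larger than `kπ`, whence `k = 1`: shorter minimal periods are impossible.
  have hΘ2 : Θ (2 * Real.pi) = 2 * Real.pi := by
    have h1 : y (2 * Real.pi) = y 0 := by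
      have := hW.periodic 0
      rw [zero_add] at this
      simp only [hy, this]
    have h2 : Real.cos (Θ (2 * Real.pi)) = 1 := by
      have := hyr (2 * Real.pi)
      rw [h1] at this
      exact mul_left_cancel₀ hr0 (this.symm.trans (mul_one _).symm)
    obtain ⟨k, hk⟩ := (Real.cos_eq_one_iff _).1 h2
    have h3 := hinv (2 * Real.pi)
    have hpi := Real.pi_pos
    have hk1 : 0 < (k : ℝ) := by
      by_contra hneg
      push Not at hneg
      have h4 : Θ (2 * Real.pi) ≤ 0 := by rw [← hk]; nlinarith
      have h5 : 0 < Θ (2 * Real.pi) := intervalIntegral.intervalIntegral_pos_of_pos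
        (hκc.intervalIntegrable _ _) (fun x => inv_pos.2 (mul_pos hβ0 (h.pos_g _))) (by positivity)
      linarith
    have h4 := h.half_mul_le_angleInt (y 0) (θ := Θ (2 * Real.pi)) (by rw [← hk]; positivity)
    rw [← hk] at h4
    rw [← hk] at h3
    have hk2 : (k : ℝ) < 2 := by
      by_contra hge
      push Not at hge
      have h5 : 2 * Real.pi ≤ angleInt g (y 0) (↑k * (2 * Real.pi)) := by nlinarith
      nlinarith
    have hk3 : k = 1 := by
      have e1 : 0 < k := by exact_mod_cast hk1
      have e2 : k < 2 := by exact_mod_cast hk2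
      omega
    rw [← hk, hk3]
    simp
  refine ⟨y 0, hYR 0, hr0, ?_, Θ, hinv, fun z => ?_, hΘd⟩
  · have := hinv (2 * Real.pi)
    rwa [hΘ2] at this
  · rw [← hyr z]
    exact (hwY z).symm

theorem Profile.contDiff_g_cos (h : Profile c₁ w g R) {r : ℝ} (hr : r ∈ Ioo (-R) R) :
    ContDiff ℝ ∞ fun t => g (r * Real.cos t) :=
  contDiff_iff_contDiffAt.2 fun t => ContDiffAt.comp t
    (((h.contDiffOn_g _ (mul_cos_mem_Ioo hr t)).contDiffAt
      (Ioo_mem_nhds (mul_cos_mem_Ioo hr t).1 (mul_cos_mem_Ioo hr t).2)))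
    (contDiff_const.mul Real.contDiff_cos).contDiffAt

/-- Bootstrap: if `Θ` is `C^n`, then so is `Θ' = F ∘ Θ`. -/
theorem contDiff_of_hasDerivAt_comp {Θ F : ℝ → ℝ} (hF : ContDiff ℝ ∞ F)
    (h : ∀ z, HasDerivAt Θ (F (Θ z)) z) : ContDiff ℝ ∞ Θ := by
  have hd : deriv Θ = F ∘ Θ := funext fun z => (h z).deriv
  rw [contDiff_infty]
  intro n
  induction n with
  | zero =>
    exact contDiff_zero.2 (continuous_iff_continuousAt.2 fun z => (h z).continuousAt)
  | succ n ih =>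
    rw [Nat.cast_add, Nat.cast_one, contDiff_succ_iff_deriv]
    refine ⟨fun z => (h z).differentiableAt, by simp, ?_⟩
    rw [hd]
    exact (hF.of_le (by exact_mod_cast le_top)).comp ih

/-- The angle is the inverse of the travel time `θ ↦ β ∫₀^θ g(r cos t) dt`, which is strictly
increasing and, as `g ≥ 1/2`, unbounded in both directions. -/
theorem Profile.exists_inverse (h : Profile c₁ w g R) {β r : ℝ} (hβ : 0 < β) :
    ∃ Θ : ℝ → ℝ, Continuous Θ ∧ (∀ z, β * angleInt g r (Θ z) = z) ∧
      (∀ θ, Θ (β * angleInt g r θ) = θ) ∧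
      ∀ z, HasDerivAt Θ (β * g (r * Real.cos (Θ z)))⁻¹ z := by
  have hd (θ : ℝ) : HasDerivAt (fun θ => β * angleInt g r θ) (β * g (r * Real.cos θ)) θ :=
    (h.hasDerivAt_angleInt r θ).const_mul β
  have hmono : StrictMono fun θ => β * angleInt g r θ :=
    strictMono_of_deriv_pos fun θ => by
      rw [(hd θ).deriv]
      exact mul_pos hβ (h.pos_g _)
  have hcont : Continuous fun θ => β * angleInt g r θ :=
    continuous_iff_continuousAt.2 fun θ => (hd θ).continuousAt
  have hneg (θ : ℝ) (hθ : θ ≤ 0) : angleInt g r θ ≤ θ / 2 := by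
    have h1 := h.half_mul_le_angleInt r (θ := -θ) (by linarith)
    have h2 : angleInt g r (-θ) = - angleInt g r θ := by
      have h3 := intervalIntegral.integral_comp_neg (a := θ) (b := 0) (fun t => g (r * Real.cos t))
      rw [neg_zero] at h3
      rw [angleInt, ← h3, intervalIntegral.integral_symm, angleInt]
      simp only [Real.cos_neg]
    linarith
  have hsurj : Function.Surjective fun θ => β * angleInt g r θ := by
    refine hcont.surjective ?_ ?_
    · refine Filter.tendsto_atTop_mono' _ ?_
        (Filter.tendsto_id.const_mul_atTop (show 0 < β / 2 by positivity))
      filter_upwards [Filter.eventually_ge_atTop 0] with θ hθ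
      have := mul_le_mul_of_nonneg_left (h.half_mul_le_angleInt r hθ) hβ.le
      simp only [id]
      linarith
    · refine Filter.tendsto_atBot_mono' _ ?_
        (Filter.tendsto_id.const_mul_atBot (show 0 < β / 2 by positivity))
      filter_upwards [Filter.eventually_le_atBot 0] with θ hθ
      have := mul_le_mul_of_nonneg_left (hneg θ hθ) hβ.le
      simp only [id]
      linarith
  set e := hmono.orderIsoOfSurjective _ hsurj with he
  have h1 (z : ℝ) : β * angleInt g r (e.symm z) = z := e.apply_symm_apply z
  have h2 (θ : ℝ) : e.symm (β * angleInt g r θ) = θ := e.symm_apply_apply θ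
  refine ⟨e.symm, e.symm.continuous, h1, h2, fun z => ?_⟩
  exact (hd (e.symm z)).of_local_left_inverse e.symm.continuous.continuousAt
    (mul_pos hβ (h.pos_g _)).ne' (Filter.Eventually.of_forall h1)

/-- Converse of `Profile.exists_angle`. The period condition gives `Θ(z + 2π) = Θ(z) + 2π`, and the
flux of `w(r cos Θ)` equals `-β r sin Θ`, whose derivative is `-w`. -/
theorem Profile.isNormalWave (h : Profile c₁ w g R) {β r : ℝ} (hβ : 0 < β) (hr : r ∈ Ioo (-R) R)
    (hr0 : r ≠ 0) (hper : β * angleInt g r (2 * Real.pi) = 2 * Real.pi) :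
    ∃ W, IsNormalWave (β ^ 2) c₁ W := by
  obtain ⟨Θ, hΘc, hΘ1, hΘ2, hΘd⟩ := h.exists_inverse (r := r) hβ
  have hΘs : ContDiff ℝ ∞ Θ := by
    refine contDiff_of_hasDerivAt_comp (F := fun t => (β * g (r * Real.cos t))⁻¹) ?_ hΘd
    exact (contDiff_const.mul (h.contDiff_g_cos hr)).inv fun t => (mul_pos hβ (h.pos_g _)).ne'
  have hadd (θ : ℝ) : angleInt g r (θ + 2 * Real.pi) =
      angleInt g r θ + angleInt g r (2 * Real.pi) := by
    have h2 : Function.Periodic (fun t => g (r * Real.cos t)) (2 * Real.pi) := fun t => by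
      simp only [Real.cos_add_two_pi]
    have h3 := h2.intervalIntegral_add_eq θ 0
    rw [zero_add] at h3
    have hi (a b : ℝ) : IntervalIntegrable (fun t => g (r * Real.cos t)) volume a b :=
      (h.continuous_comp_cos r).intervalIntegrable a b
    simp only [angleInt]
    rw [← h3, intervalIntegral.integral_add_adjacent_intervals (hi _ _) (hi _ _)]
  have hneg (θ : ℝ) : angleInt g r (-θ) = -angleInt g r θ := by
    have h3 := intervalIntegral.integral_comp_neg (a := θ) (b := 0) (fun t => g (r * Real.cos t))
    rw [neg_zero] at h3
    rw [angleInt, ← h3, intervalIntegral.integral_symm, angleInt]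
    simp only [Real.cos_neg]
  have hΘper (z : ℝ) : Θ (z + 2 * Real.pi) = Θ z + 2 * Real.pi := by
    rw [← hΘ2 (Θ z + 2 * Real.pi), hadd, mul_add, hΘ1, hper]
  have hΘneg (z : ℝ) : Θ (-z) = -Θ z := by
    rw [← hΘ2 (-Θ z), hneg, mul_neg, hΘ1]
  set y := fun z => r * Real.cos (Θ z) with hy
  have hyR (z : ℝ) : y z ∈ Ioo (-R) R := mul_cos_mem_Ioo hr _
  have hws : ContDiff ℝ ∞ fun z => w (y z) :=
    contDiff_iff_contDiffAt.2 fun t => ContDiffAt.comp t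
      ((h.contDiffOn_w _ (hyR t)).contDiffAt (Ioo_mem_nhds (hyR t).1 (hyR t).2))
      (contDiff_const.mul (Real.contDiff_cos.comp hΘs)).contDiffAt
  have hwd (z : ℝ) : HasDerivAt w (deriv w (y z)) (y z) :=
    (((h.contDiffOn_w _ (hyR z)).contDiffAt (Ioo_mem_nhds (hyR z).1 (hyR z).2)).differentiableAt
      (by simp)).hasDerivAt
  have hyd (z : ℝ) : HasDerivAt y (r * (-Real.sin (Θ z) * (β * g (y z))⁻¹)) z :=
    (hΘd z).cos.const_mul r
  refine ⟨fun z => w (y z), hws, fun z => ?_, fun z => ?_, ⟨0, ?_⟩, fun z => ?_⟩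
  · simp only [hy, hΘper, Real.cos_add_two_pi]
  · simp only [hy, hΘneg, Real.cos_neg]
  · have h1 : Θ 0 = 0 := by
      have := hΘneg 0
      rw [neg_zero] at this
      linarith
    intro h2
    have h3 := h.mul_eq _ (hyR 0)
    rw [h2, zero_mul] at h3
    simp only [hy, h1, Real.cos_zero, mul_one] at h3
    exact hr0 h3.symm
  · have h1 : (fun x => β ^ 2 * c₁ (w (y x)) * deriv (fun z => w (y z)) x) =
        fun x => -(β * r) * Real.sin (Θ x) := by
      funext x
      have h2 : deriv (fun z => w (y z)) x = _ := ((hwd x).comp x (hyd x)).deriv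
      have h3 := h.deriv_eq _ (hyR x)
      have h4 := (h.pos_g (y x)).ne'
      rw [h2]
      have : β ^ 2 * c₁ (w (y x)) * (deriv w (y x) * (r * (-Real.sin (Θ x) * (β * g (y x))⁻¹))) =
          (c₁ (w (y x)) * deriv w (y x)) * (β ^ 2 * (r * (-Real.sin (Θ x) * (β * g (y x))⁻¹))) := by
        ring
      rw [this, h3]
      field_simp
    rw [h1, ((hΘd z).sin.const_mul (-(β * r))).deriv]
    have h3 := h.mul_eq _ (hyR z)
    have h4 := (h.pos_g (y z)).ne'
    have h5 : w (y z) = y z / g (y z) := by rw [eq_div_iff h4, h3]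
    rw [h5, show g (r * Real.cos (Θ z)) = g (y z) from rfl, show y z = r * Real.cos (Θ z) from rfl]
    field_simp
    ring

/-- The integral of `g` over a turn depends continuously on `r`, is `2π` at `r = 0` and at most `2π
- πR²/32` at `r = R/2`. The bound on `β - 1` places `2π/β` between the two. -/
theorem Profile.exists_normalWave (h : Profile c₁ w g R) {β : ℝ} (hβ : 1 < β)
    (hβR : β - 1 < R ^ 2 / 64) : ∃ W, IsNormalWave (β ^ 2) c₁ W := by
  have hR := h.pos
  have hc : Continuous fun r => angleInt g r (2 * Real.pi) :=
    intervalIntegral.continuous_parametric_intervalIntegral_of_continuous'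
      (by
        have := h.continuous
        simp only [Function.uncurry_def]
        fun_prop) _ _
  have h0 : angleInt g 0 (2 * Real.pi) = 2 * Real.pi := by simp [angleInt, h.at_zero]
  have h1 := h.angleInt_two_pi_le (r := R / 2) ⟨by linarith, by linarith⟩
  have hpi := Real.pi_pos
  have h2 : 2 * Real.pi / β ∈ Icc (angleInt g (R / 2) (2 * Real.pi)) (angleInt g 0 (2 * Real.pi)) := by
    constructor
    · refine h1.trans ?_
      rw [le_div_iff₀ (by linarith)]
      have : (2 - R ^ 2 / 32) * β ≤ 2 := by nlinarith [sq_nonneg R]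
      nlinarith
    · rw [h0, div_le_iff₀ (by linarith)]
      nlinarith
  obtain ⟨r, hr, hr2⟩ := intermediate_value_Icc' (by linarith : (0 : ℝ) ≤ R / 2) hc.continuousOn h2
  have hr2' : angleInt g r (2 * Real.pi) = 2 * Real.pi / β := hr2
  refine h.isNormalWave (r := r) (by linarith) ⟨by linarith [hr.1], by linarith [hr.2]⟩ ?_ ?_
  · rintro rfl
    rw [h0, eq_div_iff (by linarith)] at hr2'
    nlinarith
  · rw [hr2']
    field_simp

end Profiles

/-! ### Explicit trigonometric profiles. -/

section ExplicitProfiles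

theorem cos_le_one_sub_sin_sq_half (x : ℝ) : 2 * Real.cos x ≤ 2 - Real.sin x ^ 2 := by
  nlinarith [sq_nonneg (1 - Real.cos x), Real.sin_sq_add_cos_sq x]

/-- The angle of the profile `W² - 2W³/3 = y²`. -/
def cubicAngle (y : ℝ) : ℝ := Real.arcsin (√3 * y) / 3

/-- The solution `w = W` of `W² - 2W³/3 = y²` with the sign of `y`. -/
def cubicW (y : ℝ) : ℝ :=
  Real.sin (cubicAngle y) ^ 2 + √3 * Real.sin (cubicAngle y) * Real.cos (cubicAngle y)

/-- The quotient `y / cubicW y`. -/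
def cubicG (y : ℝ) : ℝ := Real.cos (cubicAngle y) - √3 / 3 * Real.sin (cubicAngle y)

theorem sin_three_cubicAngle {y : ℝ} (hy : y ∈ Ioo (-(1 / √3)) (1 / √3)) :
    Real.sin (3 * cubicAngle y) = √3 * y := by
  have h3 : 0 < √3 := by positivity
  have h1 := (div_lt_iff₀' h3).1 (show -1 / √3 < y by simpa [neg_div] using hy.1)
  have h2 := (lt_div_iff₀' h3).1 hy.2
  rw [cubicAngle, mul_div_cancel₀ _ (by norm_num : (3 : ℝ) ≠ 0), Real.sin_arcsin h1.le h2.le]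

theorem cubicAngle_mem (y : ℝ) :
    √3 / 2 ≤ Real.cos (cubicAngle y) ∧ |Real.sin (cubicAngle y)| ≤ 1 / 2 := by
  have h1 : -(Real.pi / 6) ≤ cubicAngle y := by
    have := Real.neg_pi_div_two_le_arcsin (√3 * y)
    rw [cubicAngle]
    linarith
  have h2 : cubicAngle y ≤ Real.pi / 6 := by
    have := Real.arcsin_le_pi_div_two (√3 * y)
    rw [cubicAngle]
    linarith
  have hpi := Real.pi_pos
  constructor
  · rw [← Real.cos_pi_div_six, ← Real.cos_abs (cubicAngle y)]
    exact Real.cos_le_cos_of_nonneg_of_le_pi (abs_nonneg _) (by linarith) (abs_le.2 ⟨h1, h2⟩)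
  · rw [abs_le, ← Real.sin_pi_div_six, ← Real.sin_neg]
    exact ⟨Real.sin_le_sin_of_le_of_le_pi_div_two (by linarith) (by linarith) h1,
      Real.sin_le_sin_of_le_of_le_pi_div_two (by linarith) (by linarith) h2⟩

/-- Together with `w g = y` this is the energy relation `w²(1 - 2w/3) = y²`, a cubic that the
triple-angle formula solves. -/
theorem cubicG_sq (y : ℝ) : cubicG y ^ 2 = 1 - 2 / 3 * cubicW y := by
  have h3 : √3 ^ 2 = 3 := Real.sq_sqrt (by norm_num)
  rw [cubicG, cubicW]
  linear_combination (Real.sin (cubicAngle y) ^ 2 / 9) * h3 +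
    Real.sin_sq_add_cos_sq (cubicAngle y)

/-- For `s = sin α` the left side is `sin² 3α`; this converts a bound in `sin² α` into one in `y²`.
-/
theorem sin_cos_sq_le {s : ℝ} (hs : |s| ≤ 1 / 2) : (3 * s - 4 * s ^ 3) ^ 2 ≤ 9 * s ^ 2 := by
  have h1 : s ^ 2 ≤ 1 / 4 := by
    have := sq_le_sq' (by linarith [abs_le.1 hs]) (abs_le.1 hs).2
    linarith
  have h2 : (3 * s - 4 * s ^ 3) ^ 2 = s ^ 2 * (3 - 4 * s ^ 2) ^ 2 := by ring
  rw [h2, mul_comm]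
  gcongr
  nlinarith [sq_nonneg s]

theorem hasDerivAt_cubicAngle {y : ℝ} (hy : y ∈ Ioo (-(1 / √3)) (1 / √3)) :
    ∃ D, HasDerivAt cubicAngle D y ∧ 3 * (D * Real.cos (3 * cubicAngle y)) = √3 ∧
      0 < Real.cos (3 * cubicAngle y) := by
  have h3 : 0 < √3 := by positivity
  have h1 := (div_lt_iff₀' h3).1 (show -1 / √3 < y by simpa [neg_div] using hy.1)
  have h2 := (lt_div_iff₀' h3).1 hy.2
  have h4 : HasDerivAt cubicAngle (1 / √(1 - (√3 * y) ^ 2) * (√3 * 1) / 3) y :=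
    ((Real.hasDerivAt_arcsin h1.ne' h2.ne).comp y ((hasDerivAt_id y).const_mul √3)).div_const 3
  have h5 : Real.cos (3 * cubicAngle y) = √(1 - (√3 * y) ^ 2) := by
    rw [cubicAngle, mul_div_cancel₀ _ (by norm_num : (3 : ℝ) ≠ 0), Real.cos_arcsin]
  have h6 : 0 < √(1 - (√3 * y) ^ 2) := Real.sqrt_pos.2 (by nlinarith)
  refine ⟨_, h4, ?_, h5 ▸ h6⟩
  rw [h5]
  generalize √(1 - (√3 * y) ^ 2) = t at h6
  field_simp

theorem contDiffAt_cubicAngle {y : ℝ} (hy : y ∈ Ioo (-(1 / √3)) (1 / √3)) :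
    ContDiffAt ℝ ∞ cubicAngle y := by
  have h3 : 0 < √3 := by positivity
  have h1 := (div_lt_iff₀' h3).1 (show -1 / √3 < y by simpa [neg_div] using hy.1)
  have h2 := (lt_div_iff₀' h3).1 hy.2
  exact ((Real.contDiffAt_arcsin h1.ne' h2.ne).comp y
    (contDiffAt_const.mul contDiffAt_id)).div_const 3

/-- The square of the radius is the value `1/3` of `w² - 2w³/3` at `w = 1`, where the coefficient `1
- w` degenerates. -/
theorem cubicProfile : Profile (fun w => 1 - w) cubicW cubicG (1 / √3) where
  pos := by positivity
  differentiable := by fun_prop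
  continuous := by
    unfold cubicG cubicAngle
    have := Real.continuous_arcsin
    fun_prop
  half_le y := by
    obtain ⟨h1, h2⟩ := cubicAngle_mem y
    have h3 : √3 ^ 2 = 3 := Real.sq_sqrt (by norm_num)
    have h5 : 3 / 2 ≤ √3 := Real.le_sqrt_of_sq_le (by norm_num)
    rw [cubicG]
    nlinarith [(abs_le.1 h2).2]
  at_zero := by simp [cubicG, cubicAngle]
  contDiffOn_g y hy := by
    have := contDiffAt_cubicAngle hy
    unfold cubicG
    exact (this.cos.sub (contDiffAt_const.mul this.sin)).contDiffWithinAt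
  contDiffOn_w y hy := by
    have := contDiffAt_cubicAngle hy
    unfold cubicW
    exact ((this.sin.pow 2).add ((contDiffAt_const.mul this.sin).mul this.cos)).contDiffWithinAt
  mul_eq y hy := by
    have h3 : √3 ^ 2 = 3 := Real.sq_sqrt (by norm_num)
    have h1 := sin_three_cubicAngle hy
    have h2 := Real.sin_sq_add_cos_sq (cubicAngle y)
    rw [Real.sin_three_mul] at h1
    rw [cubicW, cubicG]
    generalize Real.sin (cubicAngle y) = s at *
    generalize Real.cos (cubicAngle y) = c at *
    have h4 : y = √3 / 3 * (3 * s - 4 * s ^ 3) := by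
      rw [h1]
      linear_combination (-y / 3) * h3
    have h5 : c ^ 2 = 1 - s ^ 2 := by linarith
    rw [h4]
    linear_combination (√3 * s) * h5 - (s ^ 2 * c / 3) * h3
  deriv_eq y hy := by
    obtain ⟨D, hD, h1, h0⟩ := hasDerivAt_cubicAngle hy
    have h3 : √3 ^ 2 = 3 := Real.sq_sqrt (by norm_num)
    have h2 := Real.sin_sq_add_cos_sq (cubicAngle y)
    have h4 : HasDerivAt cubicW _ y := (hD.sin.pow 2).add ((hD.sin.const_mul √3).mul hD.cos)
    rw [h4.deriv, cubicW, cubicG]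
    -- Multiplying by `cos 3α > 0` trades the derivative `D` of the angle for `√3 / 3`, leaving a
    -- polynomial identity in `sin α` and `cos α`.
    refine mul_right_cancel₀ h0.ne' ?_
    rw [Real.cos_three_mul] at h1 ⊢
    generalize Real.sin (cubicAngle y) = s at *
    generalize Real.cos (cubicAngle y) = c at *
    have h5 : s ^ 2 = 1 - c ^ 2 := by linarith
    have h6 : D * (4 * c ^ 3 - 3 * c) = √3 / 3 := by linarith
    simp only [Nat.cast_ofNat, Nat.add_one_sub_one, pow_one]
    have h7 : (1 - (s ^ 2 + √3 * s * c)) * (2 * s * c + √3 * (c ^ 2 - s ^ 2)) * (√3 / 3) =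
        (c - √3 / 3 * s) * (4 * c ^ 3 - 3 * c) := by
      have e1 : 1 - (s ^ 2 + √3 * s * c) = c * (c - √3 * s) := by linear_combination -h5
      have e2 : 4 * c ^ 3 - 3 * c = c * (c ^ 2 - 3 * s ^ 2) := by linear_combination 3 * c * h5
      rw [e1, e2]
      linear_combination
        (c * (c - √3 * s) * (c ^ 2 - s ^ 2) / 3 - 2 * c ^ 2 * s ^ 2 / 3) * h3
    rw [← h7, ← h6]
    ring
  add_le y hy := by
    have h1 : cubicAngle (-y) = -cubicAngle y := by
      rw [cubicAngle, mul_neg, Real.arcsin_neg, neg_div, cubicAngle]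
    have h2 := cos_le_one_sub_sin_sq_half (cubicAngle y)
    have h3 := sin_cos_sq_le (cubicAngle_mem y).2
    rw [← Real.sin_three_mul, sin_three_cubicAngle hy, mul_pow,
      Real.sq_sqrt (by norm_num : (0 : ℝ) ≤ 3)] at h3
    rw [cubicG, cubicG, h1, Real.cos_neg, Real.sin_neg]
    nlinarith

/-- The angle of the profile `W² - W⁴/4 = y²`. -/
def quarticAngle (y : ℝ) : ℝ := Real.arcsin y / 2

/-- The solution `w = W` of `W² - W⁴/4 = y²` with the sign of `y`. -/
def quarticW (y : ℝ) : ℝ := 2 * Real.sin (quarticAngle y)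

/-- The quotient `y / quarticW y`. -/
def quarticG (y : ℝ) : ℝ := Real.cos (quarticAngle y)

theorem quarticG_sq (y : ℝ) : quarticG y ^ 2 = 1 - quarticW y ^ 2 / 4 := by
  rw [quarticG, quarticW]
  linear_combination Real.sin_sq_add_cos_sq (quarticAngle y)

theorem two_mul_quarticAngle (y : ℝ) : 2 * quarticAngle y = Real.arcsin y :=
  mul_div_cancel₀ _ (by norm_num : (2 : ℝ) ≠ 0)

theorem quarticW_sq_le (y : ℝ) : quarticW y ^ 2 ≤ 2 := by
  have h1 := Real.cos_arcsin_nonneg y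
  rw [← two_mul_quarticAngle, Real.cos_two_mul] at h1
  rw [quarticW]
  nlinarith [Real.sin_sq_add_cos_sq (quarticAngle y)]

/-- The double-angle formula replaces the triple-angle one. The radius is `1` because `w² - w⁴/4 =
1` at the degenerate value `w² = 2`. -/
theorem quarticProfile : Profile (fun w => 1 - w ^ 2 / 2) quarticW quarticG 1 where
  pos := one_pos
  differentiable := by fun_prop
  continuous := by
    unfold quarticG quarticAngle
    have := Real.continuous_arcsin
    fun_prop
  half_le y := by
    have hpi := Real.pi_pos
    have h1 := Real.neg_pi_div_two_le_arcsin y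
    have h2 := Real.arcsin_le_pi_div_two y
    rw [quarticG, ← Real.cos_pi_div_three, ← Real.cos_abs (quarticAngle y)]
    refine Real.cos_le_cos_of_nonneg_of_le_pi (abs_nonneg _) (by linarith) (abs_le.2 ⟨?_, ?_⟩) <;>
    · rw [quarticAngle]
      linarith
  at_zero := by simp [quarticG, quarticAngle]
  contDiffOn_g y hy := by
    have : ContDiffAt ℝ ∞ quarticAngle y :=
      (Real.contDiffAt_arcsin hy.1.ne' hy.2.ne).div_const 2
    exact this.cos.contDiffWithinAt
  contDiffOn_w y hy := by
    have : ContDiffAt ℝ ∞ quarticAngle y :=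
      (Real.contDiffAt_arcsin hy.1.ne' hy.2.ne).div_const 2
    exact (contDiffAt_const.mul this.sin).contDiffWithinAt
  mul_eq y hy := by
    rw [quarticW, quarticG, ← Real.sin_two_mul, two_mul_quarticAngle,
      Real.sin_arcsin hy.1.le hy.2.le]
  deriv_eq y hy := by
    have hD : HasDerivAt quarticAngle (1 / √(1 - y ^ 2) / 2) y :=
      (Real.hasDerivAt_arcsin hy.1.ne' hy.2.ne).div_const 2
    have h1 : √(1 - y ^ 2) = 2 * Real.cos (quarticAngle y) ^ 2 - 1 := by
      rw [← Real.cos_arcsin, ← two_mul_quarticAngle, Real.cos_two_mul]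
    have h0 : 0 < √(1 - y ^ 2) := Real.sqrt_pos.2 (by nlinarith [hy.1, hy.2])
    have h4 : HasDerivAt quarticW _ y := hD.sin.const_mul 2
    rw [h4.deriv, quarticW, quarticG]
    have h5 : 1 - (2 * Real.sin (quarticAngle y)) ^ 2 / 2 = √(1 - y ^ 2) := by
      rw [h1]
      linear_combination -2 * Real.sin_sq_add_cos_sq (quarticAngle y)
    rw [h5]
    field_simp
  add_le y hy := by
    have h1 : quarticAngle (-y) = -quarticAngle y := by
      rw [quarticAngle, Real.arcsin_neg, neg_div, quarticAngle]
    have h2 := cos_le_one_sub_sin_sq_half (quarticAngle y)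
    have h3 : y = 2 * Real.sin (quarticAngle y) * Real.cos (quarticAngle y) := by
      rw [← Real.sin_two_mul, two_mul_quarticAngle, Real.sin_arcsin hy.1.le hy.2.le]
    have h4 : y ^ 2 ≤ 4 * Real.sin (quarticAngle y) ^ 2 := by
      have := Real.sin_sq_add_cos_sq (quarticAngle y)
      have e : y ^ 2 = 4 * Real.sin (quarticAngle y) ^ 2 * Real.cos (quarticAngle y) ^ 2 := by
        conv_lhs => rw [h3]
        ring
      rw [e]
      exact mul_le_of_le_one_right (by positivity) (Real.cos_sq_le_one _)
    rw [quarticG, quarticG, h1, Real.cos_neg]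
    linarith

theorem cubicW_bounds (y : ℝ) : -(1 / 2) ≤ cubicW y ∧ cubicW y ≤ 1 := by
  obtain ⟨h1, h2⟩ := cubicAngle_mem y
  have h3 : √3 ^ 2 = 3 := Real.sq_sqrt (by norm_num)
  have h4 := Real.sin_sq_add_cos_sq (cubicAngle y)
  have h5 : 3 / 2 ≤ √3 := Real.le_sqrt_of_sq_le (by norm_num)
  rw [cubicW]
  generalize Real.sin (cubicAngle y) = s at *
  generalize Real.cos (cubicAngle y) = c at *
  constructor
  · have : s ^ 2 + √3 * s * c = -(1 / 2) + (√3 * s + c) ^ 2 / 2 := by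
      linear_combination (-s ^ 2 / 2) * h3 - h4 / 2
    rw [this]
    linarith [sq_nonneg (√3 * s + c)]
  · have e : 1 - (s ^ 2 + √3 * s * c) = c * (c - √3 * s) := by linear_combination -h4
    have h6 : 0 ≤ c := by linarith
    have h7 : 0 ≤ c - √3 * s := by nlinarith [(abs_le.1 h2).2]
    linarith [mul_nonneg h6 h7]

/-- The cubic profile inverts `w ↦ w √(1 - 2w/3)` on `(-1/2, 1)`. -/
theorem cubicW_apply {u : ℝ} (h₁ : -(1 / 2) < u) (h₂ : u < 1) :
    u * √(1 - 2 / 3 * u) ∈ Ioo (-(1 / √3)) (1 / √3) ∧ cubicW (u * √(1 - 2 / 3 * u)) = u := by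
  have hs : 0 < √(1 - 2 / 3 * u) := Real.sqrt_pos.2 (by linarith)
  have h3 : √(1 - 2 / 3 * u) ^ 2 = 1 - 2 / 3 * u := Real.sq_sqrt (by linarith)
  set y := u * √(1 - 2 / 3 * u) with hy
  have hy2 : y ^ 2 = u ^ 2 * (1 - 2 / 3 * u) := by rw [hy, mul_pow, h3]
  have hmem : y ∈ Ioo (-(1 / √3)) (1 / √3) := by
    refine abs_lt.1 (abs_lt_of_sq_lt_sq ?_ (by positivity))
    rw [hy2, div_pow, Real.sq_sqrt (by norm_num : (0 : ℝ) ≤ 3)]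
    have : 0 < (1 - u) ^ 2 * (2 * u + 1) :=
      mul_pos (pow_pos (by linarith) 2) (by linarith)
    linarith
  refine ⟨hmem, ?_⟩
  have h4 := cubicProfile.mul_eq y hmem
  have h5 := cubicG_sq y
  have h6 := cubicProfile.pos_g y
  obtain ⟨h7, h8⟩ := cubicW_bounds y
  generalize cubicW y = w at *
  generalize cubicG y = g at *
  have h9 : w ^ 2 * (1 - 2 / 3 * w) = u ^ 2 * (1 - 2 / 3 * u) := by
    rw [← hy2, ← h5, ← h4]
    ring
  -- `w` and `u` have the same energy, and the same sign since both are positive multiples of `y`.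
  -- For `u ≠ 0` the second factor then cannot vanish: it is positive when `0 < u < 1`, `0 ≤ w ≤ 1`,
  -- and negative when `u < 0`, `w ≤ 0`.
  have h10 : (w - u) * (w + u - 2 / 3 * (w ^ 2 + w * u + u ^ 2)) = 0 := by
    linear_combination h9
  rcases mul_eq_zero.1 h10 with h11 | h11
  · linarith
  · have h12 : 0 ≤ w * u := by
      have e : w * u * (g * √(1 - 2 / 3 * u)) = y ^ 2 := by
        calc _ = (w * g) * (u * √(1 - 2 / 3 * u)) := by ring
          _ = y ^ 2 := by rw [h4, ← hy]; ring
      by_contra hneg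
      push Not at hneg
      have := mul_neg_of_neg_of_pos hneg (mul_pos h6 hs)
      nlinarith [sq_nonneg y]
    rcases le_or_gt 0 u with hu | hu
    · rcases eq_or_lt_of_le hu with hu | hu
      · have : y = 0 := by rw [hy, ← hu, zero_mul]
        rw [this] at h4
        rw [(mul_eq_zero.1 h4).resolve_right h6.ne']
        exact hu
      · have hw : 0 ≤ w := nonneg_of_mul_nonneg_left h12 hu
        nlinarith
    · have hw : w ≤ 0 := by
        by_contra hneg
        push Not at hneg
        nlinarith
      nlinarith

/-- The quartic profile inverts `w ↦ w √(1 - w²/4)` on `w² < 2`. -/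
theorem quarticW_apply {u : ℝ} (h₁ : u ^ 2 < 2) :
    u * √(1 - u ^ 2 / 4) ∈ Ioo (-1) 1 ∧ quarticW (u * √(1 - u ^ 2 / 4)) = u := by
  have hs : 0 < √(1 - u ^ 2 / 4) := Real.sqrt_pos.2 (by linarith)
  have h3 : √(1 - u ^ 2 / 4) ^ 2 = 1 - u ^ 2 / 4 := Real.sq_sqrt (by linarith)
  set y := u * √(1 - u ^ 2 / 4) with hy
  have hy2 : y ^ 2 = u ^ 2 * (1 - u ^ 2 / 4) := by rw [hy, mul_pow, h3]
  have hmem : y ∈ Ioo (-1) 1 := by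
    refine abs_lt.1 (abs_lt_of_sq_lt_sq ?_ zero_le_one)
    rw [hy2]
    nlinarith
  refine ⟨hmem, ?_⟩
  have h4 := quarticProfile.mul_eq y hmem
  have h5 := quarticG_sq y
  have h6 := quarticProfile.pos_g y
  have h7 := quarticW_sq_le y
  generalize quarticW y = w at *
  generalize quarticG y = g at *
  have h9 : w ^ 2 * (1 - w ^ 2 / 4) = u ^ 2 * (1 - u ^ 2 / 4) := by
    rw [← hy2, ← h5, ← h4]
    ring
  have h10 : (w ^ 2 - u ^ 2) * (4 - (w ^ 2 + u ^ 2)) = 0 := by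
    linear_combination 4 * h9
  -- The other branch would need `w² + u² = 4`, but `w² ≤ 2` and `u² < 2`.
  have h11 : w ^ 2 = u ^ 2 := by
    rcases mul_eq_zero.1 h10 with h11 | h11 <;> linarith
  have h12 : 0 ≤ w * u := by
    have e : w * u * (g * √(1 - u ^ 2 / 4)) = y ^ 2 := by
      calc _ = (w * g) * (u * √(1 - u ^ 2 / 4)) := by ring
        _ = y ^ 2 := by rw [h4, ← hy]; ring
    by_contra hneg
    push Not at hneg
    have := mul_neg_of_neg_of_pos hneg (mul_pos h6 hs)
    nlinarith [sq_nonneg y]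
  have h13 : (w - u) ^ 2 ≤ 0 := by
    rcases sq_eq_sq_iff_eq_or_eq_neg.1 h11 with h | h
    · rw [h]; simp
    · nlinarith
  nlinarith [pow_eq_zero_iff (two_ne_zero) |>.1 (le_antisymm h13 (sq_nonneg _))]

end ExplicitProfiles

/-! ### A priori range of the waves and bounds on their derivatives. -/

section WaveRange

variable {c U : ℝ → ℝ}

theorem IsWave.hasDerivAt (h : IsWave c U) (z : ℝ) : HasDerivAt U (deriv U z) z :=
  (h.smooth.differentiable (by simp) z).hasDerivAt

theorem IsWave.hasDerivAt_deriv (h : IsWave c U) (z : ℝ) :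
    HasDerivAt (deriv U) (deriv (deriv U) z) z :=
  ((contDiff_infty_iff_deriv.1 h.smooth).2.differentiable (by simp) z).hasDerivAt

theorem IsWave.hasDerivAt_flux (h : IsWave c U) (hc : Differentiable ℝ c) (z : ℝ) :
    HasDerivAt (fun x => c (U x) * deriv U x) (-U z) z := by
  have h1 : DifferentiableAt ℝ (fun x => c (U x) * deriv U x) z :=
    ((hc (U z)).comp z (h.hasDerivAt z).differentiableAt).mul (h.hasDerivAt_deriv z).differentiableAt
  have h2 : deriv (fun x => c (U x) * deriv U x) z = -U z := by linarith [h.ode z]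
  exact h2 ▸ h1.hasDerivAt

/-- The equation in nondivergence form. -/
theorem IsWave.second_deriv (h : IsWave c U) (hc : Differentiable ℝ c) (z : ℝ) :
    deriv c (U z) * deriv U z ^ 2 + c (U z) * deriv (deriv U) z = -U z := by
  have h1 : HasDerivAt (fun x => c (U x) * deriv U x)
      (deriv c (U z) * deriv U z * deriv U z + c (U z) * deriv (deriv U) z) z :=
    ((hc (U z)).hasDerivAt.comp z (h.hasDerivAt z)).mul (h.hasDerivAt_deriv z)
  rw [← h1.unique (h.hasDerivAt_flux hc z)]
  ring

theorem IsWave.deriv_zero (h : IsWave c U) : deriv U 0 = 0 := by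
  have h2 := deriv_comp_neg U 0
  rw [show (fun x => U (-x)) = U from funext h.even, neg_zero] at h2
  linarith

theorem exists_forall_le_of_periodic {f : ℝ → ℝ} (hf : Continuous f) {T : ℝ} (hT : 0 < T)
    (hp : Function.Periodic f T) : ∃ x₀, ∀ x, f x ≤ f x₀ := by
  obtain ⟨x₀, -, h0⟩ := isCompact_Icc.exists_isMaxOn (nonempty_Icc.2 hT.le) hf.continuousOn
  refine ⟨x₀, fun x => ?_⟩
  obtain ⟨y, hy, hxy⟩ := hp.exists_mem_Ico₀ hT x
  rw [hxy]
  exact h0 (Ico_subset_Icc_self hy)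

theorem exists_forall_ge_of_periodic {f : ℝ → ℝ} (hf : Continuous f) {T : ℝ} (hT : 0 < T)
    (hp : Function.Periodic f T) : ∃ x₀, ∀ x, f x₀ ≤ f x := by
  obtain ⟨x₀, h0⟩ := exists_forall_le_of_periodic hf.neg hT
    (fun x => by simp only [Pi.neg_apply, hp x])
  exact ⟨x₀, fun x => by simpa using h0 x⟩

/-- A positive second derivative would make `x₀` a local minimum as well, so `f` would be locally
constant. -/
theorem deriv_deriv_nonpos_of_isMax {f : ℝ → ℝ} {x₀ : ℝ} (hf : ContinuousAt f x₀)
    (h : ∀ x, f x ≤ f x₀) : deriv (deriv f) x₀ ≤ 0 := by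
  by_contra hpos
  push Not at hpos
  have h1 : deriv f x₀ = 0 := IsLocalMax.deriv_eq_zero (Filter.Eventually.of_forall h)
  have h2 := isLocalMin_of_deriv_deriv_pos hpos h1 hf
  have h3 : f =ᶠ[nhds x₀] fun _ => f x₀ := by
    filter_upwards [h2] with x hx using le_antisymm (h x) hx
  have h4 : deriv f =ᶠ[nhds x₀] deriv (fun _ => f x₀) := h3.deriv
  have h5 := h4.deriv_eq
  simp at h5
  linarith

/-- At a maximum `U' = 0`, so the equation reduces to `c(U) U'' = -U` with `d = U'' ≤ 0`. No
smallness or sign of `c` is needed. -/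
theorem IsWave.exists_max (h : IsWave c U) (hc : Differentiable ℝ c) :
    ∃ z₀, (∀ z, U z ≤ U z₀) ∧ deriv U z₀ = 0 ∧ ∃ d ≤ 0, c (U z₀) * d = -U z₀ := by
  obtain ⟨z₀, hz⟩ := exists_forall_le_of_periodic h.continuous Real.two_pi_pos h.periodic
  have h1 : deriv U z₀ = 0 := IsLocalMax.deriv_eq_zero (Filter.Eventually.of_forall hz)
  refine ⟨z₀, hz, h1, _, deriv_deriv_nonpos_of_isMax h.continuous.continuousAt hz, ?_⟩
  have := h.second_deriv hc z₀
  rwa [h1, zero_pow two_ne_zero, mul_zero, zero_add] at this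

/-- With `κ = γ` in the quadratic case and `κ = √γ` in the modified one, the coefficient becomes `γ`
times a fixed function; the inverse scalings lead back. -/
theorem IsWave.scale {κ : ℝ} (hκ : κ ≠ 0) (h : IsWave c U) :
    IsWave (fun w => c (κ * w)) (fun z => U z / κ) where
  smooth := h.smooth.div_const κ
  periodic z := by simp only [h.periodic z]
  even z := by simp only [h.even z]
  ne_zero := h.ne_zero.imp fun z hz => div_ne_zero hz hκ
  ode z := by
    have h1 : (fun x => c (κ * (U x / κ)) * deriv (fun z => U z / κ) x) =
        fun x => c (U x) * deriv U x / κ := by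
      funext x
      rw [deriv_div_const, mul_div_cancel₀ _ hκ]
      ring
    rw [h1, deriv_div_const]
    have := h.ode z
    rw [← add_div, this, zero_div]

/-- If `W ≥ 1` at the maximum, then `γ(1 - W)W'' ≥ 0 > -W`, contrary to the equation. For the lower
bound, the conserved energy keeps `W²/2 - W³/3` at or below its value at the maximum, which is less
than `1/6`, and `1 - 3W² + 2W³ = (1 - W)²(1 + 2W)`. -/
theorem IsNormalWave.cubic_range {γ : ℝ} {W : ℝ → ℝ} (hγ : 0 < γ)
    (h : IsNormalWave γ (fun w => 1 - w) W) (z : ℝ) : -(1 / 2) < W z ∧ W z < 1 := by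
  have hc : Differentiable ℝ fun w : ℝ => γ * (1 - w) := by fun_prop
  obtain ⟨z₀, h1, h2, d, hd, h3⟩ := h.exists_max hc
  have h4 : W z₀ < 1 := by
    by_contra hge
    push Not at hge
    have : 0 ≤ γ * (1 - W z₀) * d :=
      mul_nonneg_of_nonpos_of_nonpos (mul_nonpos_of_nonneg_of_nonpos hγ.le (by linarith)) hd
    linarith
  have h5 : 0 ≤ W z₀ := by
    have : γ * (1 - W z₀) * d ≤ 0 :=
      mul_nonpos_of_nonneg_of_nonpos (mul_nonneg hγ.le (by linarith)) hd
    linarith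
  refine ⟨?_, (h1 z).trans_lt h4⟩
  set p := fun x => γ * (1 - W x) * deriv W x with hp
  have hp' (x : ℝ) : HasDerivAt p (-W x) x := h.hasDerivAt_flux hc x
  have hE (x : ℝ) : HasDerivAt (fun x => p x ^ 2 / (2 * γ) + (W x ^ 2 / 2 - W x ^ 3 / 3)) 0 x := by
    have e := (((hp' x).pow 2).div_const (2 * γ)).add
      ((((h.hasDerivAt x).pow 2).div_const 2).sub (((h.hasDerivAt x).pow 3).div_const 3))
    convert! e using 1
    simp only [hp]
    field_simp
    ring
  have h6 := is_const_of_deriv_eq_zero (fun x => (hE x).differentiableAt)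
    (fun x => (hE x).deriv) z z₀
  have h7 : p z₀ = 0 := by simp [hp, h2]
  have h8 : 0 ≤ p z ^ 2 / (2 * γ) := div_nonneg (sq_nonneg _) (by linarith)
  simp only [h7] at h6
  have h9 : 0 < (1 - W z₀) ^ 2 * (2 * W z₀ + 1) :=
    mul_pos (pow_pos (by linarith) 2) (by linarith)
  have h10 : 0 < (1 - W z) ^ 2 * (2 * W z + 1) := by
    have : (0 : ℝ) ^ 2 / (2 * γ) = 0 := by simp
    rw [this] at h6
    nlinarith
  have := pos_of_mul_pos_right h10 (sq_nonneg _)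
  linarith

/-- The maximum argument applies to `W` and, by the symmetry of the equation, to `-W`. -/
theorem IsNormalWave.quartic_range {γ : ℝ} {W : ℝ → ℝ} (hγ : 0 < γ)
    (h : IsNormalWave γ (fun w => 1 - w ^ 2 / 2) W) (z : ℝ) : W z ^ 2 < 2 := by
  have key : ∀ {V : ℝ → ℝ}, IsNormalWave γ (fun w => 1 - w ^ 2 / 2) V → ∀ x, V x < √2 := by
    intro V h x
    obtain ⟨z₀, h1, -, d, hd, h3⟩ := h.exists_max (by fun_prop)
    refine (h1 x).trans_lt ?_
    by_contra hge
    push Not at hge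
    have h4 : 2 ≤ V z₀ ^ 2 := by
      have := pow_le_pow_left₀ (Real.sqrt_nonneg 2) hge 2
      rwa [Real.sq_sqrt (by norm_num)] at this
    have : 0 ≤ γ * (1 - V z₀ ^ 2 / 2) * d :=
      mul_nonneg_of_nonpos_of_nonpos (mul_nonpos_of_nonneg_of_nonpos hγ.le (by linarith)) hd
    have : 0 < √2 := by positivity
    linarith
  have h1 := key h z
  have h2 : IsNormalWave γ (fun w => 1 - w ^ 2 / 2) (fun z => W z / (-1)) := by
    simpa using IsWave.scale (κ := -1) (by norm_num) h
  have h3 := key h2 z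
  have h4 : (0 : ℝ) < √2 := by positivity
  have h5 : √2 ^ 2 = 2 := Real.sq_sqrt (by norm_num)
  rw [← h5]
  exact sq_lt_sq' (by linarith) h1

/-- Waves as reparametrised rotations, for the reduced Ostrovsky equation. -/
theorem IsOstrovskyWave.exists_angle {β : ℝ} (hβ : 1 < β) {U : ℝ → ℝ}
    (h : IsOstrovskyWave (β ^ 2) U) :
    ∃ r ∈ Ioo (-(1 / √3)) (1 / √3), r ≠ 0 ∧ β * angleInt cubicG r (2 * Real.pi) = 2 * Real.pi ∧
      ∃ Θ : ℝ → ℝ, (∀ z, β * angleInt cubicG r (Θ z) = z) ∧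
        ∀ z, U z = β ^ 2 * cubicW (r * Real.cos (Θ z)) := by
  have hγ : 0 < β ^ 2 := by positivity
  have h1 : IsNormalWave (β ^ 2) (fun w => 1 - w) (fun z => U z / β ^ 2) := by
    have := IsWave.scale hγ.ne' h
    have e : (fun w => β ^ 2 - β ^ 2 * w) = fun w => β ^ 2 * (1 - w) := by
      funext w
      ring
    rwa [e] at this
  have h2 := h1.cubic_range hγ
  obtain ⟨r, hr, hr0, hper, Θ, hΘ, hW, -⟩ := cubicProfile.exists_angle hβ h1
    (Y := fun u => u * √(1 - 2 / 3 * u))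
    (fun z => by
      have e := (h1.hasDerivAt z).differentiableAt
      exact e.mul (((e.const_mul (2 / 3)).const_sub 1).sqrt (by linarith [(h2 z).2])))
    (fun z => (cubicW_apply (h2 z).1 (h2 z).2).1) (fun z => (cubicW_apply (h2 z).1 (h2 z).2).2)
  refine ⟨r, hr, hr0, hper, Θ, hΘ, fun z => ?_⟩
  rw [← hW z, mul_div_cancel₀ _ hγ.ne']

/-- Waves as reparametrised rotations, for the modified reduced Ostrovsky equation. -/
theorem IsModifiedWave.exists_angle {β : ℝ} (hβ : 1 < β) {U : ℝ → ℝ}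
    (h : IsModifiedWave (β ^ 2) U) :
    ∃ r ∈ Ioo (-1 : ℝ) 1, r ≠ 0 ∧ β * angleInt quarticG r (2 * Real.pi) = 2 * Real.pi ∧
      ∃ Θ : ℝ → ℝ, (∀ z, β * angleInt quarticG r (Θ z) = z) ∧
        ∀ z, U z = β * quarticW (r * Real.cos (Θ z)) := by
  have hβ0 : 0 < β := by linarith
  have h1 : IsNormalWave (β ^ 2) (fun w => 1 - w ^ 2 / 2) (fun z => U z / β) := by
    have := IsWave.scale hβ0.ne' h
    have e : (fun w => β ^ 2 - (β * w) ^ 2 / 2) = fun w => β ^ 2 * (1 - w ^ 2 / 2) := by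
      funext w
      ring
    rwa [e] at this
  have h2 := h1.quartic_range (by positivity)
  obtain ⟨r, hr, hr0, hper, Θ, hΘ, hW, -⟩ := quarticProfile.exists_angle hβ h1
    (Y := fun u => u * √(1 - u ^ 2 / 4))
    (fun z => by
      have e := (h1.hasDerivAt z).differentiableAt
      exact e.mul ((((e.pow 2).div_const 4).const_sub 1).sqrt
        (by simp only [Pi.pow_apply]; linarith [h2 z])))
    (fun z => (quarticW_apply (h2 z)).1) (fun z => (quarticW_apply (h2 z)).2)
  refine ⟨r, hr, hr0, hper, Θ, hΘ, fun z => ?_⟩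
  rw [← hW z, mul_div_cancel₀ _ hβ0.ne']

theorem exists_ostrovskyWave {β : ℝ} (hβ : 1 < β) (hβ' : β - 1 < 1 / 192) :
    ∃ U, IsOstrovskyWave (β ^ 2) U := by
  obtain ⟨W, hW⟩ := cubicProfile.exists_normalWave hβ (by
    rw [div_pow, Real.sq_sqrt (by norm_num : (0 : ℝ) ≤ 3)]
    linarith)
  have hγ : (β ^ 2)⁻¹ ≠ 0 := by positivity
  have := IsWave.scale hγ hW
  have e : (fun w => β ^ 2 * (1 - (β ^ 2)⁻¹ * w)) = fun w => β ^ 2 - w := by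
    funext w
    field_simp
  rw [e] at this
  exact ⟨_, this⟩

theorem exists_modifiedWave {β : ℝ} (hβ : 1 < β) (hβ' : β - 1 < 1 / 64) :
    ∃ U, IsModifiedWave (β ^ 2) U := by
  obtain ⟨W, hW⟩ := quarticProfile.exists_normalWave hβ (by linarith)
  have hγ : β⁻¹ ≠ 0 := by positivity
  have := IsWave.scale hγ hW
  have e : (fun w => β ^ 2 * (1 - (β⁻¹ * w) ^ 2 / 2)) = fun w => β ^ 2 - w ^ 2 / 2 := by
    funext w
    field_simp
  rw [e] at this
  exact ⟨_, this⟩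

/-- Bounds for the derivatives of a small wave by its size. -/
theorem IsWave.deriv_bounds (h : IsWave c U) (hc : Differentiable ℝ c) {M : ℝ} (hM : M ≤ 1)
    (hU : ∀ z, |U z| ≤ M) (hc₁ : ∀ z, 1 / 2 ≤ c (U z)) (hc₂ : ∀ z, |deriv c (U z)| ≤ 1) (z : ℝ) :
    |deriv U z| ≤ 14 * M ∧ |deriv (deriv U) z| ≤ 394 * M := by
  have hM0 : 0 ≤ M := (abs_nonneg _).trans (hU 0)
  have hp : ∀ z, |deriv U z| ≤ 14 * M := by
    intro z
    obtain ⟨y, hy, hxy⟩ := h.periodic_deriv.exists_mem_Ico₀ Real.two_pi_pos z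
    rw [hxy]
    -- The flux vanishes at `0` by evenness and has derivative `-U`, so within a period of length
    -- `2π < 7` it stays below `7M`; dividing by `c ≥ 1/2` gives `14M`.
    have h1 : ‖c (U y) * deriv U y - c (U 0) * deriv U 0‖ ≤ M * ‖y - 0‖ :=
      Convex.norm_image_sub_le_of_norm_hasDerivWithin_le
        (fun x _ => (h.hasDerivAt_flux hc x).hasDerivWithinAt)
        (fun x _ => by rw [norm_neg]; exact hU x) convex_univ (mem_univ 0) (mem_univ y)
    rw [h.deriv_zero, mul_zero, sub_zero, sub_zero, Real.norm_eq_abs, Real.norm_eq_abs, abs_mul,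
      abs_of_nonneg hy.1] at h1
    have h2 : |c (U y)| * |deriv U y| ≥ 1 / 2 * |deriv U y| :=
      mul_le_mul_of_nonneg_right ((hc₁ y).trans (le_abs_self _)) (abs_nonneg _)
    have h3 : M * y ≤ M * 7 := mul_le_mul_of_nonneg_left
      (by linarith [hy.2, Real.pi_lt_d2]) hM0
    linarith
  refine ⟨hp z, ?_⟩
  have h1 := h.second_deriv hc z
  -- With `M ≤ 1` the right side is at most `197 M`, and `c ≥ 1/2` doubles it to `394 M`.
  have h2 : |c (U z) * deriv (deriv U) z| ≤ M + 1 * (14 * M) ^ 2 := by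
    have e : c (U z) * deriv (deriv U) z = -U z - deriv c (U z) * deriv U z ^ 2 := by linarith
    rw [e]
    refine (abs_sub _ _).trans (add_le_add (by rw [abs_neg]; exact hU z) ?_)
    rw [abs_mul, abs_pow]
    exact mul_le_mul (hc₂ z) (pow_le_pow_left₀ (abs_nonneg _) (hp z) 2) (by positivity) zero_le_one
  rw [abs_mul] at h2
  have h3 : |c (U z)| * |deriv (deriv U) z| ≥ 1 / 2 * |deriv (deriv U) z| :=
    mul_le_mul_of_nonneg_right ((hc₁ z).trans (le_abs_self _)) (abs_nonneg _)
  nlinarith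

/-- A function with second derivative at most `κ` lies above a parabola at its maximum. -/
theorem sub_le_of_isMax {f f₁ f₂ : ℝ → ℝ} {κ x₀ : ℝ} (h₁ : ∀ x, HasDerivAt f (f₁ x) x)
    (h₂ : ∀ x, HasDerivAt f₁ (f₂ x) x) (hκ : ∀ x, |f₂ x| ≤ κ) (hmax : ∀ x, f x ≤ f x₀) (x : ℝ) :
    f x₀ - f x ≤ κ * (x - x₀) ^ 2 := by
  have h0 : f₁ x₀ = 0 := by
    rw [← (h₁ x₀).deriv]
    exact IsLocalMax.deriv_eq_zero (Filter.Eventually.of_forall hmax)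
  have h3 (y : ℝ) : ‖f₁ y‖ ≤ κ * ‖y - x₀‖ := by
    have := Convex.norm_image_sub_le_of_norm_hasDerivWithin_le
        (fun x _ => (h₂ x).hasDerivWithinAt) (fun x _ => hκ x) convex_univ (mem_univ x₀) (mem_univ y)
    rwa [h0, sub_zero] at this
  have hκ0 : 0 ≤ κ := (abs_nonneg _).trans (hκ 0)
  have h4 : ‖f x - f x₀‖ ≤ κ * ‖x - x₀‖ * ‖x - x₀‖ :=
    Convex.norm_image_sub_le_of_norm_hasDerivWithin_le (s := uIcc x₀ x)
      (fun y _ => (h₁ y).hasDerivWithinAt)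
      (fun y hy => (h3 y).trans (mul_le_mul_of_nonneg_left
        (by simpa [Real.norm_eq_abs] using abs_sub_left_of_mem_uIcc hy) hκ0))
      (convex_uIcc _ _) left_mem_uIcc right_mem_uIcc
  rw [mul_assoc, Real.norm_eq_abs, Real.norm_eq_abs, ← sq, sq_abs] at h4
  linarith [neg_abs_le (f x - f x₀)]

end WaveRange

/-! ### Small-amplitude expansions of the profile and of the period. -/

section Expansions

theorem abs_sin_sub_self_le {h : ℝ} : |Real.sin h - h| ≤ h ^ 2 := by
  have h0 := abs_nonneg h
  rw [← sq_abs h]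
  rcases le_or_gt |h| 2 with h1 | h1
  · have h2 := Real.abs_sub_sin_le h
    rw [abs_sub_comm] at h2
    nlinarith [sq_nonneg |h|]
  · have h2 := (abs_sub (Real.sin h) h).trans (add_le_add_left (Real.abs_sin_le_one h) _)
    nlinarith

theorem abs_cos_sub_le (x y : ℝ) :
    |Real.cos x - (Real.cos y - (x - y) * Real.sin y)| ≤ 2 * (x - y) ^ 2 := by
  have e : Real.cos x - (Real.cos y - (x - y) * Real.sin y) =
      Real.cos y * (Real.cos (x - y) - 1) - Real.sin y * (Real.sin (x - y) - (x - y)) := by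
    have := Real.cos_add y (x - y)
    rw [add_sub_cancel] at this
    rw [this]
    ring
  have h1 : |Real.cos (x - y) - 1| ≤ (x - y) ^ 2 := by
    rw [abs_le]
    constructor
    · nlinarith [Real.one_sub_sq_div_two_le_cos (x := x - y)]
    · nlinarith [Real.cos_le_one (x - y)]
  rw [e]
  refine (abs_sub _ _).trans ?_
  rw [abs_mul, abs_mul]
  have h2 := mul_le_mul (Real.abs_cos_le_one y) h1 (abs_nonneg _) zero_le_one
  have h3 := mul_le_mul (Real.abs_sin_le_one y) (abs_sin_sub_self_le (h := x - y)) (abs_nonneg _)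
    zero_le_one
  linarith

/-- The identities `1 - g = 2w / (3(1 + g))` and `w - y = w(1 - g)` are iterated, each bound on `w`
improving that on `g` by one order in `y` and conversely. -/
theorem cubic_expansion {y : ℝ} (hy : y ∈ Ioo (-(1 / √3)) (1 / √3)) :
    |cubicG y - (1 - y / 3)| ≤ 2 * |y| ^ 2 ∧
    |cubicG y - (1 - y / 3 - y ^ 2 / 6)| ≤ 3 * |y| ^ 3 ∧
    |cubicW y - (y + y ^ 2 / 3)| ≤ 5 * |y| ^ 3 ∧ |cubicW y| ≤ 2 * |y| := by
  have h1 := cubicProfile.mul_eq y hy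
  have h2 := cubicG_sq y
  have h3 := cubicProfile.half_le y
  generalize cubicG y = g at *
  generalize cubicW y = w at *
  have hg : 0 < 1 + g := by linarith
  have hy0 := abs_nonneg y
  have hw : |w| ≤ 2 * |y| := by
    rw [← h1, abs_mul, abs_of_pos (by linarith : 0 < g)]
    nlinarith [abs_nonneg w]
  have e1 : 1 - g = 2 / 3 * w / (1 + g) := by
    rw [eq_div_iff hg.ne']
    linear_combination -h2
  have b1 : |1 - g| ≤ |y| := by
    rw [e1, abs_div, abs_of_pos hg, div_le_iff₀ hg, abs_mul, abs_of_pos (by norm_num : (0:ℝ) < 2/3)]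
    nlinarith
  have e2 : w - y = w * (1 - g) := by rw [← h1]; ring
  have b2 : |w - y| ≤ 2 * |y| ^ 2 := by
    rw [e2, abs_mul]
    nlinarith [mul_le_mul hw b1 (abs_nonneg _) (by positivity)]
  have e3 : 1 - g - y / 3 = (2 * (w - y) + y * (1 - g)) / (3 * (1 + g)) := by
    rw [eq_div_iff (by positivity)]
    linear_combination -3 * h2
  have b3 : |1 - g - y / 3| ≤ 2 * |y| ^ 2 := by
    rw [e3, abs_div, abs_of_pos (by positivity : 0 < 3 * (1 + g)), div_le_iff₀ (by positivity)]
    have i1 : |2 * (w - y) + y * (1 - g)| ≤ 2 * (2 * |y| ^ 2) + |y| * |y| := by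
      refine (abs_add_le _ _).trans (add_le_add ?_ ?_)
      · rw [abs_mul, abs_two]; linarith
      · rw [abs_mul]; exact mul_le_mul_of_nonneg_left b1 hy0
    nlinarith [sq_nonneg |y|]
  have b4 : |w - (y + y ^ 2 / 3)| ≤ 5 * |y| ^ 3 := by
    have e : w - (y + y ^ 2 / 3) = (w - y) * (y / 3) + w * (1 - g - y / 3) := by
      linear_combination e2
    rw [e]
    refine (abs_add_le _ _).trans ?_
    rw [abs_mul, abs_mul, abs_div, abs_of_pos (by norm_num : (0 : ℝ) < 3)]
    have i1 := mul_le_mul_of_nonneg_right b2 (by positivity : 0 ≤ |y| / 3)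
    have i2 := mul_le_mul hw b3 (abs_nonneg _) (by positivity)
    have i3 : 0 ≤ |y| ^ 3 := by positivity
    nlinarith
  refine ⟨?_, ?_, b4, hw⟩
  · rw [abs_sub_comm, show 1 - y / 3 - g = 1 - g - y / 3 by ring]
    exact b3
  · have e : 1 - y / 3 - y ^ 2 / 6 - g = (2 * (w - (y + y ^ 2 / 3)) + y * (1 - g - y / 3) +
        y ^ 2 / 2 * (1 - g)) / (3 * (1 + g)) := by
      rw [eq_div_iff (by positivity)]
      linear_combination -3 * h2
    rw [abs_sub_comm, e, abs_div, abs_of_pos (by positivity : 0 < 3 * (1 + g)),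
      div_le_iff₀ (by positivity)]
    have i1 : |2 * (w - (y + y ^ 2 / 3)) + y * (1 - g - y / 3) + y ^ 2 / 2 * (1 - g)| ≤
        2 * (5 * |y| ^ 3) + |y| * (2 * |y| ^ 2) + |y| ^ 2 / 2 * |y| := by
      refine (abs_add_three _ _ _).trans (add_le_add (add_le_add ?_ ?_) ?_)
      · rw [abs_mul, abs_two]; linarith
      · rw [abs_mul]; exact mul_le_mul_of_nonneg_left b3 hy0
      · rw [abs_mul, abs_div, abs_two, abs_pow]
        exact mul_le_mul_of_nonneg_left b1 (by positivity)
    have i3 : 0 ≤ |y| ^ 3 := by positivity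
    nlinarith

/-- The same iteration with `1 - g = w² / (4(1 + g))`, which gains two orders at each round. -/
theorem quartic_expansion {y : ℝ} (hy : y ∈ Ioo (-1 : ℝ) 1) :
    |quarticG y - 1| ≤ |y| ^ 2 ∧
    |quarticG y - (1 - y ^ 2 / 8)| ≤ 2 * |y| ^ 4 ∧
    |quarticW y - y| ≤ 2 * |y| ^ 3 ∧ |quarticW y| ≤ 2 * |y| := by
  have h1 := quarticProfile.mul_eq y hy
  have h2 := quarticG_sq y
  have h3 := quarticProfile.half_le y
  generalize quarticG y = g at *
  generalize quarticW y = w at *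
  have hg : 0 < 1 + g := by linarith
  have hy0 := abs_nonneg y
  have hw : |w| ≤ 2 * |y| := by
    rw [← h1, abs_mul, abs_of_pos (by linarith : 0 < g)]
    nlinarith [abs_nonneg w]
  have e1 : 1 - g = w ^ 2 / 4 / (1 + g) := by
    rw [eq_div_iff hg.ne']
    linear_combination -h2
  have b1 : |1 - g| ≤ |y| ^ 2 := by
    rw [e1, abs_div, abs_of_pos hg, div_le_iff₀ hg, abs_div, abs_pow,
      abs_of_pos (by norm_num : (0:ℝ) < 4)]
    have := pow_le_pow_left₀ (abs_nonneg w) hw 2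
    nlinarith [sq_nonneg |y|]
  have e2 : w - y = w * (1 - g) := by rw [← h1]; ring
  have b2 : |w - y| ≤ 2 * |y| ^ 3 := by
    rw [e2, abs_mul]
    nlinarith [mul_le_mul hw b1 (abs_nonneg _) (by positivity)]
  refine ⟨by rwa [abs_sub_comm], ?_, b2, hw⟩
  have e : 1 - y ^ 2 / 8 - g = (2 * ((w - y) * (w + y)) + y ^ 2 * (1 - g)) / (8 * (1 + g)) := by
    rw [eq_div_iff (by positivity)]
    linear_combination -8 * h2
  rw [abs_sub_comm, e, abs_div, abs_of_pos (by positivity : 0 < 8 * (1 + g)),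
    div_le_iff₀ (by positivity)]
  have i0 : |w + y| ≤ 3 * |y| := (abs_add_le _ _).trans (by linarith)
  have i1 : |2 * ((w - y) * (w + y)) + y ^ 2 * (1 - g)| ≤
      2 * (2 * |y| ^ 3 * (3 * |y|)) + |y| ^ 2 * |y| ^ 2 := by
    refine (abs_add_le _ _).trans (add_le_add ?_ ?_)
    · rw [abs_mul, abs_two, abs_mul]
      exact mul_le_mul_of_nonneg_left (mul_le_mul b2 i0 (abs_nonneg _) (by positivity)) zero_le_two
    · rw [abs_mul, abs_pow]
      exact mul_le_mul_of_nonneg_left b1 (by positivity)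
  have i3 : 0 ≤ |y| ^ 4 := by positivity
  nlinarith

theorem abs_angleInt_sub_le {g f : ℝ → ℝ} {r B : ℝ} (hg : Continuous fun t => g (r * Real.cos t))
    (hf : Continuous f) (h : ∀ t, |g (r * Real.cos t) - f t| ≤ B) (θ : ℝ) :
    |angleInt g r θ - ∫ t in (0 : ℝ)..θ, f t| ≤ B * |θ| := by
  rw [angleInt, ← intervalIntegral.integral_sub (hg.intervalIntegrable _ _)
    (hf.intervalIntegrable _ _)]
  have := intervalIntegral.norm_integral_le_of_norm_le_const (a := 0) (b := θ)
    (f := fun t => g (r * Real.cos t) - f t) (C := B) fun t _ => h t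
  rwa [sub_zero] at this

/-- `cos 2z` is orthogonal to `cos z`, and the error integrates to at most `2πE`, against `∫ cos² =
π`. -/
theorem abs_amplitude_sub_le {U : ℝ → ℝ} {r B E : ℝ} (hU : Continuous U)
    (h : ∀ z, |U z - (r * Real.cos z + B * Real.cos (2 * z))| ≤ E) :
    |amplitude U - r| ≤ 2 * E := by
  have hpi := Real.pi_pos
  have h1 : ∫ z in (-Real.pi)..Real.pi, Real.cos z ^ 2 = Real.pi := by
    rw [integral_cos_sq]
    simp
  have h2 : ∫ z in (-Real.pi)..Real.pi, Real.cos (2 * z) * Real.cos z = 0 := by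
    have e : ∀ z ∈ uIcc (-Real.pi) Real.pi, HasDerivAt
        (fun z => Real.sin z - 2 / 3 * Real.sin z ^ 3) (Real.cos (2 * z) * Real.cos z) z := by
      intro z _
      have := (Real.hasDerivAt_sin z).sub (((Real.hasDerivAt_sin z).pow 3).const_mul (2 / 3))
      convert! this using 1
      rw [Real.cos_two_mul, Real.cos_sq']
      push_cast
      ring
    rw [intervalIntegral.integral_eq_sub_of_hasDerivAt e
      (Continuous.intervalIntegrable (by fun_prop) _ _)]
    simp
  have h3 : ∫ z in (-Real.pi)..Real.pi,
      (U z - (r * Real.cos z + B * Real.cos (2 * z))) * Real.cos z =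
      (∫ z in (-Real.pi)..Real.pi, U z * Real.cos z) - r * Real.pi := by
    have e : ∀ z, (U z - (r * Real.cos z + B * Real.cos (2 * z))) * Real.cos z =
        U z * Real.cos z - (r * Real.cos z ^ 2 + B * (Real.cos (2 * z) * Real.cos z)) := by
      intro z; ring
    simp only [e]
    rw [intervalIntegral.integral_sub (Continuous.intervalIntegrable (by fun_prop) _ _)
      (Continuous.intervalIntegrable (by fun_prop) _ _),
      intervalIntegral.integral_add (Continuous.intervalIntegrable (by fun_prop) _ _)
      (Continuous.intervalIntegrable (by fun_prop) _ _),
      intervalIntegral.integral_const_mul, intervalIntegral.integral_const_mul, h1, h2]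
    ring
  have h4 := intervalIntegral.norm_integral_le_of_norm_le_const (a := -Real.pi) (b := Real.pi)
    (f := fun z => (U z - (r * Real.cos z + B * Real.cos (2 * z))) * Real.cos z) (C := E)
    fun z _ => by
      rw [Real.norm_eq_abs, abs_mul]
      exact (mul_le_of_le_one_right (abs_nonneg _) (Real.abs_cos_le_one z)).trans (h z)
  rw [h3, Real.norm_eq_abs, sub_neg_eq_add, abs_of_pos (by linarith : 0 < Real.pi + Real.pi)] at h4
  have h5 : amplitude U - r =
      ((∫ z in (-Real.pi)..Real.pi, U z * Real.cos z) - r * Real.pi) / Real.pi := by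
    rw [amplitude]
    field_simp
  rw [h5, abs_div, abs_of_pos hpi, div_le_iff₀ hpi]
  linarith

/-- The quadratic deficit of the turning time bounds the radius by `β - 1`. This is why every wave,
not only a constructed branch, is small for `γ` near `1`. -/
theorem Profile.sq_le {c₁ w g : ℝ → ℝ} {R r β : ℝ} (h : Profile c₁ w g R) (hr : r ∈ Ioo (-R) R)
    (hβ : 1 < β) (hper : β * angleInt g r (2 * Real.pi) = 2 * Real.pi) : r ^ 2 ≤ 16 * (β - 1) := by
  have h1 := h.angleInt_two_pi_le hr
  have hpi := Real.pi_pos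
  have h2 : 2 * Real.pi * (β - 1) ≥ β * (Real.pi * r ^ 2 / 8) := by nlinarith
  have h3 : β * (Real.pi * r ^ 2 / 8) ≥ 1 * (Real.pi * r ^ 2 / 8) :=
    mul_le_mul_of_nonneg_right hβ.le (by positivity)
  have h4 : Real.pi * r ^ 2 ≤ Real.pi * (16 * (β - 1)) := by linarith
  exact le_of_mul_le_mul_left h4 hpi

/-- The angle is within the stated distance of the first approximation. -/
theorem Profile.angle_bounds {c₁ w g : ℝ → ℝ} {R r β θ z : ℝ} (h : Profile c₁ w g R)
    (hβ : 1 < β) (hz : z ∈ Ico 0 (2 * Real.pi)) (hθ : β * angleInt g r θ = z) :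
    |θ| ≤ 13 ∧ |z - angleInt g r θ| ≤ 7 * (β - 1) := by
  have hpi := Real.pi_lt_d2
  have hI0 : 0 ≤ angleInt g r θ := by
    by_contra hneg
    push Not at hneg
    nlinarith [hz.1]
  have hI : angleInt g r θ ≤ z := by nlinarith
  have hθ0 : 0 ≤ θ := by
    by_contra hneg
    push Not at hneg
    have h1 : angleInt g r θ < 0 := by
      rw [angleInt, intervalIntegral.integral_symm, neg_lt_zero]
      exact intervalIntegral.intervalIntegral_pos_of_pos
        ((h.continuous_comp_cos r).intervalIntegrable _ _) (fun t => h.pos_g _) hneg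
    linarith
  -- `θ/2` is at most the integral, hence at most `z < 2π`, so `θ < 4π < 13`.
  have h2 := h.half_mul_le_angleInt r hθ0
  have h3 := hz.2
  constructor
  · rw [abs_of_nonneg hθ0]
    linarith
  · rw [abs_of_nonneg (by linarith), ← hθ]
    nlinarith

theorem abs_mul_cos_le (r t : ℝ) : |r * Real.cos t| ≤ |r| := by
  rw [abs_mul]
  exact mul_le_of_le_one_right (abs_nonneg r) (Real.abs_cos_le_one t)

/-- The mean of `1 - y/3 - y²/6` over `y = r cos t` is `1 - r²/12`, and `β` is the reciprocal of the
mean of `g`; hence `β² - 1 = r²/6 + O(|r|³)`. -/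
theorem cubic_period {β r : ℝ} (hr : r ∈ Ioo (-(1 / √3)) (1 / √3))
    (hr' : |r| ≤ 1 / 40) (hper : β * angleInt cubicG r (2 * Real.pi) = 2 * Real.pi) :
    |β - 1| ≤ 2 * |r| ^ 2 ∧ |β ^ 2 - 1 - r ^ 2 / 6| ≤ 15 * |r| ^ 3 := by
  have hpi := Real.pi_pos
  have h0 := abs_nonneg r
  have h1 := abs_angleInt_sub_le (g := cubicG) (r := r)
    (f := fun t => 1 - r / 3 * Real.cos t - r ^ 2 / 6 * Real.cos t ^ 2) (B := 3 * |r| ^ 3)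
    (cubicProfile.continuous_comp_cos r) (by fun_prop) (fun t => by
      have e := (cubic_expansion (mul_cos_mem_Ioo hr t)).2.1
      have e2 : 1 - r / 3 * Real.cos t - r ^ 2 / 6 * Real.cos t ^ 2 =
        1 - r * Real.cos t / 3 - (r * Real.cos t) ^ 2 / 6 := by ring
      rw [e2]
      exact e.trans (mul_le_mul_of_nonneg_left
        (pow_le_pow_left₀ (abs_nonneg _) (abs_mul_cos_le r t) _) (by norm_num))) (2 * Real.pi)
  have h2 : ∫ t in (0 : ℝ)..2 * Real.pi, (1 - r / 3 * Real.cos t - r ^ 2 / 6 * Real.cos t ^ 2) =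
      2 * Real.pi * (1 - r ^ 2 / 12) := by
    rw [intervalIntegral.integral_sub (Continuous.intervalIntegrable (by fun_prop) _ _)
      (Continuous.intervalIntegrable (by fun_prop) _ _),
      intervalIntegral.integral_sub (Continuous.intervalIntegrable (by fun_prop) _ _)
      (Continuous.intervalIntegrable (by fun_prop) _ _),
      intervalIntegral.integral_const_mul, intervalIntegral.integral_const_mul, integral_cos_sq,
      integral_cos]
    simp
    ring
  have h3 := cubicProfile.half_mul_le_angleInt r (θ := 2 * Real.pi) (by positivity)
  rw [h2, abs_of_pos (by positivity : 0 < 2 * Real.pi)] at h1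
  obtain ⟨A, hA⟩ : ∃ A, angleInt cubicG r (2 * Real.pi) = 2 * Real.pi * A :=
    ⟨_, (mul_div_cancel₀ _ (by positivity)).symm⟩
  rw [hA, ← mul_sub, abs_mul, abs_of_pos (by positivity : 0 < 2 * Real.pi), mul_comm] at h1
  have h4 : |A - (1 - r ^ 2 / 12)| ≤ 3 * |r| ^ 3 := le_of_mul_le_mul_right h1 (by positivity)
  have h5 : 1 / 2 ≤ A := by
    rw [hA] at h3
    nlinarith
  have h6 : β * A = 1 := by
    rw [hA] at hper
    have : 2 * Real.pi * (β * A) = 2 * Real.pi * 1 := by linarith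
    exact mul_left_cancel₀ (by positivity) this
  have hr2 : r ^ 2 = |r| ^ 2 := (sq_abs r).symm
  have hr3 : |r| ^ 3 ≤ |r| ^ 2 / 40 := by
    have : |r| ^ 3 = |r| ^ 2 * |r| := by ring
    nlinarith [sq_nonneg |r|]
  have hr3' : 0 ≤ |r| ^ 3 := by positivity
  rw [hr2] at h4 ⊢
  have h7 : |1 - A| ≤ |r| ^ 2 := by
    rw [abs_le] at h4 ⊢
    constructor <;> linarith [sq_nonneg |r|]
  have h8 : |β - 1 - |r| ^ 2 / 12| ≤ 7 * |r| ^ 3 := by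
    have e : A * (β - 1 - |r| ^ 2 / 12) =
        -(A - (1 - |r| ^ 2 / 12)) + (1 - A) * (|r| ^ 2 / 12) := by linear_combination h6
    have e2 : |A * (β - 1 - |r| ^ 2 / 12)| ≤ 3 * |r| ^ 3 + |r| ^ 2 * (|r| ^ 2 / 12) := by
      rw [e]
      refine (abs_add_le _ _).trans (add_le_add (by rwa [abs_neg]) ?_)
      rw [abs_mul, abs_of_nonneg (by positivity : 0 ≤ |r| ^ 2 / 12)]
      exact mul_le_mul_of_nonneg_right h7 (by positivity)
    rw [abs_mul, abs_of_pos (by linarith : 0 < A)] at e2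
    have e3 : |r| ^ 2 * (|r| ^ 2 / 12) ≤ |r| ^ 3 / 12 := by
      have : |r| ^ 2 * (|r| ^ 2 / 12) = |r| ^ 3 * |r| / 12 := by ring
      nlinarith
    have e4 := mul_le_mul_of_nonneg_right h5 (abs_nonneg (β - 1 - |r| ^ 2 / 12))
    linarith
  have h9 : |β - 1| ≤ 2 * |r| ^ 2 := by
    rw [abs_le] at h8 ⊢
    constructor <;> linarith [sq_nonneg |r|]
  refine ⟨h9, ?_⟩
  have e : β ^ 2 - 1 - |r| ^ 2 / 6 = (β - 1) ^ 2 + 2 * (β - 1 - |r| ^ 2 / 12) := by ring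
  rw [e]
  refine (abs_add_le _ _).trans ?_
  rw [abs_pow, abs_mul, abs_two]
  have e2 : |β - 1| ^ 2 ≤ |r| ^ 3 := by
    have e3 := pow_le_pow_left₀ (abs_nonneg _) h9 2
    have e4 : (2 * |r| ^ 2) ^ 2 = |r| ^ 3 * (4 * |r|) := by ring
    nlinarith
  linarith

/-- The mean of `1 - y²/8` over `y = r cos t` is `1 - r²/16`, whence `β² - 1 = r²/8 + O(r⁴)`. -/
theorem quartic_period {β r : ℝ} (hr : r ∈ Ioo (-1 : ℝ) 1)
    (hr' : |r| ≤ 1 / 40) (hper : β * angleInt quarticG r (2 * Real.pi) = 2 * Real.pi) :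
    |β - 1| ≤ |r| ^ 2 ∧ |β ^ 2 - 1 - r ^ 2 / 8| ≤ 11 * |r| ^ 4 := by
  have hpi := Real.pi_pos
  have h0 := abs_nonneg r
  have h1 := abs_angleInt_sub_le (g := quarticG) (r := r)
    (f := fun t => 1 - r ^ 2 / 8 * Real.cos t ^ 2) (B := 2 * |r| ^ 4)
    (quarticProfile.continuous_comp_cos r) (by fun_prop) (fun t => by
      have e := (quartic_expansion (mul_cos_mem_Ioo hr t)).2.1
      have e2 : 1 - r ^ 2 / 8 * Real.cos t ^ 2 = 1 - (r * Real.cos t) ^ 2 / 8 := by ring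
      rw [e2]
      exact e.trans (mul_le_mul_of_nonneg_left
        (pow_le_pow_left₀ (abs_nonneg _) (abs_mul_cos_le r t) _) (by norm_num))) (2 * Real.pi)
  have h2 : ∫ t in (0 : ℝ)..2 * Real.pi, (1 - r ^ 2 / 8 * Real.cos t ^ 2) =
      2 * Real.pi * (1 - r ^ 2 / 16) := by
    rw [intervalIntegral.integral_sub (Continuous.intervalIntegrable (by fun_prop) _ _)
      (Continuous.intervalIntegrable (by fun_prop) _ _),
      intervalIntegral.integral_const_mul, integral_cos_sq]
    simp
    ring
  have h3 := quarticProfile.half_mul_le_angleInt r (θ := 2 * Real.pi) (by positivity)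
  rw [h2, abs_of_pos (by positivity : 0 < 2 * Real.pi)] at h1
  obtain ⟨A, hA⟩ : ∃ A, angleInt quarticG r (2 * Real.pi) = 2 * Real.pi * A :=
    ⟨_, (mul_div_cancel₀ _ (by positivity)).symm⟩
  rw [hA, ← mul_sub, abs_mul, abs_of_pos (by positivity : 0 < 2 * Real.pi), mul_comm] at h1
  have h4 : |A - (1 - r ^ 2 / 16)| ≤ 2 * |r| ^ 4 := le_of_mul_le_mul_right h1 (by positivity)
  have h5 : 1 / 2 ≤ A := by
    rw [hA] at h3
    nlinarith
  have h6 : β * A = 1 := by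
    rw [hA] at hper
    have : 2 * Real.pi * (β * A) = 2 * Real.pi * 1 := by linarith
    exact mul_left_cancel₀ (by positivity) this
  have hr2 : r ^ 2 = |r| ^ 2 := (sq_abs r).symm
  have hr3 : |r| ^ 4 ≤ |r| ^ 2 / 40 := by
    have e : |r| ^ 4 = |r| ^ 2 * (|r| * |r|) := by ring
    have e2 : |r| * |r| ≤ 1 / 40 := by nlinarith
    rw [e]
    nlinarith [sq_nonneg |r|]
  have hr3' : 0 ≤ |r| ^ 4 := by positivity
  rw [hr2] at h4 ⊢
  have h7 : |1 - A| ≤ |r| ^ 2 := by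
    rw [abs_le] at h4 ⊢
    constructor <;> linarith [sq_nonneg |r|]
  have h8 : |β - 1 - |r| ^ 2 / 16| ≤ 5 * |r| ^ 4 := by
    have e : A * (β - 1 - |r| ^ 2 / 16) =
        -(A - (1 - |r| ^ 2 / 16)) + (1 - A) * (|r| ^ 2 / 16) := by linear_combination h6
    have e2 : |A * (β - 1 - |r| ^ 2 / 16)| ≤ 2 * |r| ^ 4 + |r| ^ 2 * (|r| ^ 2 / 16) := by
      rw [e]
      refine (abs_add_le _ _).trans (add_le_add (by rwa [abs_neg]) ?_)
      rw [abs_mul, abs_of_nonneg (by positivity : 0 ≤ |r| ^ 2 / 16)]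
      exact mul_le_mul_of_nonneg_right h7 (by positivity)
    rw [abs_mul, abs_of_pos (by linarith : 0 < A)] at e2
    have e4 := mul_le_mul_of_nonneg_right h5 (abs_nonneg (β - 1 - |r| ^ 2 / 16))
    linarith
  have h9 : |β - 1| ≤ |r| ^ 2 := by
    rw [abs_le] at h8 ⊢
    constructor <;> linarith [sq_nonneg |r|]
  refine ⟨h9, ?_⟩
  have e : β ^ 2 - 1 - |r| ^ 2 / 8 = (β - 1) ^ 2 + 2 * (β - 1 - |r| ^ 2 / 16) := by ring
  rw [e]
  refine (abs_add_le _ _).trans ?_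
  rw [abs_pow, abs_mul, abs_two]
  have e3 := pow_le_pow_left₀ (abs_nonneg _) h9 2
  linarith

end Expansions

/-! ### Expansion of the waves in their amplitude. -/

section WaveExpansions

theorem abs_sub_of_abs_sub_le {a b c A B : ℝ} (h₁ : |a - b| ≤ A) (h₂ : |b - c| ≤ B) :
    |a - c| ≤ A + B := (abs_sub_le a b c).trans (add_le_add h₁ h₂)

/-- As `β - 1` is of second order, `z = θ - (r/3) sin θ + O(r²)`, and inversion gives `θ = z + (r/3)
sin z + O(r²)`. -/
theorem cubic_cos_angle {β r θ z : ℝ} (hβ : 1 < β) (hr : r ∈ Ioo (-(1 / √3)) (1 / √3))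
    (hr' : |r| ≤ 1 / 40) (hβr : |β - 1| ≤ 2 * |r| ^ 2) (hz : z ∈ Ico 0 (2 * Real.pi))
    (hθ : β * angleInt cubicG r θ = z) :
    |Real.cos θ - Real.cos z| ≤ 2 * |r| ∧
      |Real.cos θ - (Real.cos z - r / 3 * Real.sin z ^ 2)| ≤ 49 * |r| ^ 2 := by
  have h0 := abs_nonneg r
  obtain ⟨h1, h2⟩ := cubicProfile.angle_bounds hβ hz hθ
  rw [abs_of_pos (by linarith : 0 < β - 1)] at hβr
  have h3 := abs_angleInt_sub_le (g := cubicG) (r := r)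
    (f := fun t => 1 - r / 3 * Real.cos t) (B := 2 * |r| ^ 2)
    (cubicProfile.continuous_comp_cos r) (by fun_prop) (fun t => by
      have e := (cubic_expansion (mul_cos_mem_Ioo hr t)).1
      rw [show 1 - r / 3 * Real.cos t = 1 - r * Real.cos t / 3 by ring]
      exact e.trans (mul_le_mul_of_nonneg_left
        (pow_le_pow_left₀ (abs_nonneg _) (abs_mul_cos_le r t) _) (by norm_num))) θ
  have h4 : ∫ t in (0 : ℝ)..θ, (1 - r / 3 * Real.cos t) = θ - r / 3 * Real.sin θ := by
    rw [intervalIntegral.integral_sub (Continuous.intervalIntegrable (by fun_prop) _ _)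
      (Continuous.intervalIntegrable (by fun_prop) _ _),
      intervalIntegral.integral_const_mul, integral_cos]
    simp
  rw [h4] at h3
  have h5 : |z - (θ - r / 3 * Real.sin θ)| ≤ 40 * |r| ^ 2 := by
    refine (abs_sub_of_abs_sub_le h2 h3).trans ?_
    nlinarith [sq_nonneg |r|]
  have h6 : |r / 3 * Real.sin θ| ≤ |r| / 3 := by
    rw [abs_mul, abs_div, abs_of_pos (by norm_num : (0 : ℝ) < 3)]
    exact mul_le_of_le_one_right (by positivity) (Real.abs_sin_le_one θ)
  have h7 : |θ - z| ≤ 2 * |r| := by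
    have e : θ - z = r / 3 * Real.sin θ - (z - (θ - r / 3 * Real.sin θ)) := by ring
    rw [e]
    refine (abs_sub _ _).trans ?_
    nlinarith
  have h8 : |θ - z - r / 3 * Real.sin z| ≤ 41 * |r| ^ 2 := by
    have e : θ - z - r / 3 * Real.sin z =
        r / 3 * (Real.sin θ - Real.sin z) - (z - (θ - r / 3 * Real.sin θ)) := by ring
    rw [e]
    refine (abs_sub _ _).trans ?_
    rw [abs_mul, abs_div, abs_of_pos (by norm_num : (0 : ℝ) < 3)]
    have e2 := mul_le_mul_of_nonneg_left ((Real.abs_sin_sub_sin_le θ z).trans h7)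
      (by positivity : 0 ≤ |r| / 3)
    nlinarith [sq_nonneg |r|]
  refine ⟨(Real.abs_cos_sub_cos_le θ z).trans h7, ?_⟩
  have h9 := abs_cos_sub_le θ z
  have h10 : (θ - z) ^ 2 ≤ 4 * |r| ^ 2 := by
    have := pow_le_pow_left₀ (abs_nonneg _) h7 2
    rw [sq_abs] at this
    linarith
  have e : Real.cos θ - (Real.cos z - r / 3 * Real.sin z ^ 2) =
      (Real.cos θ - (Real.cos z - (θ - z) * Real.sin z)) -
        (θ - z - r / 3 * Real.sin z) * Real.sin z := by ring
  rw [e]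
  refine (abs_sub _ _).trans ?_
  rw [abs_mul]
  have h11 : |θ - z - r / 3 * Real.sin z| * |Real.sin z| ≤ 41 * |r| ^ 2 :=
    (mul_le_of_le_one_right (abs_nonneg _) (Real.abs_sin_le_one z)).trans h8
  linarith

theorem quartic_cos_angle {β r θ z : ℝ} (hβ : 1 < β) (hr : r ∈ Ioo (-1 : ℝ) 1)
    (hβr : |β - 1| ≤ |r| ^ 2) (hz : z ∈ Ico 0 (2 * Real.pi))
    (hθ : β * angleInt quarticG r θ = z) : |Real.cos θ - Real.cos z| ≤ 20 * |r| ^ 2 := by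
  obtain ⟨h1, h2⟩ := quarticProfile.angle_bounds hβ hz hθ
  rw [abs_of_pos (by linarith : 0 < β - 1)] at hβr
  have h3 := abs_angleInt_sub_le (g := quarticG) (r := r)
    (f := fun _ => 1) (B := |r| ^ 2)
    (quarticProfile.continuous_comp_cos r) (by fun_prop) (fun t =>
      (quartic_expansion (mul_cos_mem_Ioo hr t)).1.trans
        (pow_le_pow_left₀ (abs_nonneg _) (abs_mul_cos_le r t) _)) θ
  simp only [intervalIntegral.integral_const, sub_zero, smul_eq_mul, mul_one] at h3
  have h5 := abs_sub_of_abs_sub_le h2 h3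
  rw [abs_sub_comm] at h5
  refine (Real.abs_cos_sub_cos_le θ z).trans (h5.trans ?_)
  nlinarith [sq_nonneg |r|]

/-- Inserting the angle in `w = y + y²/3` gives `r cos z - (r²/3) sin² z + (r²/3) cos² z`, which is
the second harmonic. The errors add up to `5 + 49 + 4/3 + 2 ≤ 58`. -/
theorem cubic_wave_expansion {β r θ z : ℝ} (hβ : 1 < β) (hr : r ∈ Ioo (-(1 / √3)) (1 / √3))
    (hr' : |r| ≤ 1 / 40) (hper : β * angleInt cubicG r (2 * Real.pi) = 2 * Real.pi)
    (hz : z ∈ Ico 0 (2 * Real.pi)) (hθ : β * angleInt cubicG r θ = z) :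
    |β ^ 2 * cubicW (r * Real.cos θ) - (r * Real.cos z + r ^ 2 / 3 * Real.cos (2 * z))| ≤
      58 * |r| ^ 3 := by
  have h0 := abs_nonneg r
  obtain ⟨hβ1, hβ2⟩ := cubic_period hr hr' hper
  obtain ⟨hc1, hc2⟩ := cubic_cos_angle hβ hr hr' hβ1 hz hθ
  obtain ⟨-, -, hw1, hw2⟩ := cubic_expansion (mul_cos_mem_Ioo hr θ)
  have hy := abs_mul_cos_le r θ
  have hr3 : 0 ≤ |r| ^ 3 := by positivity
  have h1 : |cubicW (r * Real.cos θ) - (r * Real.cos θ + (r * Real.cos θ) ^ 2 / 3)| ≤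
      5 * |r| ^ 3 := hw1.trans (mul_le_mul_of_nonneg_left
        (pow_le_pow_left₀ (abs_nonneg _) hy _) (by norm_num))
  have h2 : |r * (Real.cos θ - (Real.cos z - r / 3 * Real.sin z ^ 2))| ≤ 49 * |r| ^ 3 := by
    rw [abs_mul]
    have := mul_le_mul_of_nonneg_left hc2 h0
    linarith
  have h3 : |r ^ 2 / 3 * ((Real.cos θ - Real.cos z) * (Real.cos θ + Real.cos z))| ≤
      4 / 3 * |r| ^ 3 := by
    rw [abs_mul, abs_mul, abs_div, abs_pow, abs_of_pos (by norm_num : (0 : ℝ) < 3)]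
    have e1 : |Real.cos θ + Real.cos z| ≤ 2 := (abs_add_le _ _).trans
      (by linarith [Real.abs_cos_le_one θ, Real.abs_cos_le_one z])
    have e2 := mul_le_mul hc1 e1 (abs_nonneg _) (by positivity)
    have e3 := mul_le_mul_of_nonneg_left e2 (by positivity : 0 ≤ |r| ^ 2 / 3)
    refine e3.trans (le_of_eq ?_)
    ring
  have h4 : |(β ^ 2 - 1) * cubicW (r * Real.cos θ)| ≤ 2 * |r| ^ 3 := by
    rw [abs_mul]
    have e1 : |β ^ 2 - 1| ≤ |r| ^ 2 := by
      have e4 : |r| ^ 3 ≤ |r| ^ 2 / 40 := by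
        rw [pow_succ]
        nlinarith [sq_nonneg |r|]
      rw [← sq_abs r] at hβ2
      rw [abs_le] at hβ2 ⊢
      constructor <;> linarith [sq_nonneg |r|]
    have e2 := mul_le_mul e1 (hw2.trans (mul_le_mul_of_nonneg_left hy zero_le_two))
      (abs_nonneg _) (by positivity)
    linarith
  have e : β ^ 2 * cubicW (r * Real.cos θ) - (r * Real.cos z + r ^ 2 / 3 * Real.cos (2 * z)) =
      (cubicW (r * Real.cos θ) - (r * Real.cos θ + (r * Real.cos θ) ^ 2 / 3)) +
      r * (Real.cos θ - (Real.cos z - r / 3 * Real.sin z ^ 2)) +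
      r ^ 2 / 3 * ((Real.cos θ - Real.cos z) * (Real.cos θ + Real.cos z)) +
      (β ^ 2 - 1) * cubicW (r * Real.cos θ) := by
    rw [Real.cos_two_mul, Real.sin_sq]
    ring
  rw [e]
  refine (abs_add_le _ _).trans ?_
  have := abs_add_three (cubicW (r * Real.cos θ) - (r * Real.cos θ + (r * Real.cos θ) ^ 2 / 3))
    (r * (Real.cos θ - (Real.cos z - r / 3 * Real.sin z ^ 2)))
    (r ^ 2 / 3 * ((Real.cos θ - Real.cos z) * (Real.cos θ + Real.cos z)))
  linarith

theorem quartic_wave_expansion {β r θ z : ℝ} (hβ : 1 < β) (hr : r ∈ Ioo (-1 : ℝ) 1)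
    (hr' : |r| ≤ 1 / 40) (hper : β * angleInt quarticG r (2 * Real.pi) = 2 * Real.pi)
    (hz : z ∈ Ico 0 (2 * Real.pi)) (hθ : β * angleInt quarticG r θ = z) :
    |β * quarticW (r * Real.cos θ) - r * Real.cos z| ≤ 24 * |r| ^ 3 := by
  have h0 := abs_nonneg r
  obtain ⟨hβ1, -⟩ := quartic_period hr hr' hper
  have hc := quartic_cos_angle hβ hr hβ1 hz hθ
  obtain ⟨-, -, hw1, hw2⟩ := quartic_expansion (mul_cos_mem_Ioo hr θ)
  have hy := abs_mul_cos_le r θ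
  have h1 : |quarticW (r * Real.cos θ) - r * Real.cos θ| ≤
      2 * |r| ^ 3 := hw1.trans (mul_le_mul_of_nonneg_left
        (pow_le_pow_left₀ (abs_nonneg _) hy _) (by norm_num))
  have h2 : |r * (Real.cos θ - Real.cos z)| ≤ 20 * |r| ^ 3 := by
    rw [abs_mul]
    have := mul_le_mul_of_nonneg_left hc h0
    linarith
  have h4 : |(β - 1) * quarticW (r * Real.cos θ)| ≤ 2 * |r| ^ 3 := by
    rw [abs_mul]
    have e2 := mul_le_mul hβ1 (hw2.trans (mul_le_mul_of_nonneg_left hy zero_le_two))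
      (abs_nonneg _) (by positivity)
    linarith
  have e : β * quarticW (r * Real.cos θ) - r * Real.cos z =
      (quarticW (r * Real.cos θ) - r * Real.cos θ) + r * (Real.cos θ - Real.cos z) +
      (β - 1) * quarticW (r * Real.cos θ) := by ring
  rw [e]
  refine (abs_add_three _ _ _).trans ?_
  linarith

/-- `1 < β`, with `β² = γ`. -/
theorem exists_sq_eq {γ : ℝ} (hγ : 1 < γ) : ∃ β, 1 < β ∧ 2 * (β - 1) ≤ γ - 1 ∧ β ^ 2 = γ := by
  have h1 : √γ ^ 2 = γ := Real.sq_sqrt (by linarith)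
  have h2 : 1 < √γ := Real.lt_sqrt_of_sq_lt (by linarith)
  exact ⟨√γ, h2, by nlinarith, h1⟩

/-- The amplitude `a` and the radius `r` differ by `O(|r|³)`, so expansions in `r` become expansions
in `a`. The bound on `γ` is chosen to give `r² ≤ 8(γ - 1) ≤ 1/1600`. -/
theorem IsOstrovskyWave.expansion {γ : ℝ} (hγ : 1 < γ) (hγ' : γ < 1 + 1 / 12800) {U : ℝ → ℝ}
    (h : IsOstrovskyWave γ U) {a : ℝ} (ha : a = amplitude U) :
    a ≠ 0 ∧ a ^ 2 ≤ 32 * (γ - 1) ∧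
    (∀ z, |U z - (a * Real.cos z + a ^ 2 / 3 * Real.cos (2 * z))| ≤ 1440 * |a| ^ 3) ∧
    |γ - 1 - a ^ 2 / 6| ≤ 136 * |a| ^ 3 := by
  obtain ⟨β, hβ, hβγ, rfl⟩ := exists_sq_eq hγ
  obtain ⟨r, hr, hr0, hper, Θ, hΘ, hU⟩ := h.exists_angle hβ
  have hr2 := cubicProfile.sq_le hr hβ hper
  have hr' : |r| ≤ 1 / 40 := abs_le_of_sq_le_sq (by linarith) (by norm_num)
  have h0 : 0 < |r| := abs_pos.2 hr0
  have h1 (z : ℝ) : |U z - (r * Real.cos z + r ^ 2 / 3 * Real.cos (2 * z))| ≤ 58 * |r| ^ 3 := by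
    have hp : Function.Periodic
        (fun z => U z - (r * Real.cos z + r ^ 2 / 3 * Real.cos (2 * z))) (2 * Real.pi) := fun z => by
      have e : Real.cos (2 * (z + 2 * Real.pi)) = Real.cos (2 * z) := by
        rw [mul_add, show 2 * z + 2 * (2 * Real.pi) = 2 * z + 2 * Real.pi + 2 * Real.pi by ring,
          Real.cos_add_two_pi, Real.cos_add_two_pi]
      simp only [h.periodic z, Real.cos_add_two_pi, e]
    obtain ⟨y, hy, hzy⟩ := hp.exists_mem_Ico₀ Real.two_pi_pos z
    rw [hzy, hU y]
    exact cubic_wave_expansion hβ hr hr' hper hy (hΘ y)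
  have h2 := abs_amplitude_sub_le h.continuous h1
  rw [← ha] at h2
  have hr3 : |r| ^ 3 ≤ |r| / 1600 := by
    have : |r| ^ 2 ≤ (1 / 40) ^ 2 := pow_le_pow_left₀ h0.le hr' 2
    rw [pow_succ]
    nlinarith
  have hr3' : 0 ≤ |r| ^ 3 := by positivity
  have h3 : |r| ≤ 2 * |a| := by
    have := abs_sub_abs_le_abs_sub r a
    rw [abs_sub_comm] at this
    linarith
  have h4 : |a| ≤ 2 * |r| := by
    have := abs_sub_abs_le_abs_sub a r
    linarith
  have h5 : |r| ^ 3 ≤ 8 * |a| ^ 3 := by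
    have := pow_le_pow_left₀ h0.le h3 3
    linarith
  have h6 : |a ^ 2 - r ^ 2| ≤ 9 * |r| ^ 3 := by
    have e : a ^ 2 - r ^ 2 = (a - r) * (a + r) := by ring
    rw [e, abs_mul]
    have e2 : |a + r| ≤ 3 * (1 / 40) := (abs_add_le _ _).trans (by linarith)
    have := mul_le_mul h2 e2 (abs_nonneg _) (by positivity)
    linarith
  refine ⟨?_, ?_, fun z => ?_, ?_⟩
  · rintro rfl
    rw [abs_zero] at h3
    linarith
  · have := pow_le_pow_left₀ (abs_nonneg a) h4 2
    rw [mul_pow, sq_abs, sq_abs] at this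
    linarith
  · have e : U z - (a * Real.cos z + a ^ 2 / 3 * Real.cos (2 * z)) =
        (U z - (r * Real.cos z + r ^ 2 / 3 * Real.cos (2 * z))) - (a - r) * Real.cos z -
          (a ^ 2 - r ^ 2) / 3 * Real.cos (2 * z) := by ring
    have e1 : |(a - r) * Real.cos z| ≤ 116 * |r| ^ 3 := by
      rw [abs_mul]
      exact (mul_le_of_le_one_right (abs_nonneg _) (Real.abs_cos_le_one z)).trans (by linarith)
    have e2 : |(a ^ 2 - r ^ 2) / 3 * Real.cos (2 * z)| ≤ 3 * |r| ^ 3 := by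
      rw [abs_mul, abs_div, abs_of_pos (by norm_num : (0 : ℝ) < 3)]
      exact (mul_le_of_le_one_right (by positivity) (Real.abs_cos_le_one _)).trans (by linarith)
    rw [e]
    have e3 := h1 z
    exact ((abs_sub _ _).trans (add_le_add ((abs_sub _ _).trans (add_le_add e3 e1)) e2)).trans
      (by linarith)
  · have e1 := (cubic_period hr hr' hper).2
    have e : β ^ 2 - 1 - a ^ 2 / 6 = (β ^ 2 - 1 - r ^ 2 / 6) - (a ^ 2 - r ^ 2) / 6 := by ring
    rw [e]
    refine (abs_sub _ _).trans ?_
    rw [abs_div, abs_of_pos (by norm_num : (0 : ℝ) < 6)]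
    linarith

theorem IsModifiedWave.expansion {γ : ℝ} (hγ : 1 < γ) (hγ' : γ < 1 + 1 / 12800) {U : ℝ → ℝ}
    (h : IsModifiedWave γ U) {a : ℝ} (ha : a = amplitude U) :
    a ≠ 0 ∧ a ^ 2 ≤ 32 * (γ - 1) ∧
    (∀ z, |U z - a * Real.cos z| ≤ 1440 * |a| ^ 3) ∧ |γ - 1 - a ^ 2 / 8| ≤ 500 * |a| ^ 4 := by
  obtain ⟨β, hβ, hβγ, rfl⟩ := exists_sq_eq hγ
  obtain ⟨r, hr, hr0, hper, Θ, hΘ, hU⟩ := h.exists_angle hβ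
  have hr2 := quarticProfile.sq_le hr hβ hper
  have hr' : |r| ≤ 1 / 40 := abs_le_of_sq_le_sq (by linarith) (by norm_num)
  have h0 : 0 < |r| := abs_pos.2 hr0
  have h1 (z : ℝ) : |U z - r * Real.cos z| ≤ 24 * |r| ^ 3 := by
    have hp : Function.Periodic (fun z => U z - r * Real.cos z) (2 * Real.pi) := fun z => by
      simp only [h.periodic z, Real.cos_add_two_pi]
    obtain ⟨y, hy, hzy⟩ := hp.exists_mem_Ico₀ Real.two_pi_pos z
    rw [hzy, hU y]
    exact quartic_wave_expansion hβ hr hr' hper hy (hΘ y)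
  have h2 := abs_amplitude_sub_le (B := 0) h.continuous (by simpa using h1)
  rw [← ha] at h2
  have hr3 : |r| ^ 3 ≤ |r| / 1600 := by
    have : |r| ^ 2 ≤ (1 / 40) ^ 2 := pow_le_pow_left₀ h0.le hr' 2
    rw [pow_succ]
    nlinarith
  have hr3' : 0 ≤ |r| ^ 3 := by positivity
  have h3 : |r| ≤ 2 * |a| := by
    have := abs_sub_abs_le_abs_sub r a
    rw [abs_sub_comm] at this
    linarith
  have h4 : |a| ≤ 2 * |r| := by
    have := abs_sub_abs_le_abs_sub a r
    linarith
  have h5 : |r| ^ 3 ≤ 8 * |a| ^ 3 := by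
    have := pow_le_pow_left₀ h0.le h3 3
    linarith
  have h5' : |r| ^ 4 ≤ 16 * |a| ^ 4 := by
    have := pow_le_pow_left₀ h0.le h3 4
    linarith
  have h6 : |a ^ 2 - r ^ 2| ≤ 144 * |r| ^ 4 := by
    have e : a ^ 2 - r ^ 2 = (a - r) * (a + r) := by ring
    rw [e, abs_mul]
    have e2 : |a + r| ≤ 3 * |r| := (abs_add_le _ _).trans (by linarith)
    have := mul_le_mul h2 e2 (abs_nonneg _) (by positivity)
    linarith
  refine ⟨?_, ?_, fun z => ?_, ?_⟩
  · rintro rfl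
    rw [abs_zero] at h3
    linarith
  · have := pow_le_pow_left₀ (abs_nonneg a) h4 2
    rw [mul_pow, sq_abs, sq_abs] at this
    linarith
  · have e : U z - a * Real.cos z = (U z - r * Real.cos z) - (a - r) * Real.cos z := by ring
    have e1 : |(a - r) * Real.cos z| ≤ 48 * |r| ^ 3 := by
      rw [abs_mul]
      exact (mul_le_of_le_one_right (abs_nonneg _) (Real.abs_cos_le_one z)).trans (by linarith)
    rw [e]
    exact ((abs_sub _ _).trans (add_le_add (h1 z) e1)).trans (by linarith)
  · have e1 := (quartic_period hr hr' hper).2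
    have e : β ^ 2 - 1 - a ^ 2 / 8 = (β ^ 2 - 1 - r ^ 2 / 8) - (a ^ 2 - r ^ 2) / 8 := by ring
    rw [e]
    refine (abs_sub _ _).trans ?_
    rw [abs_div, abs_of_pos (by norm_num : (0 : ℝ) < 8)]
    linarith [pow_nonneg (abs_nonneg a) 4]

end WaveExpansions

/-! ### The Hessian at a wave. -/

section WaveSpectrum

variable {N : ℕ} [NeZero N]

theorem orthogonalProjectionOnto_lpOf_const (m : ℂ) :
    (zeroMean N).orthogonalProjectionOnto
      (lpOf (ContinuousMap.const (AddCircle (2 * Real.pi * (N : ℝ))) m)) = 0 := by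
  have h : (ContinuousMap.const (AddCircle (2 * Real.pi * (N : ℝ))) m) = m • fourier 0 := by
    ext x
    simp
  refine Submodule.orthogonalProjectionOnto_apply_of_mem_orthogonal ?_
  rw [Submodule.orthogonal_orthogonal, lpOf, h, map_smul]
  exact Submodule.smul_mem _ _ (Submodule.mem_span_singleton_self _)

/-- The projection kills constants, so any constant `m` may be subtracted from the residual before
its norm is taken. -/
theorem norm_hessian_lpOf_sub_le {q : ℝ → ℝ} {hq : Continuous q}
    {hp : Function.Periodic q (2 * Real.pi)} {f g : C(AddCircle (2 * Real.pi * (N : ℝ)), ℂ)}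
    {f₁ : ℝ → ℂ} (hf : ∀ x : ℝ, HasDerivAt (fun y : ℝ => f y) (f₁ x) x)
    (hg : ∀ x : ℝ, HasDerivAt f₁ (g x) x) {v : zeroMean N} (hv : (v : L2per N) = lpOf g)
    (ρ m : ℂ) : ‖hessian N q hq hp v - ρ • v‖ ≤
      ‖lpOf (onCircle N q hq hp * g - f - ρ • g - ContinuousMap.const _ m)‖ := by
  have h1 : v = (zeroMean N).orthogonalProjectionOnto (lpOf g) := by
    rw [← hv, Submodule.orthogonalProjectionOnto_mem_subspace_eq_self]
  have h2 : hessian N q hq hp v - ρ • v = (zeroMean N).orthogonalProjectionOnto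
      (lpOf (onCircle N q hq hp * g - f - ρ • g - ContinuousMap.const _ m)) := by
    rw [hessian_lpOf hf hg hv]
    nth_rewrite 1 [h1]
    have h3 := orthogonalProjectionOnto_lpOf_const (N := N) m
    rw [lpOf] at h3
    simp only [lpOf, map_sub, map_smul, h3, sub_zero]
  rw [h2]
  exact Submodule.norm_orthogonalProjectionOnto_apply_le _ _

/-- Trigonometric polynomials used as approximate eigenfunctions. -/
def testFun (A B : ℝ) (z : ℝ) : ℝ := Real.cos z + A * Real.cos (2 * z) + B * Real.cos (3 * z)

theorem continuous_testFun (A B : ℝ) : Continuous (testFun A B) := by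
  unfold testFun
  fun_prop

theorem periodic_testFun (A B : ℝ) : Function.Periodic (testFun A B) (2 * Real.pi) := by
  intro z
  have h2 : Real.cos (2 * (z + 2 * Real.pi)) = Real.cos (2 * z) := by
    rw [mul_add, show 2 * z + 2 * (2 * Real.pi) = 2 * z + 2 * Real.pi + 2 * Real.pi by ring,
      Real.cos_add_two_pi, Real.cos_add_two_pi]
  have h3 : Real.cos (3 * (z + 2 * Real.pi)) = Real.cos (3 * z) := by
    rw [mul_add, show 3 * z + 3 * (2 * Real.pi) =
      3 * z + 2 * Real.pi + 2 * Real.pi + 2 * Real.pi by ring,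
      Real.cos_add_two_pi, Real.cos_add_two_pi, Real.cos_add_two_pi]
  simp only [testFun, Real.cos_add_two_pi, h2, h3]

theorem abs_testFun_le (A B z : ℝ) : |testFun A B z| ≤ 1 + |A| + |B| := by
  refine (abs_add_three _ _ _).trans ?_
  rw [abs_mul, abs_mul]
  have h1 := Real.abs_cos_le_one z
  have h2 := mul_le_of_le_one_right (abs_nonneg A) (Real.abs_cos_le_one (2 * z))
  have h3 := mul_le_of_le_one_right (abs_nonneg B) (Real.abs_cos_le_one (3 * z))
  linarith

theorem hasDerivAt_neg_testFun (A B z : ℝ) :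
    HasDerivAt (fun z => -testFun (A / 4) (B / 9) z)
      (Real.sin z + A / 2 * Real.sin (2 * z) + B / 3 * Real.sin (3 * z)) z := by
  have h2 := ((hasDerivAt_id z).const_mul 2).cos.const_mul (A / 4)
  have h3 := ((hasDerivAt_id z).const_mul 3).cos.const_mul (B / 9)
  convert! (((Real.hasDerivAt_cos z).add h2).add h3).neg using 1
  simp only [id]
  ring

theorem hasDerivAt_testFun_antideriv (A B z : ℝ) :
    HasDerivAt (fun z => Real.sin z + A / 2 * Real.sin (2 * z) + B / 3 * Real.sin (3 * z))
      (testFun A B z) z := by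
  have h2 := ((hasDerivAt_id z).const_mul 2).sin.const_mul (A / 2)
  have h3 := ((hasDerivAt_id z).const_mul 3).sin.const_mul (B / 3)
  convert! ((Real.hasDerivAt_sin z).add h2).add h3 using 1
  simp only [id, testFun]
  ring

/-- `‖cos‖ = 1/√2 ≥ 1/2`, and the two higher harmonics change the norm by at most `1/4`. -/
theorem quarter_le_norm_testFun {A B : ℝ} (hAB : |A| + |B| ≤ 1 / 4) :
    1 / 4 ≤ ‖(lpOf (onCircle N (testFun A B) (continuous_testFun A B) (periodic_testFun A B)) :
      L2per N)‖ := by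
  set g := onCircle N (testFun A B) (continuous_testFun A B) (periodic_testFun A B) with hg
  set g₀ := onCircle N (testFun 0 0) (continuous_testFun 0 0) (periodic_testFun 0 0) with hg₀
  have hN : (0 : ℝ) < N := Nat.cast_pos.2 (Nat.pos_of_ne_zero (NeZero.ne N))
  have h1 : ‖(lpOf g₀ : L2per N)‖ ^ 2 = 1 / 2 := by
    rw [norm_lpOf_sq (F := Real.cos) (fun x => by rw [hg₀, onCircle_coe]; simp [testFun]) 0,
      integral_cos_sq]
    have : Real.sin (2 * Real.pi * N) = 0 := by
      have := Real.sin_nat_mul_pi (2 * N)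
      rw [← this]
      congr 1
      push_cast
      ring
    rw [zero_add, this, Real.sin_zero]
    have hpi := Real.pi_pos
    field_simp
    ring
  have h2 : ‖(lpOf (g₀ - g) : L2per N)‖ ≤ 1 / 4 := by
    refine norm_lpOf_le (by norm_num) fun x => ?_
    rw [ContinuousMap.sub_apply, hg, hg₀, onCircle_coe, onCircle_coe, ← Complex.ofReal_sub,
      Complex.norm_real, Real.norm_eq_abs]
    have e : testFun 0 0 x - testFun A B x = -(A * Real.cos (2 * x) + B * Real.cos (3 * x)) := by
      simp only [testFun]
      ring
    rw [e, abs_neg]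
    refine (abs_add_le _ _).trans ?_
    rw [abs_mul, abs_mul]
    have h2 := mul_le_of_le_one_right (abs_nonneg A) (Real.abs_cos_le_one (2 * x))
    have h3 := mul_le_of_le_one_right (abs_nonneg B) (Real.abs_cos_le_one (3 * x))
    linarith
  have h3 : ‖(lpOf g₀ : L2per N)‖ ≤ ‖(lpOf g : L2per N)‖ + ‖(lpOf (g₀ - g) : L2per N)‖ := by
    have : (lpOf g₀ : L2per N) = lpOf g + lpOf (g₀ - g) := by
      rw [lpOf, lpOf, lpOf, map_sub]
      abel
    rw [this]
    exact norm_add_le _ _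
  have h4 : 1 / 2 ≤ ‖(lpOf g₀ : L2per N)‖ := by
    nlinarith [norm_nonneg (lpOf g₀ : L2per N)]
  linarith

variable {c U q : ℝ → ℝ}

/-- The spectrum of `-∂_z⁻² - c(U)` from an approximate eigenfunction `cos z + …`. -/
theorem IsWave.spectrum_hessian (h : IsWave c U) (hc : Differentiable ℝ c) (hq : Continuous q)
    (hp : Function.Periodic q (2 * Real.pi)) (hqc : ∀ z, q z = -c (U z))
    (hq1 : ∀ x, |q x + 1| ≤ 1 / (4 * ((N : ℝ) + 1))) {κ : ℝ}
    (hκ : κ * bumpMoment < bumpEnergy)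
    (hκq : ∀ z₀, (∀ x, q x ≤ q z₀) → ∀ x, q z₀ - q x ≤ κ * (x - z₀) ^ 2)
    {A B ρ m η : ℝ} (hAB : |A| + |B| ≤ 1 / 4) (hη : 0 < η)
    (hres : ∀ z, |q z * testFun A B z + testFun (A / 4) (B / 9) z - ρ * testFun A B z - m| ≤ η / 8)
    (hρ : η < ρ) (hρε : ρ + η < 1 / (2 * ((N : ℝ) + 1))) :
    HasStatedSpectrum h (hessian N q hq hp) q ∧ ∃ μ : ℝ,
      IsBifurcatingEigenvalue (hessian N q hq hp) (1 / (2 * ((N : ℝ) + 1))) μ ∧ |μ - ρ| ≤ η := by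
  obtain ⟨z₀, h₀⟩ := exists_forall_le_of_periodic hq Real.two_pi_pos hp
  obtain ⟨z₁, h₁⟩ := exists_forall_ge_of_periodic hq Real.two_pi_pos hp
  set L := hessian N q hq hp with hL
  have hfc : Continuous fun z => q z * deriv U z := hq.mul h.continuous_deriv
  have hfp : Function.Periodic (fun z => q z * deriv U z) (2 * Real.pi) := fun z => by
    simp only [hp z, h.periodic_deriv z]
  -- The wave equation is `(q U')' = U`: thus `q U'` is a second antiderivative of `U'`, and the two
  -- terms of `L U'` cancel.
  have hf : ∀ x : ℝ, HasDerivAt (fun y : ℝ => onCircle N _ hfc hfp y) ((U x : ℝ) : ℂ) x := by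
    intro x
    have e := (h.hasDerivAt_flux hc x).neg.ofReal_comp
    rw [neg_neg] at e
    convert! e using 1
    funext y
    simp [onCircle_coe, hqc]
  have hg : ∀ x : ℝ, HasDerivAt (fun x : ℝ => ((U x : ℝ) : ℂ))
      (onCircle N (deriv U) h.continuous_deriv h.periodic_deriv x) x := fun x =>
    (h.hasDerivAt x).ofReal_comp
  set v₀ : zeroMean N := ⟨_, lpOf_mem_zeroMean hf hg⟩ with hv₀
  have hv : (v₀ : L2per N) = lpOf _ := rfl
  have hLv : L v₀ = 0 := by
    rw [hL, hessian_lpOf hf hg hv]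
    have e : onCircle N q hq hp * onCircle N (deriv U) h.continuous_deriv h.periodic_deriv -
        onCircle N _ hfc hfp = 0 := by
      ext x
      induction x using QuotientAddGroup.induction_on with
      | H x => simp [onCircle_coe]
    rw [e, lpOf, map_zero, map_zero]
  have hv0 : v₀ ≠ 0 := by
    intro h0
    have h2 : onCircle N (deriv U) h.continuous_deriv h.periodic_deriv = 0 := by
      refine ContinuousMap.toLp_injective (p := 2) (𝕜 := ℂ) haarAddCircle ?_
      rw [map_zero]
      exact congrArg Subtype.val h0
    have h3 : deriv U = 0 := by
      funext x
      have := congrArg (fun F => F (x : AddCircle (2 * Real.pi * (N : ℝ)))) h2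
      simpa [onCircle_coe] using this
    obtain ⟨z, hz⟩ := h.ne_zero
    have h4 := h.ode z
    simp [h3] at h4
    exact hz h4
  have hpt : Function.Periodic (fun z => -testFun (A / 4) (B / 9) z) (2 * Real.pi) := fun z =>
    congrArg Neg.neg (periodic_testFun (A / 4) (B / 9) z)
  have hft : ∀ x : ℝ, HasDerivAt (fun y : ℝ => onCircle N (fun z => -testFun (A / 4) (B / 9) z)
      (continuous_testFun _ _).neg
      hpt y)
      ((Real.sin x + A / 2 * Real.sin (2 * x) + B / 3 * Real.sin (3 * x) : ℝ) : ℂ) x := fun x =>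
    (hasDerivAt_neg_testFun A B x).ofReal_comp
  have hgt : ∀ x : ℝ, HasDerivAt
      (fun x : ℝ => ((Real.sin x + A / 2 * Real.sin (2 * x) + B / 3 * Real.sin (3 * x) : ℝ) : ℂ))
      (onCircle N (testFun A B) (continuous_testFun A B) (periodic_testFun A B) x) x := fun x =>
    (hasDerivAt_testFun_antideriv A B x).ofReal_comp
  set V : zeroMean N := ⟨_, lpOf_mem_zeroMean hft hgt⟩ with hV
  have hV1 : (V : L2per N) = lpOf _ := rfl
  have hV2 : 1 / 4 ≤ ‖V‖ := quarter_le_norm_testFun hAB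
  -- The residual is at most `η/8` pointwise, hence in norm, while `‖V‖ ≥ 1/4`.
  have hV3 : ‖L V - (ρ : ℂ) • V‖ < η * ‖V‖ := by
    refine ((norm_hessian_lpOf_sub_le hft hgt hV1 ρ m).trans
      (norm_lpOf_le (C := η / 8) (by positivity) fun x => ?_)).trans_lt ?_
    · refine le_trans (le_of_eq ?_) (hres x)
      simp only [ContinuousMap.sub_apply, ContinuousMap.mul_apply, ContinuousMap.smul_apply,
        ContinuousMap.const_apply, smul_eq_mul]
      rw [onCircle_coe, onCircle_coe, onCircle_coe]
      rw [← Real.norm_eq_abs, ← Complex.norm_real]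
      push_cast
      ring_nf
    · nlinarith
  obtain ⟨l, hl0, hl, hl1, hz1, hpos, hneg, hspec⟩ := exists_bifurcating_hessian (hq := hq)
    (hp := hp) hq1 h₀ hκ (hκq z₀ h₀) hv0 hLv V hV3 (by linarith) hρε
  refine ⟨⟨ReducedOstrovsky.spectrum_hessian h₀ h₁, fun z => ?_, hpos, hz1, ⟨v₀, rfl, ?_⟩, hneg⟩,
    l, ⟨hl0, hl1, hspec⟩, hl.le⟩
  · have h2 := (abs_le.1 (hq1 z)).2
    have h3 : 1 / (4 * ((N : ℝ) + 1)) ≤ 1 / 4 := by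
      rw [div_le_div_iff₀ (by positivity) (by norm_num)]
      have : (0 : ℝ) ≤ N := Nat.cast_nonneg N
      linarith
    linarith
  · have : FiniteDimensional ℂ (eigenspaceAt L 0) := FiniteDimensional.of_finrank_eq_succ hz1
    refine (Submodule.eq_of_le_of_finrank_eq ?_ ?_).symm
    · rw [Submodule.span_singleton_le_iff_mem, Module.End.mem_eigenspace_iff]
      simpa using hLv
    · rw [finrank_span_singleton hv0, hz1]

end WaveSpectrum

/-! ### Approximate eigenfunctions and the final estimates. -/

section MainResults

/-- A uniform smallness condition on the amplitude. -/
theorem exists_smallness (N : ℕ) : ∃ δ > (0 : ℝ), δ ≤ 1 / 12800 ∧ ∀ a γ : ℝ, γ ∈ Ioo 1 (1 + δ) →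
    a ^ 2 ≤ 32 * (γ - 1) → |a| ≤ 1 / (10 ^ 6 * ((N : ℝ) + 1)) ∧ |a| ≤ 1 / 10 ^ 6 ∧
      788 * |a| * bumpMoment < bumpEnergy := by
  have hE := bumpEnergy_pos
  have hM := abs_nonneg bumpMoment
  have hN : (0 : ℝ) ≤ N := Nat.cast_nonneg N
  -- The factor containing `bumpMoment / bumpEnergy` secures the third condition, the others the
  -- first two. Taking `δ ≤ d²/32` turns `a² ≤ 32(γ - 1)` into `|a| ≤ d`.
  set d : ℝ := 1 / (10 ^ 6 * ((N : ℝ) + 1) * (1 + |bumpMoment| / bumpEnergy)) with hd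
  have hd0 : 0 < d := by positivity
  have hMd : 0 ≤ |bumpMoment| / bumpEnergy := by positivity
  have h1 : d ≤ 1 / (10 ^ 6 * ((N : ℝ) + 1)) :=
    one_div_le_one_div_of_le (by positivity) (le_mul_of_one_le_right (by positivity) (by linarith))
  have h2 : 1 / (10 ^ 6 * ((N : ℝ) + 1)) ≤ 1 / 10 ^ 6 :=
    one_div_le_one_div_of_le (by positivity) (by linarith)
  have h3 : 788 * d * |bumpMoment| < bumpEnergy := by
    have e0 : d ≤ 1 / (10 ^ 6 * (|bumpMoment| / bumpEnergy + 1)) :=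
      one_div_le_one_div_of_le (by positivity) (by nlinarith)
    have e : 788 * d * |bumpMoment| ≤ 788 * (1 / (10 ^ 6 * (|bumpMoment| / bumpEnergy + 1))) *
        |bumpMoment| := by gcongr
    refine e.trans_lt ?_
    have e2 : 788 * (1 / (10 ^ 6 * (|bumpMoment| / bumpEnergy + 1))) * |bumpMoment| =
        788 * |bumpMoment| * bumpEnergy / (10 ^ 6 * (|bumpMoment| + bumpEnergy)) := by
      field_simp
    rw [e2, div_lt_iff₀ (by positivity)]
    nlinarith [mul_nonneg hM hE.le, mul_pos hE hE]
  refine ⟨min (1 / 12800) (d ^ 2 / 32), by positivity, min_le_left _ _, fun a γ hγ ha => ?_⟩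
  have h4 : |a| ≤ d := by
    refine abs_le_of_sq_le_sq (ha.trans ?_) hd0.le
    have := hγ.2.le.trans (add_le_add_right (min_le_right _ _) 1)
    linarith
  refine ⟨h4.trans h1, h4.trans (h1.trans h2), lt_of_le_of_lt ?_ h3⟩
  calc 788 * |a| * bumpMoment ≤ 788 * |a| * |bumpMoment| :=
        mul_le_mul_of_nonneg_left (le_abs_self _) (by positivity)
    _ ≤ 788 * d * |bumpMoment| := by gcongr

/-- The coefficients cancel order by order. At order `a`, `cos² z - (3/4)(2/3) cos 2z` leaves the
constant `1/2`. At order `a²`, the `cos z` terms add up to `1/2 - 1/6 = 1/3`, the eigenvalue, and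
the `cos 3z` terms cancel because `(8/9)(9/16) = 1/2`. -/
theorem cubic_residual {a e q z : ℝ} (ha : |a| ≤ 1)
    (hq : q = -1 - a ^ 2 / 6 + a * Real.cos z + a ^ 2 / 3 * Real.cos (2 * z) + e)
    (he : |e| ≤ 1576 * |a| ^ 3) :
    |q * testFun (2 * a / 3) (9 * a ^ 2 / 16) z +
      testFun (2 * a / 3 / 4) (9 * a ^ 2 / 16 / 9) z -
      a ^ 2 / 3 * testFun (2 * a / 3) (9 * a ^ 2 / 16) z - a / 2| ≤ 6400 * |a| ^ 3 := by
  have h0 := abs_nonneg a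
  have e1 : q * testFun (2 * a / 3) (9 * a ^ 2 / 16) z +
      testFun (2 * a / 3 / 4) (9 * a ^ 2 / 16 / 9) z -
      a ^ 2 / 3 * testFun (2 * a / 3) (9 * a ^ 2 / 16) z - a / 2 =
      e * testFun (2 * a / 3) (9 * a ^ 2 / 16) z +
      a ^ 3 * (-(1 / 9) * Real.cos (2 * z) + 9 / 16 * (Real.cos z * Real.cos (3 * z)) +
        2 / 9 * Real.cos (2 * z) ^ 2 - 2 / 9 * Real.cos (2 * z)) +
      a ^ 4 * (-(3 / 32) * Real.cos (3 * z) + 3 / 16 * (Real.cos (2 * z) * Real.cos (3 * z)) -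
        3 / 16 * Real.cos (3 * z)) := by
    rw [hq]
    simp only [testFun, Real.cos_two_mul, Real.cos_three_mul]
    ring
  have c1 := Real.abs_cos_le_one z
  have c2 := Real.abs_cos_le_one (2 * z)
  have c3 := Real.abs_cos_le_one (3 * z)
  have c13 : |Real.cos z * Real.cos (3 * z)| ≤ 1 := by
    rw [abs_mul]; exact mul_le_one₀ c1 (abs_nonneg _) c3
  have c23 : |Real.cos (2 * z) * Real.cos (3 * z)| ≤ 1 := by
    rw [abs_mul]; exact mul_le_one₀ c2 (abs_nonneg _) c3
  have c22 : |Real.cos (2 * z) ^ 2| ≤ 1 := by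
    rw [abs_pow]; exact pow_le_one₀ (abs_nonneg _) c2
  rw [abs_le] at c1 c2 c3 c13 c23 c22
  have h1 : |testFun (2 * a / 3) (9 * a ^ 2 / 16) z| ≤ 3 := by
    refine (abs_testFun_le _ _ _).trans ?_
    rw [abs_div, abs_mul, abs_div, abs_mul, abs_pow]
    norm_num
    have : a ^ 2 ≤ 1 := by nlinarith [sq_abs a]
    linarith
  have h2 : |-(1 / 9) * Real.cos (2 * z) + 9 / 16 * (Real.cos z * Real.cos (3 * z)) +
        2 / 9 * Real.cos (2 * z) ^ 2 - 2 / 9 * Real.cos (2 * z)| ≤ 2 := by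
    rw [abs_le]
    constructor <;> linarith
  have h3 : |-(3 / 32) * Real.cos (3 * z) + 3 / 16 * (Real.cos (2 * z) * Real.cos (3 * z)) -
        3 / 16 * Real.cos (3 * z)| ≤ 1 := by
    rw [abs_le]
    constructor <;> linarith
  rw [e1]
  refine (abs_add_three _ _ _).trans ?_
  rw [abs_mul, abs_mul, abs_mul, abs_pow, abs_pow]
  have i1 := mul_le_mul he h1 (abs_nonneg _) (by positivity)
  have i2 := mul_le_mul_of_nonneg_left h2 (by positivity : 0 ≤ |a| ^ 3)
  have i3 := mul_le_mul_of_nonneg_left h3 (by positivity : 0 ≤ |a| ^ 4)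
  have i4 : |a| ^ 4 ≤ |a| ^ 3 := pow_le_pow_of_le_one h0 ha (by norm_num)
  have i5 : 0 ≤ |a| ^ 3 := by positivity
  linarith

/-- At order `a²`, `-(1/8) cos z + (1/2) cos³ z = (1/4) cos z + (1/8) cos 3z`; the first term gives
the eigenvalue, the second is cancelled since `(8/9)(9/64) = 1/8`. No constant arises. -/
theorem quartic_residual {a e q z : ℝ} (ha : |a| ≤ 1)
    (hq : q = -1 - a ^ 2 / 8 + a ^ 2 / 2 * Real.cos z ^ 2 + e) (he : |e| ≤ 2000 * |a| ^ 4) :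
    |q * testFun 0 (9 * a ^ 2 / 64) z + testFun (0 / 4) (9 * a ^ 2 / 64 / 9) z -
      a ^ 2 / 4 * testFun 0 (9 * a ^ 2 / 64) z - 0| ≤ 6400 * |a| ^ 4 := by
  have h0 := abs_nonneg a
  have e1 : q * testFun 0 (9 * a ^ 2 / 64) z + testFun (0 / 4) (9 * a ^ 2 / 64 / 9) z -
      a ^ 2 / 4 * testFun 0 (9 * a ^ 2 / 64) z - 0 =
      e * testFun 0 (9 * a ^ 2 / 64) z +
      a ^ 4 * (9 / 64 * (-(3 / 8) * Real.cos (3 * z) +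
        1 / 2 * (Real.cos z ^ 2 * Real.cos (3 * z)))) := by
    rw [hq]
    simp only [testFun, Real.cos_three_mul]
    ring
  have c1 := Real.abs_cos_le_one z
  have c3 := Real.abs_cos_le_one (3 * z)
  have c13 : |Real.cos z ^ 2 * Real.cos (3 * z)| ≤ 1 := by
    rw [abs_mul, abs_pow]; exact mul_le_one₀ (pow_le_one₀ (abs_nonneg _) c1) (abs_nonneg _) c3
  rw [abs_le] at c3 c13
  have h1 : |testFun 0 (9 * a ^ 2 / 64) z| ≤ 3 := by
    refine (abs_testFun_le _ _ _).trans ?_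
    rw [abs_zero, abs_div, abs_mul, abs_pow]
    norm_num
    have : a ^ 2 ≤ 1 := by nlinarith [sq_abs a]
    linarith
  have h2 : |9 / 64 * (-(3 / 8) * Real.cos (3 * z) +
        1 / 2 * (Real.cos z ^ 2 * Real.cos (3 * z)))| ≤ 1 := by
    rw [abs_le]
    constructor <;> linarith
  rw [e1]
  refine (abs_add_le _ _).trans ?_
  rw [abs_mul, abs_mul, abs_pow]
  have i1 := mul_le_mul he h1 (abs_nonneg _) (by positivity)
  have i2 := mul_le_mul_of_nonneg_left h2 (by positivity : 0 ≤ |a| ^ 4)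
  have i5 : 0 ≤ |a| ^ 4 := by positivity
  linarith

theorem IsOstrovskyWave.main {N : ℕ} [NeZero N] {γ : ℝ} {U : ℝ → ℝ} (h : IsOstrovskyWave γ U)
    (hγ : 1 < γ) (hγ' : γ < 1 + 1 / 12800) {a : ℝ} (ha : a = amplitude U)
    (hs : |a| ≤ 1 / (10 ^ 6 * ((N : ℝ) + 1)) ∧ |a| ≤ 1 / 10 ^ 6 ∧
      788 * |a| * bumpMoment < bumpEnergy) :
    HasStatedSpectrum h (ostrovskyHessian N h) (fun z => -γ + U z) ∧
      (∀ z, |U z - a * Real.cos z| ≤ a ^ 2) ∧ ∃ μ : ℝ,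
      IsBifurcatingEigenvalue (ostrovskyHessian N h) (1 / (2 * ((N : ℝ) + 1))) μ ∧
        |μ - a ^ 2 / 3| ≤ 51200 * |a| ^ 3 := by
  obtain ⟨ha0, -, hU, hγa⟩ := h.expansion hγ hγ' ha
  obtain ⟨hs1, hs2, hs3⟩ := hs
  have h0 : 0 < |a| := abs_pos.2 ha0
  have hN : (0 : ℝ) ≤ N := Nat.cast_nonneg N
  have hd : |a| * 10 ^ 6 ≤ 1 / ((N : ℝ) + 1) := by
    rw [← div_div, div_right_comm] at hs1
    linarith
  have hsq : |a| ^ 2 = a ^ 2 := sq_abs a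
  have ha2 : a ^ 2 ≤ |a| / 10 ^ 6 := by rw [← hsq]; nlinarith
  have ha2' : 0 < a ^ 2 := by positivity
  have ha3 : |a| ^ 3 ≤ a ^ 2 / 10 ^ 6 := by rw [pow_succ, hsq]; nlinarith
  have ha3' : 0 < |a| ^ 3 := by positivity
  have hUc (z : ℝ) : |U z - a * Real.cos z| ≤ a ^ 2 := by
    have e : U z - a * Real.cos z = (U z - (a * Real.cos z + a ^ 2 / 3 * Real.cos (2 * z))) +
      a ^ 2 / 3 * Real.cos (2 * z) := by ring
    have e2 : |a ^ 2 / 3 * Real.cos (2 * z)| ≤ a ^ 2 / 3 := by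
      rw [abs_mul, abs_of_pos (by positivity : 0 < a ^ 2 / 3)]
      exact mul_le_of_le_one_right (by positivity) (Real.abs_cos_le_one _)
    rw [e]
    refine (abs_add_le _ _).trans ?_
    linarith [hU z]
  have hUM (z : ℝ) : |U z| ≤ 2 * |a| := by
    have e : U z = (U z - a * Real.cos z) + a * Real.cos z := by ring
    rw [e]
    refine (abs_add_le _ _).trans ?_
    linarith [hUc z, abs_mul_cos_le a z]
  have hc : Differentiable ℝ fun u : ℝ => γ - u := by fun_prop
  have hdU := h.deriv_bounds hc (M := 2 * |a|) (by linarith) hUM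
    (fun z => by linarith [(abs_le.1 (hUM z)).2])
    (fun z => by
      have : deriv (fun u : ℝ => γ - u) (U z) = -1 := ((hasDerivAt_id (U z)).const_sub γ).deriv
      rw [this]; simp)
  have hq1 (x : ℝ) : |-γ + U x + 1| ≤ 1 / (4 * ((N : ℝ) + 1)) := by
    rw [mul_comm (4 : ℝ), ← div_div]
    have e2 := abs_le.1 hγa
    have e3 := abs_le.1 (hUM x)
    rw [abs_le]
    constructor <;> linarith
  -- `κ = 788|a|` is the bound `394 · 2|a|` on `U''`, and `η` is eight times the bound on the
  -- residual.
  have key := h.spectrum_hessian (N := N) (q := fun z => -γ + U z) hc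
    (continuous_const.add h.continuous) (fun z => by simp only [h.periodic z])
    (fun z => by ring) hq1 (κ := 788 * |a|) hs3
    (fun z₀ h₀ => sub_le_of_isMax (f₁ := deriv U) (f₂ := deriv (deriv U))
      (fun x => (h.hasDerivAt x).const_add _) h.hasDerivAt_deriv
      (fun x => (hdU x).2.trans (by linarith)) h₀)
    (A := 2 * a / 3) (B := 9 * a ^ 2 / 16) (ρ := a ^ 2 / 3) (m := a / 2) (η := 51200 * |a| ^ 3)
    (by
      rw [abs_div, abs_mul, abs_div, abs_mul, abs_pow]
      norm_num
      linarith)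
    (by positivity)
    (fun z => by
      refine (cubic_residual (e := -(γ - 1 - a ^ 2 / 6) +
        (U z - (a * Real.cos z + a ^ 2 / 3 * Real.cos (2 * z)))) (by linarith) (by ring)
        ?_).trans (by linarith)
      refine (abs_add_le _ _).trans ?_
      rw [abs_neg]
      linarith [hU z])
    (by linarith)
    (by
      rw [mul_comm (2 : ℝ), ← div_div]
      linarith)
  exact ⟨key.1, hUc, key.2⟩

theorem IsModifiedWave.main {N : ℕ} [NeZero N] {γ : ℝ} {U : ℝ → ℝ} (h : IsModifiedWave γ U)
    (hγ : 1 < γ) (hγ' : γ < 1 + 1 / 12800) {a : ℝ} (ha : a = amplitude U)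
    (hs : |a| ≤ 1 / (10 ^ 6 * ((N : ℝ) + 1)) ∧ |a| ≤ 1 / 10 ^ 6 ∧
      788 * |a| * bumpMoment < bumpEnergy) :
    HasStatedSpectrum h (modifiedHessian N h) (fun z => -γ + U z ^ 2 / 2) ∧
      ∃ μ : ℝ, IsBifurcatingEigenvalue (modifiedHessian N h) (1 / (2 * ((N : ℝ) + 1))) μ ∧
        |μ - a ^ 2 / 4| ≤ 51200 * |a| ^ 4 := by
  obtain ⟨ha0, -, hU, hγa⟩ := h.expansion hγ hγ' ha
  obtain ⟨hs1, hs2, hs3⟩ := hs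
  have h0 : 0 < |a| := abs_pos.2 ha0
  have hN : (0 : ℝ) ≤ N := Nat.cast_nonneg N
  have hd : |a| * 10 ^ 6 ≤ 1 / ((N : ℝ) + 1) := by
    rw [← div_div, div_right_comm] at hs1
    linarith
  have hsq : |a| ^ 2 = a ^ 2 := sq_abs a
  have ha2 : a ^ 2 ≤ |a| / 10 ^ 6 := by rw [← hsq]; nlinarith
  have ha2' : 0 < a ^ 2 := by positivity
  have ha3 : |a| ^ 3 ≤ a ^ 2 / 10 ^ 6 := by rw [pow_succ, hsq]; nlinarith
  have ha3' : 0 < |a| ^ 3 := by positivity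
  have ha4 : |a| ^ 4 ≤ |a| ^ 3 / 10 ^ 6 := by rw [pow_succ]; nlinarith
  have ha4' : 0 < |a| ^ 4 := by positivity
  have hUM (z : ℝ) : |U z| ≤ 2 * |a| := by
    have e : U z = (U z - a * Real.cos z) + a * Real.cos z := by ring
    rw [e]
    refine (abs_add_le _ _).trans ?_
    linarith [hU z, abs_mul_cos_le a z]
  have hU2 (z : ℝ) : U z ^ 2 ≤ 4 * a ^ 2 := by
    have := pow_le_pow_left₀ (abs_nonneg _) (hUM z) 2
    rw [sq_abs, mul_pow, hsq] at this
    linarith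
  have hc : Differentiable ℝ fun u : ℝ => γ - u ^ 2 / 2 := by fun_prop
  have hdU := h.deriv_bounds hc (M := 2 * |a|) (by linarith) hUM
    (fun z => by linarith [hU2 z])
    (fun z => by
      have e : HasDerivAt (fun u : ℝ => γ - u ^ 2 / 2) (-U z) (U z) := by
        convert! ((((hasDerivAt_id (U z)).pow 2).div_const 2).const_sub γ) using 1
        simp
      rw [e.deriv, abs_neg]
      linarith [hUM z])
  have hq1 (x : ℝ) : |-γ + U x ^ 2 / 2 + 1| ≤ 1 / (4 * ((N : ℝ) + 1)) := by
    rw [mul_comm (4 : ℝ), ← div_div]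
    have e2 := abs_le.1 hγa
    have e3 := hU2 x
    have e4 := sq_nonneg (U x)
    rw [abs_le]
    constructor <;> linarith
  have key := h.spectrum_hessian (N := N) (q := fun z => -γ + U z ^ 2 / 2) hc
    (continuous_const.add ((h.continuous.pow 2).div_const 2))
    (fun z => by simp only [h.periodic z])
    (fun z => by ring) hq1 (κ := 788 * |a|) hs3
    (fun z₀ h₀ => sub_le_of_isMax (f₁ := fun z => U z * deriv U z)
      (f₂ := fun z => deriv U z * deriv U z + U z * deriv (deriv U) z)
      (fun x => by
        convert! ((((h.hasDerivAt x).pow 2).div_const 2).const_add (-γ)) using 1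
        push_cast
        ring)
      (fun x => (h.hasDerivAt x).mul (h.hasDerivAt_deriv x))
      (fun x => by
        -- The second derivative of `U²/2` is bounded by `(784 + 1576) a²`, far below `788|a|` as
        -- `|a| ≤ 10⁻⁶`.
        refine (abs_add_le _ _).trans ?_
        rw [abs_mul, abs_mul]
        have e1 := mul_le_mul (hdU x).1 (hdU x).1 (abs_nonneg _) (by positivity)
        have e2 := mul_le_mul (hUM x) (hdU x).2 (abs_nonneg _) (by positivity)
        have e3 : 14 * (2 * |a|) * (14 * (2 * |a|)) = 784 * a ^ 2 := by rw [← hsq]; ring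
        have e4 : 2 * |a| * (394 * (2 * |a|)) = 1576 * a ^ 2 := by rw [← hsq]; ring
        linarith) h₀)
    (A := 0) (B := 9 * a ^ 2 / 64) (ρ := a ^ 2 / 4) (m := 0) (η := 51200 * |a| ^ 4)
    (by
      rw [abs_zero, abs_of_nonneg (by positivity)]
      linarith)
    (by positivity)
    (fun z => by
      refine (quartic_residual (e := -(γ - 1 - a ^ 2 / 8) +
        (U z - a * Real.cos z) * (U z + a * Real.cos z) / 2) (by linarith) (by ring)
        ?_).trans (by linarith)
      refine (abs_add_le _ _).trans ?_
      rw [abs_neg, abs_div, abs_mul, abs_two]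
      have e1 : |U z + a * Real.cos z| ≤ 2 * |a| + |a| / 1000 := by
        have e : U z + a * Real.cos z = (U z - a * Real.cos z) + 2 * (a * Real.cos z) := by ring
        rw [e]
        refine (abs_add_le _ _).trans ?_
        rw [abs_mul 2, abs_two]
        linarith [hU z, abs_mul_cos_le a z]
      have e2 := mul_le_mul (hU z) e1 (abs_nonneg _) (by positivity)
      have e3 : 1440 * |a| ^ 3 * (2 * |a| + |a| / 1000) = 1440 * (2 + 1 / 1000) * |a| ^ 4 := by ring
      linarith)
    (by linarith)
    (by
      rw [mul_comm (2 : ℝ), ← div_div]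
      linarith)
  exact key

end MainResults

end ReducedOstrovsky

end

theorem mainTheorem6 (N : ℕ) [NeZero N] :
    (∃ δ > (0 : ℝ), ∃ ε > (0 : ℝ), ∃ C : ℝ, ∀ γ ∈ Set.Ioo (1 : ℝ) (1 + δ),
      (∃ U : ℝ → ℝ, ReducedOstrovsky.IsOstrovskyWave γ U) ∧
      ∀ (U : ℝ → ℝ) (h : ReducedOstrovsky.IsOstrovskyWave γ U),
        ReducedOstrovsky.HasStatedSpectrum h (ReducedOstrovsky.ostrovskyHessian N h)
          (fun z => -γ + U z) ∧
        ReducedOstrovsky.amplitude U ^ 2 ≤ C * (γ - 1) ∧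
        (∀ z, |U z - ReducedOstrovsky.amplitude U * Real.cos z| ≤
          C * ReducedOstrovsky.amplitude U ^ 2) ∧
        ∃ μ : ℝ,
          ReducedOstrovsky.IsBifurcatingEigenvalue (ReducedOstrovsky.ostrovskyHessian N h) ε μ ∧
          |μ - ReducedOstrovsky.amplitude U ^ 2 / 3| ≤ C * |ReducedOstrovsky.amplitude U| ^ 3) ∧
    (∃ δ > (0 : ℝ), ∃ ε > (0 : ℝ), ∃ C : ℝ, ∀ γ ∈ Set.Ioo (1 : ℝ) (1 + δ),
      (∃ U : ℝ → ℝ, ReducedOstrovsky.IsModifiedWave γ U) ∧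
      ∀ (U : ℝ → ℝ) (h : ReducedOstrovsky.IsModifiedWave γ U),
        ReducedOstrovsky.HasStatedSpectrum h (ReducedOstrovsky.modifiedHessian N h)
          (fun z => -γ + U z ^ 2 / 2) ∧
        ReducedOstrovsky.amplitude U ^ 2 ≤ C * (γ - 1) ∧
        (∀ z, |U z - ReducedOstrovsky.amplitude U * Real.cos z| ≤
          C * |ReducedOstrovsky.amplitude U| ^ 3) ∧
        ∃ μ : ℝ,
          ReducedOstrovsky.IsBifurcatingEigenvalue (ReducedOstrovsky.modifiedHessian N h) ε μ ∧
          |μ - ReducedOstrovsky.amplitude U ^ 2 / 4| ≤ C * ReducedOstrovsky.amplitude U ^ 4) := by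
  obtain ⟨δ, hδ, hδ', hs⟩ := ReducedOstrovsky.exists_smallness N
  have hN : (0 : ℝ) ≤ N := Nat.cast_nonneg N
  -- `51200 = 8 · 6400` comes from the residuals; it also exceeds the constants `32` and `1440` of
  -- the expansions.
  refine ⟨⟨δ, hδ, 1 / (2 * ((N : ℝ) + 1)), by positivity, 51200, fun γ hγ => ⟨?_, fun U h => ?_⟩⟩,
    ⟨δ, hδ, 1 / (2 * ((N : ℝ) + 1)), by positivity, 51200, fun γ hγ => ⟨?_, fun U h => ?_⟩⟩⟩
  · obtain ⟨β, hβ, hβγ, rfl⟩ := ReducedOstrovsky.exists_sq_eq hγ.1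
    exact ReducedOstrovsky.exists_ostrovskyWave hβ (by linarith [hγ.2])
  · have hγ' : γ < 1 + 1 / 12800 := by linarith [hγ.2]
    have h1 := (h.expansion hγ.1 hγ' rfl).2.1
    obtain ⟨h2, h3, h4⟩ := h.main (N := N) hγ.1 hγ' rfl (hs _ γ hγ h1)
    refine ⟨h2, by linarith [hγ.1], fun z => (h3 z).trans ?_, h4⟩
    exact le_mul_of_one_le_left (sq_nonneg _) (by norm_num)
  · obtain ⟨β, hβ, hβγ, rfl⟩ := ReducedOstrovsky.exists_sq_eq hγ.1
    exact ReducedOstrovsky.exists_modifiedWave hβ (by linarith [hγ.2])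
  · have hγ' : γ < 1 + 1 / 12800 := by linarith [hγ.2]
    obtain ⟨-, h1, h2, -⟩ := h.expansion hγ.1 hγ' rfl
    obtain ⟨h3, μ, h4, h5⟩ := h.main (N := N) hγ.1 hγ' rfl (hs _ γ hγ h1)
    refine ⟨h3, by linarith [hγ.1], fun z => (h2 z).trans ?_, μ, h4, ?_⟩
    · exact mul_le_mul_of_nonneg_right (by norm_num) (by positivity)
    · rwa [Even.pow_abs (by decide)] at h5
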